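/- Let $d\ge 1$, $0<\alpha\le 2$, $\nu>0$, $0<a<1$ and $T>0$. Let $X$ be a continuous time, rate one random walk on $\mathbf Z^d$ started at $0$ with dislocation (step) distribution $\mu$; that is, $X_t=\sum_{n=1}^{N_t}\xi_n$, where $N$ is a Poisson process of rate one and $\xi_1,\xi_2,\dots$ are i.i.d. with law $\mu$, independent of $N$. Let $$\hat\mu(z)=\sum_{k\in\mathbf Z^d}e^{iz\cdot k}\mu(\{k\}),\qquad p_t(x)=\frac1{(2\pi)^d}\int_{\mathbf R^d}e^{-ix\cdot z}e^{-t\nu|z|^\alpha}\,dz,$$ so that $p_t$ is the heat kernel of $-\nu(-\Delta)^{\alpha/2}$. Define $\mathcal D$ and $\mathcal E_{k,i}$ by $$\hat\mu(z)=1-\nu|z|^\alpha+\mathcal D(z),\qquad \frac{\partial^k}{\partial z_i^k}\hat\mu(z)=-\nu\frac{\partial^k}{\partial z_i^k}|z|^\alpha+\mathcal E_{k,i}(z)\quad(k\ge1,\ 1\le i\le d).$$ Assumption 1: $\{z\in(-\pi,\pi]^d:\hat\mu(z)=1\}=\{0\}$, and $\mathcal D(z)=O(|z|^{a+\alpha})$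 as $z\to0$. Assumption 2: $\mathcal D$ is $d+3$ times continuously differentiable in a neighbourhood in $\mathbf R^d$ of every point of $(-\pi,\pi]^d\setminus\{0\}$ (with $\hat\mu$ regarded as a periodic function on $\mathbf R^d$), and $\mathcal E_{k,i}(z)=O(|z|^{\alpha+a-k})$ as $z\to0$, for all $1\le k\le d+3$ and $1\le i\le d$. (i) If Assumption 1 holds, there is a constant $C$ such that for all $\epsilon>0$, $\epsilon^\alpha\le t\le T$ and $x\in\epsilon\mathbf Z^d$, $$\left|\frac1{\epsilon^d}P(\epsilon X_{t/\epsilon^\alpha}=x)-p_t(x)\right|\le C\,\frac{\epsilon^a}{t^{(d+a)/\alpha}}.$$ (ii) If Assumptions 1 and 2 hold, there is a constant $C$ such that for all $\epsilon>0$, $\epsilon^\alpha\le t\le T$ and $x\in\epsilon\mathbf Z^d$ with $|x|\ge t^{1/\alpha}$, $$\left|\frac1{\epsilon^d}P(\epsilon X_{t/\epsilon^\alpha}=x)-p_t(x)\right|\le C\,\frac{t\,\epsilon^a}{|x|^{d+\alpha+a}}.$$ (iii) If Assumptions 1 and 2 hold and $\alpha<2$, there is a constant $C$ such that for all $\epsilon>0$,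 $\epsilon^\alpha\le t\le T$ and $x\in\epsilon\mathbf Z^d$, $$\left|\frac1{\epsilon^d}P(\epsilon X_{t/\epsilon^\alpha}=x)-p_t(x)\right|\le C\,\frac{\epsilon^a\,p_t(x)}{t^{a/\alpha}}.$$ -/

import Mathlib

open MeasureTheory ProbabilityTheory Filter Topology
open scoped NNReal

namespace LocalLimit

/-- `ℝ^d` with the Euclidean norm. -/
abbrev Space (d : ℕ) : Type := EuclideanSpace ℝ (Fin d)

/-- The inclusion of `ℤ^d` in `ℝ^d`. -/
noncomputable def toSpace {d : ℕ} (k : Fin d → ℤ) : Space d :=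
  WithLp.toLp 2 (fun i => (k i : ℝ))

/-- The lattice `ε ℤ^d`. -/
def lattice (d : ℕ) (ε : ℝ) : Set (Space d) :=
  Set.range (fun k : Fin d → ℤ => ε • toSpace k)

/-- `N` is a Poisson process of rate one. -/
structure IsPoissonProcess {Ω : Type*} [MeasurableSpace Ω] (P : Measure Ω)
    (N : ℝ≥0 → Ω → ℕ) : Prop where
  measurable : ∀ t, Measurable (N t)
  zero : ∀ ω, N 0 ω = 0
  mono : ∀ ω, Monotone (fun t => N t ω)
  right_continuous : ∀ ω t, ContinuousWithinAt (fun s => N s ω) (Set.Ici t) t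
  indep_increments : HasIndepIncrements N P
  increment_law : ∀ s t : ℝ≥0, s ≤ t →
    HasLaw (fun ω => N t ω - N s ω) (poissonMeasure (t - s)) P

/-- `X` is a continuous time, rate one random walk on `ℤ^d` started at `0`: at the jump times of
a rate one Poisson process it makes i.i.d. steps with law `μ`, independent of that process.
When `μ {0} = 0`, `μ` is the law of `X` at the first time that `X` differs from `0`. -/
def IsRateOneWalk {d : ℕ} {Ω : Type*} [MeasurableSpace Ω] (P : Measure Ω)
    (μ : Measure (Fin d → ℤ)) (X : ℝ≥0 → Ω → (Fin d → ℤ)) : Prop :=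
  ∃ (N : ℝ≥0 → Ω → ℕ) (ξ : ℕ → Ω → (Fin d → ℤ)),
    IsPoissonProcess P N ∧
    (∀ n, Measurable (ξ n)) ∧
    (∀ n, HasLaw (ξ n) μ P) ∧
    iIndepFun ξ P ∧
    IndepFun (fun ω t => N t ω) (fun ω n => ξ n ω) P ∧
    ∀ t ω, X t ω = ∑ n ∈ Finset.range (N t ω), ξ n ω

/-- The characteristic function `μ̂(z) = ∑_k e^{i z·k} μ(k)`, as a periodic function on `ℝ^d`. -/
noncomputable def charFn {d : ℕ} (μ : Measure (Fin d → ℤ)) (z : Space d) : ℂ :=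
  ∑' k : Fin d → ℤ, Complex.exp (Complex.I * (inner ℝ z (toSpace k) : ℝ)) * (μ.real {k} : ℂ)

/-- `|z|^α`, as a complex valued function. -/
noncomputable def normPow {d : ℕ} (α : ℝ) (z : Space d) : ℂ := ((‖z‖ ^ α : ℝ) : ℂ)

/-- The remainder `D` in `μ̂(z) = 1 - ν |z|^α + D(z)`. -/
noncomputable def remainder {d : ℕ} (μ : Measure (Fin d → ℤ)) (α ν : ℝ) (z : Space d) : ℂ :=
  charFn μ z - 1 + ν * normPow α z

/-- The pure partial derivative `∂^k f / ∂z_i^k` at `z`. -/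
noncomputable def partialDeriv {d : ℕ} (k : ℕ) (i : Fin d) (f : Space d → ℂ) (z : Space d) : ℂ :=
  iteratedDeriv k (fun s : ℝ => f (z + s • EuclideanSpace.single i (1 : ℝ))) 0

/-- The remainder `E_{k,i}` in `∂_i^k μ̂(z) = -ν ∂_i^k |z|^α + E_{k,i}(z)`. -/
noncomputable def derivRemainder {d : ℕ} (μ : Measure (Fin d → ℤ)) (α ν : ℝ)
    (k : ℕ) (i : Fin d) (z : Space d) : ℂ :=
  partialDeriv k i (charFn μ) z + ν * partialDeriv k i (normPow α) z

/-- The cube `(-π, π]^d`, a fundamental domain of the torus. -/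
def cube (d : ℕ) : Set (Space d) := {z | ∀ i, z i ∈ Set.Ioc (-Real.pi) Real.pi}

/-- First assumption on the walk: on `(-π, π]^d`, `μ̂ = 1` only at the origin, and
`D(z) = O(|z|^{a+α})` as `z → 0`. -/
structure Assumption1 {d : ℕ} (μ : Measure (Fin d → ℤ)) (α ν a : ℝ) : Prop where
  eq_one_iff : {z ∈ cube d | charFn μ z = 1} = {0}
  remainder_isBigO : remainder μ α ν =O[𝓝 0] fun z => ‖z‖ ^ (a + α)

/-- Second assumption on the walk: away from the origin of the torus, `D` is `d + 3` times
continuously differentiable, and `E_{k,i}(z) = O(|z|^{α+a-k})` as `z → 0`, for `1 ≤ k ≤ d + 3`.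
Differentiability at points of the boundary of the cube refers to the periodic function `μ̂`
on a full neighbourhood in `ℝ^d`. -/
structure Assumption2 {d : ℕ} (μ : Measure (Fin d → ℤ)) (α ν a : ℝ) : Prop where
  contDiffAt : ∀ z ∈ cube d, z ≠ 0 → ContDiffAt ℝ ((d + 3 : ℕ) : WithTop ℕ∞) (remainder μ α ν) z
  derivRemainder_isBigO : ∀ k : ℕ, 1 ≤ k → k ≤ d + 3 → ∀ i : Fin d,
    derivRemainder μ α ν k i =O[𝓝[≠] 0] fun z => ‖z‖ ^ (α + a - k)

/-- The heat kernel of `-ν (-Δ)^{α/2}`, that is, the transition density of the isotropic strictly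
`α`-stable process: `p_t(x) = (2π)^{-d} ∫ e^{-i x·z} e^{-tν|z|^α} dz`. The integral is real. -/
noncomputable def heatKernel {d : ℕ} (α ν t : ℝ) (x : Space d) : ℝ :=
  (((2 * Real.pi) ^ d)⁻¹ : ℝ) *
    (∫ z : Space d, Complex.exp (-Complex.I * (inner ℝ x z : ℝ)) *
      (Real.exp (-t * ν * ‖z‖ ^ α) : ℂ)).re

/-- `|ε^{-d} P(ε X_{t/ε^α} = x) - p_t(x)|`. -/
noncomputable def localError {d : ℕ} {Ω : Type*} [MeasurableSpace Ω] (P : Measure Ω)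
    (X : ℝ≥0 → Ω → (Fin d → ℤ)) (α ν ε t : ℝ) (x : Space d) : ℝ :=
  |(ε ^ d)⁻¹ * P.real {ω | ε • toSpace (X (t / ε ^ α).toNNReal ω) = x} - heatKernel α ν t x|

end LocalLimit

/-!
By Fourier inversion on `(-π, π]^d`, the error at lattice spacing one and time `s = t / ε ^ α` is
the Fourier integral of the difference of `exp (s (μ̂ - 1))` on the cube and `exp (-s ν |z|^α)` on
`ℝ^d`. Since `Re (1 - μ̂ z) ≥ c |z|^α` on the cube, the difference there is at most a multiple of
`s |z|^(α + a) exp (-c s |z|^α)`, whose integral is of order `s^(-(d + a) / α)`.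

For the decay in `x = ε k`, integration by parts would meet derivatives of `|z|^α` that are not
integrable at the origin. Instead take `d + 3` finite differences with step `h = π / |k i|` in the
direction of a largest coordinate of `k`. Each of them multiplies the Fourier integral by `-2`,
while the differenced symbols are at most a multiple of
`s h^(d + 3) (h + |z|)^(α + a - (d + 3))`: for `|z|` of order `h` no smoothness is needed, and for
larger `|z|` the derivatives are controlled. As `α + a < 3`, this is integrable, with integral of
order `s h^(d + α + a)`.

The relative bound follows from these two and `p_t x ≥ c t / (t^(1 / α) + |x|)^(d + α)`. For the
latter, the Lévy–Khintchine representation of `ν |z|^α` (`α < 2`) splits off from the stable law an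
independent compound Poisson part, whose jumps have density of order `(1 + |y|)^(-(d + α))`.
Nonnegativity of the remaining factor is proved directly, by approximating its transform with
exponentials of nonnegative cosine transforms, so no theory of Lévy processes is needed.
-/

namespace LocalLimit

/-! ### Finite differences and exponentials -/

section Line

variable {𝕜 E : Type*} [NontriviallyNormedField 𝕜] [NormedAddCommGroup E] [NormedSpace 𝕜 E]

lemma differentiableAt_iteratedDeriv {n : WithTop ℕ∞} {m : ℕ} {f : 𝕜 → E} {u : 𝕜}
    (hf : ContDiffAt 𝕜 n f u) (hmn : m < n) : DifferentiableAt 𝕜 (iteratedDeriv m f) u := by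
  rw [← differentiableWithinAt_univ, ← iteratedDerivWithin_univ]
  exact ContDiffWithinAt.differentiableWithinAt_iteratedDerivWithin hf hmn
    (by simp [uniqueDiffOn_univ])

lemma contDiffAt_fwdDiff {n : WithTop ℕ∞} {f : 𝕜 → E} {h y : 𝕜} (hf : ContDiffAt 𝕜 n f y)
    (hfh : ContDiffAt 𝕜 n f (y + h)) : ContDiffAt 𝕜 n (fwdDiff h f) y :=
  (hfh.comp (f := fun v => v + h) y (by fun_prop)).sub hf

lemma iteratedDeriv_fwdDiff {m : ℕ} {f : 𝕜 → E} {h y : 𝕜} (hf : ContDiffAt 𝕜 m f y)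
    (hfh : ContDiffAt 𝕜 m f (y + h)) :
    iteratedDeriv m (fwdDiff h f) y = fwdDiff h (iteratedDeriv m f) y := by
  have hshift : ContDiffAt 𝕜 m (fun v => f (v + h)) y :=
    hfh.comp (f := fun v => v + h) y (by fun_prop)
  change iteratedDeriv m ((fun v => f (v + h)) - f) y = _
  rw [iteratedDeriv_sub hshift hf, iteratedDeriv_comp_add_const, fwdDiff]

lemma norm_iterate_fwdDiff_le {E : Type*} [NormedAddCommGroup E] [NormedSpace ℝ E] (m : ℕ)
    {f : ℝ → E} {h y M : ℝ} (hh : 0 ≤ h)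
    (hf : ∀ u ∈ Set.Icc y (y + m * h), ContDiffAt ℝ m f u)
    (hM : ∀ u ∈ Set.Icc y (y + m * h), ‖iteratedDeriv m f u‖ ≤ M) :
    ‖(fwdDiff h)^[m] f y‖ ≤ h ^ m * M := by
  induction m generalizing f M with
  | zero => simpa using hM y (by simp)
  | succ m ih =>
    have hsub : ∀ u ∈ Set.Icc y (y + m * h), Set.Icc u (u + h) ⊆
        Set.Icc y (y + (m + 1 : ℕ) * h) := fun u hu =>
      Set.Icc_subset_Icc hu.1 (by push_cast; linarith [hu.2])
    have hsmooth : ∀ u ∈ Set.Icc y (y + m * h), ∀ v ∈ Set.Icc u (u + h), ContDiffAt ℝ m f v :=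
      fun u hu v hv => (hf v (hsub u hu hv)).of_le (by exact_mod_cast m.le_succ)
    have hleft : ∀ u : ℝ, u ∈ Set.Icc u (u + h) := fun u => ⟨le_rfl, by linarith⟩
    have hright : ∀ u : ℝ, u + h ∈ Set.Icc u (u + h) := fun u => ⟨by linarith, le_rfl⟩
    have hmean : ∀ u ∈ Set.Icc y (y + m * h), ‖iteratedDeriv m (fwdDiff h f) u‖ ≤ h * M := by
      intro u hu
      rw [iteratedDeriv_fwdDiff (hsmooth u hu u (hleft u)) (hsmooth u hu _ (hright u)), fwdDiff]
      have := (convex_Icc u (u + h)).norm_image_sub_le_of_norm_deriv_le (C := M)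
        (fun v hv => differentiableAt_iteratedDeriv (m := m) (hf v (hsub u hu hv))
          (by exact_mod_cast m.lt_succ_self))
        (fun v hv => by rw [← iteratedDeriv_succ]; exact hM v (hsub u hu hv)) (hleft u) (hright u)
      simpa [abs_of_nonneg hh, mul_comm] using this
    calc ‖(fwdDiff h)^[m + 1] f y‖ ≤ h ^ m * (h * M) :=
          ih (fun u hu => contDiffAt_fwdDiff (hsmooth u hu u (hleft u))
            (hsmooth u hu _ (hright u))) hmean
      _ = h ^ (m + 1) * M := by ring

end Line

section Exponential

variable {f g : ℝ → ℂ} {m : ℕ} {u ρ K δ M : ℝ}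

lemma iteratedDeriv_succ_cexp (hf : ContDiffAt ℝ (m + 1 : ℕ) f u) :
    iteratedDeriv (m + 1) (fun v => Complex.exp (f v)) u =
      ∑ i ∈ Finset.range (m + 1), (m.choose i : ℂ) *
        iteratedDeriv i (fun v => Complex.exp (f v)) u * iteratedDeriv (m - i + 1) f u := by
  have hderiv : deriv (fun v => Complex.exp (f v)) =ᶠ[𝓝 u]
      fun v => Complex.exp (f v) * deriv f v := by
    filter_upwards [hf.eventually (by simp)] with v hv
    exact (hv.differentiableAt (by simp)).hasDerivAt.cexp.deriv
  rw [iteratedDeriv_succ', hderiv.iteratedDeriv_eq, iteratedDeriv_fun_mul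
    (hf.of_le (by exact_mod_cast m.le_succ)).cexp (hf.derivWithin (by simp))]
  simp_rw [iteratedDeriv_succ']

lemma norm_sum_choose_mul_le {F G : ℕ → ℂ} {A : ℕ → ℝ} {L κ : ℝ} (hρ : 0 < ρ) (hL : 1 ≤ L)
    (hM : 0 ≤ M) (hA : ∀ i ≤ m, 0 ≤ A i) (hF : ∀ i ≤ m, ‖F i‖ ≤ A i * M * L ^ i / ρ ^ i)
    (hG : ∀ j, 1 ≤ j → j ≤ m + 1 → ‖G j‖ ≤ κ / ρ ^ j) :
    ‖∑ i ∈ Finset.range (m + 1), (m.choose i : ℂ) * F i * G (m - i + 1)‖ ≤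
      (∑ i ∈ Finset.range (m + 1), m.choose i * A i) * M * L ^ m * κ / ρ ^ (m + 1) := by
  have hκ : 0 ≤ κ := by
    have := (norm_nonneg _).trans (hG 1 le_rfl (by omega))
    rwa [pow_one, le_div_iff₀ hρ, zero_mul] at this
  simp only [Finset.sum_mul, Finset.sum_div]
  refine norm_sum_le_of_le _ fun i hi => ?_
  have him : i ≤ m := Nat.lt_succ_iff.1 (Finset.mem_range.1 hi)
  have hAi := hA i him
  have hpow : ρ ^ (m + 1) = ρ ^ i * ρ ^ (m - i + 1) := by
    rw [← pow_add]; congr 1; omega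
  rw [norm_mul, norm_mul, Complex.norm_natCast]
  calc (m.choose i : ℝ) * ‖F i‖ * ‖G (m - i + 1)‖
      ≤ m.choose i * (A i * M * L ^ i / ρ ^ i) * (κ / ρ ^ (m - i + 1)) := by
        gcongr
        exacts [hF i him, hG _ (by omega) (by omega)]
    _ = m.choose i * A i * M * L ^ i * κ / ρ ^ (m + 1) := by rw [hpow]; field_simp
    _ ≤ m.choose i * A i * M * L ^ m * κ / ρ ^ (m + 1) := by gcongr

lemma exists_norm_iteratedDeriv_cexp_le (m : ℕ) : ∃ C : ℝ, 0 ≤ C ∧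
    ∀ (f : ℝ → ℂ) (u ρ K M : ℝ), 0 < ρ → 0 ≤ K → ContDiffAt ℝ m f u →
      (∀ j, 1 ≤ j → j ≤ m → ‖iteratedDeriv j f u‖ ≤ K / ρ ^ j) → ‖Complex.exp (f u)‖ ≤ M →
      ‖iteratedDeriv m (fun v => Complex.exp (f v)) u‖ ≤ C * M * (1 + K) ^ m / ρ ^ m := by
  induction m using Nat.strong_induction_on with
  | _ n ih =>
    rcases n with _ | m
    · exact ⟨1, zero_le_one, fun f u ρ K M _ _ _ _ hM => by simpa using hM⟩
    choose! C hC0 hC using ih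
    have hCnonneg : ∀ i ≤ m, 0 ≤ C i := fun i hi => hC0 i (Nat.lt_succ_of_le hi)
    refine ⟨∑ i ∈ Finset.range (m + 1), m.choose i * C i, Finset.sum_nonneg fun i hi =>
      mul_nonneg (by positivity) (hC0 i (Finset.mem_range.1 hi)), ?_⟩
    intro f u ρ K M hρ hK hf hd hM
    have hM0 : 0 ≤ M := (norm_nonneg _).trans hM
    have hlower : ∀ i ≤ m, ‖iteratedDeriv i (fun v => Complex.exp (f v)) u‖ ≤
        C i * M * (1 + K) ^ i / ρ ^ i := fun i hi =>
      hC i (by omega) f u ρ K M hρ hK (hf.of_le (by exact_mod_cast hi.trans m.le_succ))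
        (fun j hj1 hj => hd j hj1 (by omega)) hM
    have hsum : 0 ≤ ∑ i ∈ Finset.range (m + 1), m.choose i * C i := Finset.sum_nonneg fun i hi =>
      mul_nonneg (by positivity) (hC0 i (Finset.mem_range.1 hi))
    rw [iteratedDeriv_succ_cexp hf]
    refine (norm_sum_choose_mul_le hρ (by linarith) hM0 hCnonneg hlower hd).trans ?_
    rw [pow_succ (1 + K), ← mul_assoc]
    gcongr
    linarith

lemma iteratedDeriv_succ_cexp_sub_cexp (hf : ContDiffAt ℝ (m + 1 : ℕ) f u)
    (hg : ContDiffAt ℝ (m + 1 : ℕ) g u) :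
    iteratedDeriv (m + 1) (fun v => Complex.exp (f v)) u -
        iteratedDeriv (m + 1) (fun v => Complex.exp (g v)) u =
      ∑ i ∈ Finset.range (m + 1), (m.choose i : ℂ) *
        (iteratedDeriv i (fun v => Complex.exp (f v)) u -
          iteratedDeriv i (fun v => Complex.exp (g v)) u) * iteratedDeriv (m - i + 1) f u +
      ∑ i ∈ Finset.range (m + 1), (m.choose i : ℂ) *
        iteratedDeriv i (fun v => Complex.exp (g v)) u *
          (iteratedDeriv (m - i + 1) f u - iteratedDeriv (m - i + 1) g u) := by
  rw [iteratedDeriv_succ_cexp hf, iteratedDeriv_succ_cexp hg, ← Finset.sum_sub_distrib,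
    ← Finset.sum_add_distrib]
  exact Finset.sum_congr rfl fun i _ => by ring

lemma exists_norm_iteratedDeriv_cexp_sub_cexp_le (m : ℕ) : ∃ C : ℝ, 0 ≤ C ∧
    ∀ (f g : ℝ → ℂ) (u ρ K δ M : ℝ), 0 < ρ → 0 ≤ K → ContDiffAt ℝ m f u → ContDiffAt ℝ m g u →
      (∀ j, 1 ≤ j → j ≤ m → ‖iteratedDeriv j f u‖ ≤ K / ρ ^ j) →
      (∀ j, 1 ≤ j → j ≤ m → ‖iteratedDeriv j g u‖ ≤ K / ρ ^ j) →
      (∀ j, 1 ≤ j → j ≤ m → ‖iteratedDeriv j f u - iteratedDeriv j g u‖ ≤ δ / ρ ^ j) →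
      ‖Complex.exp (g u)‖ ≤ M → ‖Complex.exp (f u) - Complex.exp (g u)‖ ≤ M * δ →
      ‖iteratedDeriv m (fun v => Complex.exp (f v)) u -
        iteratedDeriv m (fun v => Complex.exp (g v)) u‖ ≤ C * (M * δ) * (1 + K) ^ m / ρ ^ m := by
  induction m using Nat.strong_induction_on with
  | _ n ih =>
    rcases n with _ | m
    · exact ⟨1, zero_le_one, fun f g u ρ K δ M _ _ _ _ _ _ _ _ h => by simpa using h⟩
    choose! C hC0 hC using ih
    choose B hB0 hB using exists_norm_iteratedDeriv_cexp_le
    have hCnonneg : ∀ i ≤ m, 0 ≤ C i := fun i hi => hC0 i (Nat.lt_succ_of_le hi)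
    set SC := ∑ i ∈ Finset.range (m + 1), m.choose i * C i
    set SB := ∑ i ∈ Finset.range (m + 1), m.choose i * B i
    have hSC0 : 0 ≤ SC := Finset.sum_nonneg fun i hi =>
      mul_nonneg (by positivity) (hC0 i (Finset.mem_range.1 hi))
    have hSB0 : 0 ≤ SB := Finset.sum_nonneg fun i _ => mul_nonneg (by positivity) (hB0 i)
    refine ⟨SC + SB, by positivity, ?_⟩
    intro f g u ρ K δ M hρ hK hf hg hdf hdg hdfg hMg hMfg
    have hM0 : 0 ≤ M := (norm_nonneg _).trans hMg
    have hMδ : 0 ≤ M * δ := (norm_nonneg _).trans hMfg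
    have hle : ∀ i ≤ m, (i : WithTop ℕ∞) ≤ ((m + 1 : ℕ) : WithTop ℕ∞) := fun i hi => by
      exact_mod_cast hi.trans m.le_succ
    have hdiff := norm_sum_choose_mul_le hρ (by linarith) hMδ hCnonneg (fun i hi =>
      hC i (by omega) f g u ρ K δ M hρ hK (hf.of_le (hle i hi)) (hg.of_le (hle i hi))
        (fun j hj1 hj => hdf j hj1 (by omega)) (fun j hj1 hj => hdg j hj1 (by omega))
        (fun j hj1 hj => hdfg j hj1 (by omega)) hMg hMfg) hdf
    have hexp := norm_sum_choose_mul_le hρ (by linarith) hM0 (fun i _ => hB0 i) (fun i hi =>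
      hB i g u ρ K M hρ hK (hg.of_le (hle i hi)) (fun j hj1 hj => hdg j hj1 (by omega)) hMg) hdfg
    rw [iteratedDeriv_succ_cexp_sub_cexp hf hg]
    calc _ ≤ SC * (M * δ) * (1 + K) ^ m * K / ρ ^ (m + 1) +
          SB * M * (1 + K) ^ m * δ / ρ ^ (m + 1) := norm_add_le_of_le hdiff hexp
      _ = (SC * K + SB) * (M * δ) * (1 + K) ^ m / ρ ^ (m + 1) := by ring
      _ ≤ ((SC + SB) * (1 + K)) * (M * δ) * (1 + K) ^ m / ρ ^ (m + 1) := by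
        gcongr
        nlinarith
      _ = (SC + SB) * (M * δ) * (1 + K) ^ (m + 1) / ρ ^ (m + 1) := by ring

end Exponential

/-! ### Fourier coefficients on the cube -/

section PlaneWave

variable {E : Type*} [NormedAddCommGroup E] [InnerProductSpace ℝ E]

/-- The plane wave `e^{i x·z}`, through which both Fourier series on `(-π, π]^d` and the Fourier
integral in the heat kernel are written. -/
noncomputable def planeWave (x z : E) : ℂ := Complex.exp (Complex.I * (inner ℝ x z : ℝ))

lemma norm_planeWave (x z : E) : ‖planeWave x z‖ = 1 := by
  rw [planeWave, mul_comm, Complex.norm_exp_ofReal_mul_I]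

lemma continuous_planeWave : Continuous fun p : E × E => planeWave p.1 p.2 := by
  unfold planeWave
  fun_prop

lemma planeWave_comm (x z : E) : planeWave x z = planeWave z x := by
  rw [planeWave, planeWave, real_inner_comm]

lemma planeWave_add_right (x z w : E) : planeWave x (z + w) = planeWave x z * planeWave x w := by
  rw [planeWave, planeWave, planeWave, ← Complex.exp_add, inner_add_right]
  push_cast
  ring_nf

lemma planeWave_add_left (x y z : E) : planeWave (x + y) z = planeWave x z * planeWave y z := by
  simp only [planeWave_comm _ z, planeWave_add_right]

lemma planeWave_zero_left (z : E) : planeWave 0 z = 1 := by simp [planeWave]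

lemma planeWave_nsmul_left (n : ℕ) (x z : E) : planeWave (n • x) z = planeWave x z ^ n := by
  induction n with
  | zero => rw [zero_nsmul, planeWave_zero_left, pow_zero]
  | succ n ih => rw [succ_nsmul, planeWave_add_left, ih, pow_succ]

end PlaneWave

section Fourier

variable {d : ℕ}

lemma inner_toSpace (z : Space d) (k : Fin d → ℤ) :
    inner ℝ z (toSpace k) = ∑ i, z i * k i := by
  simp [toSpace, PiLp.inner_apply, mul_comm]

lemma toSpace_sub (k l : Fin d → ℤ) : toSpace (k - l) = toSpace k - toSpace l := by
  ext i
  simp [toSpace]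

lemma toSpace_sum {ι : Type*} (s : Finset ι) (k : ι → Fin d → ℤ) :
    toSpace (∑ j ∈ s, k j) = ∑ j ∈ s, toSpace (k j) := by
  ext i
  simp [toSpace]

lemma toSpace_injective : Function.Injective (toSpace : (Fin d → ℤ) → Space d) := by
  intro k l h
  ext i
  simpa [toSpace] using congrArg (fun v : Space d => v i) h

lemma toLp_preimage_cube : (WithLp.toLp 2 : (Fin d → ℝ) → Space d) ⁻¹' cube d =
    Set.univ.pi fun _ => Set.Ioc (-Real.pi) Real.pi := by
  ext z
  simp [cube]

lemma measurableSet_cube : MeasurableSet (cube d) := by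
  rw [← (MeasurableEquiv.toLp 2 (Fin d → ℝ)).measurableSet_preimage, MeasurableEquiv.coe_toLp,
    toLp_preimage_cube]
  exact MeasurableSet.univ_pi fun _ => measurableSet_Ioc

lemma volume_cube_lt_top : volume (cube d) < ⊤ := by
  rw [← (PiLp.volume_preserving_toLp (Fin d)).measure_preimage
    measurableSet_cube.nullMeasurableSet, toLp_preimage_cube, volume_pi, Measure.pi_pi]
  exact ENNReal.prod_lt_top fun _ _ => by simp only [Real.volume_Ioc, ENNReal.ofReal_lt_top]

lemma isFiniteMeasure_restrict_cube : IsFiniteMeasure (volume.restrict (cube d)) :=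
  ⟨by simpa using volume_cube_lt_top⟩

lemma setIntegral_cube_prod {𝕜 : Type*} [RCLike 𝕜] (f : Fin d → ℝ → 𝕜) :
    ∫ z in cube d, ∏ i, f i (z i) = ∏ i, ∫ x in Set.Ioc (-Real.pi) Real.pi, f i x := by
  rw [← (PiLp.volume_preserving_toLp (Fin d)).setIntegral_preimage_emb
    (MeasurableEquiv.toLp 2 (Fin d → ℝ)).measurableEmbedding
    (fun z : Space d => ∏ i, f i (z i)), toLp_preimage_cube, volume_pi, Measure.restrict_pi_pi]
  exact integral_fintype_prod_eq_prod f

lemma setIntegral_exp_mul_intCast (n : ℤ) :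
    ∫ x in Set.Ioc (-Real.pi) Real.pi, Complex.exp (Complex.I * ((x * n : ℝ) : ℂ)) =
      if n = 0 then 2 * (Real.pi : ℂ) else 0 := by
  rw [← intervalIntegral.integral_of_le (by linarith [Real.pi_pos])]
  split_ifs with h
  · simp only [h, Int.cast_zero, mul_zero, Complex.ofReal_zero, Complex.exp_zero,
      intervalIntegral.integral_const, Complex.real_smul, mul_one]
    push_cast
    ring
  have hn : Complex.I * (n : ℂ) ≠ 0 := by simp [h]
  have hperiod : Complex.I * n * (Real.pi : ℂ) =
      Complex.I * n * ((-Real.pi : ℝ) : ℂ) + n * (2 * Real.pi * Complex.I) := by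
    push_cast
    ring
  simp_rw [Complex.ofReal_mul, Complex.ofReal_intCast, mul_comm _ (n : ℂ), ← mul_assoc]
  rw [integral_exp_mul_complex hn, hperiod, Complex.exp_add, Complex.exp_int_mul_two_pi_mul_I,
    mul_one, sub_self, zero_div]

lemma setIntegral_cube_planeWave (n : Fin d → ℤ) :
    ∫ z in cube d, planeWave z (toSpace n) = if n = 0 then (2 * (Real.pi : ℂ)) ^ d else 0 := by
  have hprod : ∀ z : Space d, planeWave z (toSpace n) =
      ∏ i, Complex.exp (Complex.I * ((z i * n i : ℝ) : ℂ)) := fun z => by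
    rw [planeWave, inner_toSpace, ← Complex.exp_sum, Complex.ofReal_sum, Finset.mul_sum]
  simp_rw [hprod]
  rw [setIntegral_cube_prod fun i x => Complex.exp (Complex.I * ((x * n i : ℝ) : ℂ))]
  simp_rw [setIntegral_exp_mul_intCast]
  split_ifs with h
  · simp [h]
  · obtain ⟨i, hi⟩ := Function.ne_iff.1 h
    exact Finset.prod_eq_zero (Finset.mem_univ i) (if_neg hi)

lemma setIntegral_cube_planeWave_mul_tsum {c : (Fin d → ℤ) → ℂ} (hc : Summable fun l => ‖c l‖)
    (k : Fin d → ℤ) :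
    ∫ z in cube d, planeWave z (-toSpace k) * ∑' l, planeWave z (toSpace l) * c l =
      (2 * (Real.pi : ℂ)) ^ d * c k := by
  have : IsFiniteMeasure (volume.restrict (cube d)) := isFiniteMeasure_restrict_cube
  have hterm : ∀ z : Space d, planeWave z (-toSpace k) * ∑' l, planeWave z (toSpace l) * c l =
      ∑' l, planeWave z (toSpace (l - k)) * c l := fun z => by
    simp_rw [← tsum_mul_left, ← mul_assoc, ← planeWave_add_right, toSpace_sub, sub_eq_neg_add]
  have hnorm : ∀ l (z : Space d), ‖planeWave z (toSpace (l - k)) * c l‖ = ‖c l‖ := fun l z => by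
    rw [norm_mul, norm_planeWave, one_mul]
  simp_rw [hterm]
  rw [← integral_tsum_of_summable_integral_norm]
  · simp_rw [integral_mul_const, setIntegral_cube_planeWave, ite_mul, zero_mul, sub_eq_zero]
    exact tsum_ite_eq k _
  · intro l
    refine Integrable.mono' (integrable_const ‖c l‖) ?_ (ae_of_all _ fun z => (hnorm l z).le)
    exact ((continuous_planeWave.comp (by fun_prop : Continuous fun z : Space d =>
      (z, toSpace (l - k)))).mul continuous_const).aestronglyMeasurable
  · simp_rw [hnorm, integral_const, smul_eq_mul]
    exact hc.mul_left _

end Fourier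

/-! ### The characteristic function of the walk -/

section Walk

variable {d : ℕ} {Ω : Type*} [MeasurableSpace Ω] {P : Measure Ω}

lemma summable_measureReal_singleton {β : Type*} [Countable β] [MeasurableSpace β]
    [MeasurableSingletonClass β] (μ : Measure β) [IsFiniteMeasure μ] :
    Summable fun k => μ.real {k} := by
  refine ENNReal.summable_toReal ?_
  rw [← measure_iUnion (fun i j h => by simpa using h) fun k => measurableSet_singleton k]
  exact measure_ne_top _ _

lemma charFn_eq_integral (μ : Measure (Fin d → ℤ)) [IsFiniteMeasure μ] (z : Space d) :
    charFn μ z = ∫ k, planeWave z (toSpace k) ∂μ := by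
  rw [integral_countable (Integrable.mono' (integrable_const (1 : ℝ)) .of_discrete
    (ae_of_all _ fun k => (norm_planeWave _ _).le))]
  simp [charFn, planeWave, mul_comm]

lemma charFn_map_eq_integral [IsFiniteMeasure P] {Y : Ω → Fin d → ℤ} (hY : AEMeasurable Y P)
    (z : Space d) :
    charFn (P.map Y) z = ∫ ω, planeWave z (toSpace (Y ω)) ∂P := by
  rw [charFn_eq_integral, integral_map hY Measurable.of_discrete.aestronglyMeasurable]

lemma charFn_eq_charFun (μ : Measure (Fin d → ℤ)) [IsFiniteMeasure μ] (z : Space d) :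
    charFn μ z = charFun (μ.map toSpace) z := by
  rw [charFn_eq_integral, charFun_apply, integral_map .of_discrete (by fun_prop)]
  simp_rw [planeWave, real_inner_comm z, mul_comm]

lemma norm_charFn_le_one {μ : Measure (Fin d → ℤ)} [IsProbabilityMeasure μ] (z : Space d) :
    ‖charFn μ z‖ ≤ 1 := by
  have : IsProbabilityMeasure (μ.map toSpace) := Measure.isProbabilityMeasure_map .of_discrete
  rw [charFn_eq_charFun]
  exact norm_charFun_le_one z

lemma continuous_charFn {μ : Measure (Fin d → ℤ)} [IsFiniteMeasure μ] :
    Continuous (charFn μ) := by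
  refine continuous_tsum (fun k => by fun_prop) (summable_measureReal_singleton μ) fun k z => ?_
  rw [norm_mul, ← planeWave, norm_planeWave, one_mul, Complex.norm_real,
    Real.norm_of_nonneg measureReal_nonneg]

lemma charFn_map_sum {ι : Type*} {ξ : ι → Ω → Fin d → ℤ} {μ : Measure (Fin d → ℤ)}
    [IsProbabilityMeasure P] [IsFiniteMeasure μ] (hξ : ∀ j, HasLaw (ξ j) μ P)
    (hind : iIndepFun ξ P) (s : Finset ι) (z : Space d) :
    charFn (P.map fun ω => ∑ j ∈ s, ξ j ω) z = charFn μ z ^ s.card := by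
  have hindSpace : iIndepFun (s.restrict fun j => toSpace ∘ ξ j) P :=
    (hind.comp (fun _ => toSpace) fun _ => .of_discrete).restrict s
  have hlaw : ∀ j, charFun (P.map (toSpace ∘ ξ j)) z = charFn μ z := fun j => by
    rw [← AEMeasurable.map_map_of_aemeasurable Measurable.of_discrete.aemeasurable
      (hξ j).aemeasurable, (hξ j).map_eq, charFn_eq_charFun]
  calc charFn (P.map fun ω => ∑ j ∈ s, ξ j ω) z
      = charFun (P.map fun ω => ∑ j ∈ s, (toSpace ∘ ξ j) ω) z := by
        rw [charFn_eq_charFun, AEMeasurable.map_map_of_aemeasurable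
          Measurable.of_discrete.aemeasurable
          (s.aemeasurable_fun_sum fun j _ => (hξ j).aemeasurable)]
        simp only [Function.comp_def, toSpace_sum]
    _ = charFn μ z ^ s.card := by
        rw [hindSpace.charFun_map_fun_finsetSum_eq_prod fun j _ =>
          Measurable.of_discrete.comp_aemeasurable (hξ j).aemeasurable]
        simp only [Finset.prod_apply, hlaw, Finset.prod_const]

lemma integral_comp_of_indepFun {α β E : Type*} [MeasurableSpace α] [MeasurableSpace β]
    [NormedAddCommGroup E] [NormedSpace ℝ E] [IsFiniteMeasure P] {f : Ω → α} {g : Ω → β}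
    (hf : AEMeasurable f P) (hg : AEMeasurable g P) (hfg : IndepFun f g P) {F : α × β → E}
    (hF : Integrable F ((P.map f).prod (P.map g))) :
    ∫ ω, F (f ω, g ω) ∂P = ∫ a, ∫ b, F (a, b) ∂(P.map g) ∂(P.map f) := by
  have hprod := (indepFun_iff_map_prod_eq_prod_map_map hf hg).1 hfg
  rw [← integral_prod F hF, ← hprod, integral_map (hf.prodMk hg)
    (by rw [hprod]; exact hF.aestronglyMeasurable)]

lemma integral_pow_poissonMeasure (r : ℝ≥0) (w : ℂ) :
    ∫ n, w ^ n ∂poissonMeasure r = Complex.exp (r * (w - 1)) := by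
  have hterm : ∀ n : ℕ, (Real.exp (-r) * r ^ n / n.factorial) • w ^ n =
      Complex.exp (-r) * ((r * w) ^ n / n.factorial) := fun n => by
    rw [Complex.real_smul]
    push_cast
    ring
  rw [integral_poissonMeasure]
  simp_rw [hterm]
  rw [tsum_mul_left, (NormedSpace.expSeries_div_hasSum_exp ((r : ℂ) * w)).tsum_eq,
    ← Complex.exp_eq_exp_ℂ, ← Complex.exp_add]
  ring_nf

lemma IsPoissonProcess.hasLaw {N : ℝ≥0 → Ω → ℕ} (hN : IsPoissonProcess P N) (s : ℝ≥0) :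
    HasLaw (N s) (poissonMeasure s) P := by
  simpa [hN.zero] using hN.increment_law 0 s zero_le

lemma measurable_sum_range : Measurable fun p : ℕ × (ℕ → Fin d → ℤ) =>
    ∑ n ∈ Finset.range p.1, p.2 n :=
  measurable_from_prod_countable_right fun n =>
    (Finset.range n).measurable_fun_sum fun i _ => measurable_pi_apply i

variable {μ : Measure (Fin d → ℤ)} {X : ℝ≥0 → Ω → (Fin d → ℤ)}

lemma IsRateOneWalk.measurable (hX : IsRateOneWalk P μ X) (s : ℝ≥0) : Measurable (X s) := by
  obtain ⟨N, ξ, hN, hξm, -, -, -, hXsum⟩ := hX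
  rw [show X s = _ from funext (hXsum s)]
  exact measurable_sum_range.comp ((hN.measurable s).prodMk (measurable_pi_lambda _ hξm))

lemma IsRateOneWalk.charFn_map [IsProbabilityMeasure P] [IsFiniteMeasure μ]
    (hX : IsRateOneWalk P μ X) (s : ℝ≥0) (z : Space d) :
    charFn (P.map (X s)) z = Complex.exp (s * (charFn μ z - 1)) := by
  have hXm := hX.measurable s
  obtain ⟨N, ξ, hN, hξm, hξ, hind, hNξ, hXsum⟩ := hX
  let F : ℕ × (ℕ → Fin d → ℤ) → ℂ := fun p =>
    planeWave z (toSpace (∑ n ∈ Finset.range p.1, p.2 n))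
  have hξm' : Measurable fun ω n => ξ n ω := measurable_pi_lambda _ hξm
  have hNξs : IndepFun (N s) (fun ω n => ξ n ω) P :=
    hNξ.comp (φ := fun f : ℝ≥0 → ℕ => f s) (measurable_pi_apply s) measurable_id
  have hF : Measurable F :=
    (.of_discrete : Measurable fun k => planeWave z (toSpace k)).comp measurable_sum_range
  have hFint : Integrable F ((P.map (N s)).prod (P.map fun ω n => ξ n ω)) :=
    Integrable.mono' (integrable_const (1 : ℝ)) hF.aestronglyMeasurable
      (ae_of_all _ fun p => (norm_planeWave _ _).le)
  have hpartial : ∀ n, ∫ y, F (n, y) ∂(P.map fun ω n => ξ n ω) = charFn μ z ^ n := fun n => by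
    have hFn : AEStronglyMeasurable (fun y => F (n, y)) (P.map fun ω n => ξ n ω) :=
      (hF.comp measurable_prodMk_left).aestronglyMeasurable
    have hsum : AEMeasurable (fun ω => ∑ i ∈ Finset.range n, ξ i ω) P :=
      (Finset.measurable_fun_sum _ fun i _ => hξm i).aemeasurable
    rw [integral_map hξm'.aemeasurable hFn]
    exact (charFn_map_eq_integral hsum z).symm.trans (by
      rw [charFn_map_sum hξ hind, Finset.card_range])
  calc charFn (P.map (X s)) z = ∫ ω, F (N s ω, fun n => ξ n ω) ∂P := by
        rw [charFn_map_eq_integral hXm.aemeasurable]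
        simp only [hXsum, F]
    _ = ∫ n, charFn μ z ^ n ∂poissonMeasure s := by
        rw [integral_comp_of_indepFun (hN.measurable s).aemeasurable hξm'.aemeasurable hNξs hFint,
          (hN.hasLaw s).map_eq]
        simp_rw [hpartial]
    _ = Complex.exp (s * (charFn μ z - 1)) := integral_pow_poissonMeasure s _

end Walk

/-! ### Pure partial derivatives of powers of the norm -/

section PartialDeriv

variable {d : ℕ}

lemma contDiffAt_comp_line {n : WithTop ℕ∞} {i : Fin d} {f : Space d → ℂ} {z : Space d} {u : ℝ}
    (hf : ContDiffAt ℝ n f (z + u • EuclideanSpace.single i (1 : ℝ))) :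
    ContDiffAt ℝ n (fun s : ℝ => f (z + s • EuclideanSpace.single i (1 : ℝ))) u :=
  hf.comp (f := fun s : ℝ => z + s • (EuclideanSpace.single i (1 : ℝ) : Space d)) u (by fun_prop)

lemma iteratedDeriv_comp_line (k : ℕ) (i : Fin d) (f : Space d → ℂ) (z : Space d) (u : ℝ) :
    iteratedDeriv k (fun s : ℝ => f (z + s • EuclideanSpace.single i (1 : ℝ))) u =
      partialDeriv k i f (z + u • EuclideanSpace.single i (1 : ℝ)) := by
  have hshift := congrFun (iteratedDeriv_comp_const_add k
    (fun s : ℝ => f (z + s • EuclideanSpace.single i (1 : ℝ))) u) 0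
  simp only [add_zero] at hshift
  simp_rw [← hshift, partialDeriv, add_smul, add_assoc]

lemma partialDeriv_eq_iteratedFDeriv {k : ℕ} {i : Fin d} {f : Space d → ℂ} {z : Space d}
    (hf : ContDiffAt ℝ k f z) :
    partialDeriv k i f z = iteratedFDeriv ℝ k f z fun _ => EuclideanSpace.single i (1 : ℝ) := by
  let g : ℝ →L[ℝ] Space d := ContinuousLinearMap.toSpanSingleton ℝ (EuclideanSpace.single i 1)
  have hf0 : ContDiffAt ℝ k (fun w => f (z + w)) 0 :=
    ContDiffAt.comp (g := f) (f := fun w => z + w) 0 (by simpa using hf) (by fun_prop)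
  obtain ⟨u, hu, hfu⟩ := hf0.contDiffOn le_rfl (by simp)
  have hU : IsOpen (interior u) := isOpen_interior
  have h0 : g 0 ∈ interior u := by simpa using mem_interior_iff_mem_nhds.2 hu
  have hV : IsOpen (g ⁻¹' interior u) := hU.preimage g.continuous
  have hchain := g.iteratedFDerivWithin_comp_right (hfu.mono interior_subset) hU.uniqueDiffOn
    hV.uniqueDiffOn (x := 0) h0 (i := k) le_rfl
  rw [iteratedFDerivWithin_of_isOpen k hV h0, iteratedFDerivWithin_of_isOpen k hU h0,
    iteratedFDeriv_comp_add_left] at hchain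
  rw [partialDeriv, iteratedDeriv_eq_iteratedFDeriv]
  change iteratedFDeriv ℝ k ((fun w => f (z + w)) ∘ g) 0 _ = _
  rw [hchain]
  simp [g]

lemma continuousAt_partialDeriv {k : ℕ} {i : Fin d} {f : Space d → ℂ} {z : Space d}
    (hf : ContDiffAt ℝ k f z) : ContinuousAt (partialDeriv k i f) z := by
  have hcont : ContinuousAt
      (fun w => iteratedFDeriv ℝ k f w fun _ => EuclideanSpace.single i (1 : ℝ)) z :=
    (continuous_eval_const _).continuousAt.comp (hf.continuousAt_iteratedFDeriv le_rfl)
  refine hcont.congr ?_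
  filter_upwards [hf.eventually (by simp)] with w hw
  rw [partialDeriv_eq_iteratedFDeriv hw]

lemma iteratedDeriv_comp_mul_left {𝕜 F : Type*} [NontriviallyNormedField 𝕜]
    [NormedAddCommGroup F] [NormedSpace 𝕜 F] (k : ℕ) (f : 𝕜 → F) (c : 𝕜) :
    iteratedDeriv k (fun u => f (c * u)) = fun u => c ^ k • iteratedDeriv k f (c * u) := by
  induction k with
  | zero => simp
  | succ k ih =>
    ext u
    rw [iteratedDeriv_succ, ih, iteratedDeriv_succ, deriv_fun_const_smul_field,
      deriv_comp_mul_left, smul_smul, pow_succ]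

lemma continuous_normPow {α : ℝ} (hα : 0 ≤ α) : Continuous (normPow α : Space d → ℂ) :=
  Complex.continuous_ofReal.comp (continuous_norm.rpow_const fun _ => Or.inr hα)

lemma contDiffAt_normPow (α : ℝ) {z : Space d} (hz : z ≠ 0) (n : WithTop ℕ∞) :
    ContDiffAt ℝ n (normPow α) z :=
  Complex.ofRealCLM.contDiff.contDiffAt.comp z
    ((contDiffAt_norm ℝ hz).rpow_const_of_ne (norm_ne_zero_iff.2 hz))

lemma normPow_smul (α : ℝ) {r : ℝ} (hr : 0 ≤ r) (z : Space d) :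
    normPow α (r • z) = ((r ^ α : ℝ) : ℂ) * normPow α z := by
  rw [normPow, normPow, norm_smul, Real.norm_of_nonneg hr, Real.mul_rpow hr (norm_nonneg _),
    Complex.ofReal_mul]

lemma partialDeriv_normPow_smul (α : ℝ) (k : ℕ) (i : Fin d) (z : Space d) {r : ℝ} (hr : 0 < r) :
    partialDeriv k i (normPow α) (r • z) =
      ((r ^ (α - k) : ℝ) : ℂ) * partialDeriv k i (normPow α) z := by
  have hline : (fun s : ℝ => normPow α (r • z + s • EuclideanSpace.single i (1 : ℝ))) =
      fun s : ℝ => ((r ^ α : ℝ) : ℂ) *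
        (fun s : ℝ => normPow α (z + s • EuclideanSpace.single i (1 : ℝ))) (r⁻¹ * s) := by
    ext s
    rw [← normPow_smul α hr.le, smul_add, smul_smul, ← mul_assoc, mul_inv_cancel₀ hr.ne',
      one_mul]
  rw [partialDeriv, hline, iteratedDeriv_const_mul_field, iteratedDeriv_comp_mul_left k
    (fun s : ℝ => normPow α (z + s • EuclideanSpace.single i (1 : ℝ)))]
  beta_reduce
  rw [mul_zero, ← partialDeriv, Complex.real_smul, ← mul_assoc, ← Complex.ofReal_mul,
    Real.rpow_sub hr, Real.rpow_natCast, inv_pow, div_eq_mul_inv]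

lemma exists_norm_partialDeriv_normPow_le (α : ℝ) (k : ℕ) (i : Fin d) :
    ∃ C : ℝ, ∀ z : Space d, z ≠ 0 →
      ‖partialDeriv k i (normPow α) z‖ ≤ C * ‖z‖ ^ (α - k) := by
  obtain ⟨C, hC⟩ := (isCompact_sphere (0 : Space d) 1).exists_bound_of_continuousOn
    (f := partialDeriv k i (normPow α)) (fun z hz => (continuousAt_partialDeriv
      (contDiffAt_normPow α (ne_zero_of_mem_unit_sphere ⟨z, hz⟩) k)).continuousWithinAt)
  refine ⟨C, fun z hz => ?_⟩
  have hz' : 0 < ‖z‖ := norm_pos_iff.2 hz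
  have hunit := hC (‖z‖⁻¹ • z) (by simp [norm_smul, hz'.ne'])
  have hscale := partialDeriv_normPow_smul α k i (‖z‖⁻¹ • z) hz'
  rw [smul_smul, mul_inv_cancel₀ hz'.ne', one_smul] at hscale
  rw [hscale, norm_mul, Complex.norm_real, Real.norm_of_nonneg (by positivity), mul_comm]
  gcongr

lemma exists_forall_norm_partialDeriv_normPow_le (d : ℕ) (α : ℝ) (n : ℕ) :
    ∃ C : ℝ, 0 < C ∧ ∀ k ≤ n, ∀ (i : Fin d) (z : Space d), z ≠ 0 →
      ‖partialDeriv k i (normPow α) z‖ ≤ C * ‖z‖ ^ (α - k) := by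
  choose C hC using exists_norm_partialDeriv_normPow_le (d := d) α
  obtain ⟨M, hM⟩ := Finite.exists_le fun p : Fin (n + 1) × Fin d => C p.1 p.2
  refine ⟨max M 1, by positivity, fun k hk i z hz => (hC k i z hz).trans ?_⟩
  gcongr
  exact (hM (⟨k, Nat.lt_succ_of_le hk⟩, i)).trans (le_max_left _ _)

end PartialDeriv

/-! ### Bounds for the characteristic function near the fundamental cube -/

section Power

variable {E F : Type*} [NormedAddCommGroup E] [NormedAddCommGroup F] {K : Set E}

lemma exists_norm_le_mul_norm_rpow (hK : IsCompact K) {f : E → F} {β : ℝ}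
    (hf : ∀ z ∈ K, z ≠ 0 → ContinuousAt f z) (hO : f =O[𝓝[≠] 0] fun z => ‖z‖ ^ β) :
    ∃ C : ℝ, 0 < C ∧ ∀ z ∈ K, z ≠ 0 → ‖f z‖ ≤ C * ‖z‖ ^ β := by
  obtain ⟨c, hc⟩ := hO.bound
  rw [eventually_nhdsWithin_iff, Metric.eventually_nhds_iff] at hc
  obtain ⟨r, hr, hc⟩ := hc
  have hne : ∀ z ∈ K ∩ {z | r ≤ ‖z‖}, z ≠ 0 := fun z hz => norm_pos_iff.1 (hr.trans_le hz.2)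
  obtain ⟨C, hC⟩ :=
    (hK.inter_right (isClosed_le continuous_const continuous_norm)).exists_bound_of_continuousOn
      (f := fun z => ‖f z‖ * ‖z‖ ^ (-β)) fun z hz => ((hf z hz.1 (hne z hz)).norm.mul
        (continuousAt_id.norm.rpow_const
          (Or.inl (norm_ne_zero_iff.2 (hne z hz))))).continuousWithinAt
  refine ⟨max (max c C) 1, by positivity, fun z hz hz0 => ?_⟩
  have hz' : 0 < ‖z‖ := norm_pos_iff.2 hz0
  rcases lt_or_ge ‖z‖ r with hzr | hzr
  · have hnear := hc (by simpa using hzr) hz0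
    rw [Real.norm_of_nonneg (by positivity)] at hnear
    refine hnear.trans ?_
    gcongr
    exact (le_max_left _ _).trans (le_max_left _ _)
  · have hfar := hC z ⟨hz, hzr⟩
    rw [Real.norm_of_nonneg (by positivity), Real.rpow_neg hz'.le, ← div_eq_mul_inv,
      div_le_iff₀ (by positivity)] at hfar
    refine hfar.trans ?_
    gcongr
    exact (le_max_right _ _).trans (le_max_left _ _)

lemma exists_pos_mul_norm_rpow_le (hK : IsCompact K) {f : E → ℝ} {β c : ℝ} (hc : 0 < c)
    (hf : ∀ z ∈ K, z ≠ 0 → ContinuousAt f z) (hpos : ∀ z ∈ K, z ≠ 0 → 0 < f z)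
    (hnear : ∀ᶠ z in 𝓝[≠] 0, c * ‖z‖ ^ β ≤ f z) :
    ∃ c' : ℝ, 0 < c' ∧ ∀ z ∈ K, z ≠ 0 → c' * ‖z‖ ^ β ≤ f z := by
  obtain ⟨C, hC0, hC⟩ := exists_norm_le_mul_norm_rpow (f := fun z => (f z)⁻¹) (β := -β) hK
    (fun z hz hz0 => (hf z hz hz0).inv₀ (hpos z hz hz0).ne') (by
      refine Asymptotics.IsBigO.of_bound c⁻¹ ?_
      filter_upwards [hnear, self_mem_nhdsWithin] with z hz hz0
      have hz' : 0 < c * ‖z‖ ^ β := mul_pos hc (Real.rpow_pos_of_pos (norm_pos_iff.2 hz0) β)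
      rw [norm_inv, Real.norm_of_nonneg (hz'.trans_le hz).le, Real.norm_of_nonneg (by positivity),
        Real.rpow_neg (norm_nonneg _), ← mul_inv]
      exact inv_anti₀ hz' hz)
  refine ⟨C⁻¹, inv_pos.2 hC0, fun z hz hz0 => ?_⟩
  have hbound := hC z hz hz0
  rw [norm_inv, Real.norm_of_nonneg (hpos z hz hz0).le, Real.rpow_neg (norm_nonneg _),
    inv_le_comm₀ (hpos z hz hz0) (by have := norm_pos_iff.2 hz0; positivity), mul_inv,
    inv_inv] at hbound
  exact hbound

end Power

section CharFn

variable {d : ℕ} {μ : Measure (Fin d → ℤ)} {α ν a : ℝ}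

lemma charFn_zero [IsProbabilityMeasure μ] : charFn μ (0 : Space d) = 1 := by
  simp [charFn_eq_integral, planeWave_zero_left]

lemma re_charFn_le_one [IsProbabilityMeasure μ] (z : Space d) : (charFn μ z).re ≤ 1 :=
  (Complex.re_le_norm _).trans (norm_charFn_le_one z)

lemma planeWave_two_pi_smul_toSpace (n k : Fin d → ℤ) :
    planeWave ((2 * Real.pi) • toSpace n) (toSpace k) = 1 := by
  rw [planeWave, Complex.exp_eq_one_iff]
  refine ⟨∑ i, n i * k i, ?_⟩
  rw [inner_smul_left, inner_toSpace]
  simp only [toSpace, conj_trivial]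
  push_cast
  ring

lemma charFn_add_two_pi_smul_toSpace (z : Space d) (n : Fin d → ℤ) :
    charFn μ (z + (2 * Real.pi) • toSpace n) = charFn μ z := by
  change ∑' k, planeWave _ (toSpace k) * _ = ∑' k, planeWave _ (toSpace k) * _
  simp only [planeWave_add_left, planeWave_two_pi_smul_toSpace, mul_one]

/-- The cube `[-π - 1/2, π + 1/2]^d`. It is a neighbourhood of the fundamental cube `(-π, π]^d`
on which bounds survive small translations, and it contains no point of `2π ℤ^d` but `0`. -/
def bigCube (d : ℕ) : Set (Space d) := {z | ∀ i, |z i| ≤ Real.pi + 1 / 2}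

lemma isCompact_bigCube : IsCompact (bigCube d) := by
  have himage : bigCube d = WithLp.toLp 2 '' Set.univ.pi fun _ : Fin d =>
      Set.Icc (-(Real.pi + 1 / 2)) (Real.pi + 1 / 2) := by
    ext z
    constructor
    · exact fun hz => ⟨WithLp.ofLp z, fun i _ => abs_le.1 (hz i), rfl⟩
    · rintro ⟨w, hw, rfl⟩ i
      exact abs_le.2 (hw i trivial)
  rw [himage]
  exact (isCompact_univ_pi fun _ => isCompact_Icc).image (PiLp.continuous_toLp 2 _)

lemma cube_subset_bigCube : cube d ⊆ bigCube d := fun z hz i =>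
  abs_le.2 ⟨by linarith [(hz i).1], by linarith [(hz i).2]⟩

lemma eq_zero_of_two_pi_smul_toSpace_mem_bigCube {n : Fin d → ℤ}
    (hn : (2 * Real.pi) • toSpace n ∈ bigCube d) : n = 0 := by
  ext i
  have hi := hn i
  simp only [toSpace, PiLp.smul_apply, smul_eq_mul, abs_mul, abs_of_pos Real.two_pi_pos] at hi
  have hlt : |(n i : ℝ)| < 1 := by
    by_contra! hge
    nlinarith [Real.pi_gt_three]
  exact Int.abs_lt_one_iff.1 (by exact_mod_cast hlt)

lemma exists_mem_cube_eq_add {z : Space d} (hz : z ∈ bigCube d) (hz0 : z ≠ 0) :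
    ∃ w ∈ cube d, w ≠ 0 ∧ ∃ n : Fin d → ℤ, z = w + (2 * Real.pi) • toSpace n := by
  let n : Fin d → ℤ := fun i => toIocDiv Real.two_pi_pos (-Real.pi) (z i)
  refine ⟨z - (2 * Real.pi) • toSpace n, fun i => ?_, fun h => hz0 ?_, n, by simp⟩
  · have hmod : (z - (2 * Real.pi) • toSpace n) i =
        toIocMod Real.two_pi_pos (-Real.pi) (z i) := by
      rw [← self_sub_toIocDiv_zsmul Real.two_pi_pos]
      simp [toSpace, n, mul_comm]
    rw [hmod]
    simpa [two_mul] using toIocMod_mem_Ioc Real.two_pi_pos (-Real.pi) (z i)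
  · rw [sub_eq_zero] at h
    have hn : n = 0 := eq_zero_of_two_pi_smul_toSpace_mem_bigCube (by rwa [← h])
    rw [h, hn]
    ext i
    simp [toSpace]

lemma Assumption1.re_charFn_lt_one [IsProbabilityMeasure μ] (h : Assumption1 μ α ν a)
    {z : Space d} (hz : z ∈ bigCube d) (hz0 : z ≠ 0) : (charFn μ z).re < 1 := by
  refine lt_of_le_of_ne (re_charFn_le_one z) fun hre => ?_
  have him : (charFn μ z).im = 0 := by
    have hsq := Complex.sq_norm (charFn μ z)
    rw [Complex.normSq_apply, hre] at hsq
    nlinarith [norm_nonneg (charFn μ z), norm_charFn_le_one (μ := μ) z]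
  obtain ⟨w, hw, hw0, n, rfl⟩ := exists_mem_cube_eq_add hz hz0
  have hone : charFn μ w = 1 := by
    rw [← charFn_add_two_pi_smul_toSpace w n]
    exact Complex.ext (by simpa using hre) (by simpa using him)
  exact hw0 (h.eq_one_iff.subset ⟨hw, hone⟩)

lemma re_remainder (z : Space d) :
    (remainder μ α ν z).re = (charFn μ z).re - 1 + ν * ‖z‖ ^ α := by
  simp [remainder, normPow, ← Complex.ofReal_mul]

lemma remainder_zero [IsProbabilityMeasure μ] (hα : α ≠ 0) :
    remainder μ α ν (0 : Space d) = 0 := by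
  simp [remainder, charFn_zero, normPow, Real.zero_rpow hα]

lemma continuous_remainder [IsFiniteMeasure μ] (hα : 0 ≤ α) :
    Continuous (remainder μ α ν) :=
  (continuous_charFn.sub continuous_const).add (continuous_const.mul (continuous_normPow hα))

lemma Assumption1.exists_norm_remainder_le [IsProbabilityMeasure μ] (h : Assumption1 μ α ν a)
    (hα : 0 < α) :
    ∃ C : ℝ, 0 < C ∧ ∀ z ∈ bigCube d, ‖remainder μ α ν z‖ ≤ C * ‖z‖ ^ (α + a) := by
  obtain ⟨C, hC0, hC⟩ := exists_norm_le_mul_norm_rpow (β := a + α) isCompact_bigCube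
    (fun z _ _ => (continuous_remainder hα.le).continuousAt)
    (h.remainder_isBigO.mono nhdsWithin_le_nhds)
  refine ⟨C, hC0, fun z hz => ?_⟩
  rcases eq_or_ne z 0 with rfl | hz0
  · rw [remainder_zero hα.ne', norm_zero]
    positivity
  · rw [add_comm]
    exact hC z hz hz0

lemma Assumption1.eventually_le_one_sub_re_charFn (h : Assumption1 μ α ν a) (ha : 0 < a)
    (hν : 0 < ν) : ∀ᶠ z : Space d in 𝓝[≠] 0, ν / 2 * ‖z‖ ^ α ≤ 1 - (charFn μ z).re := by
  obtain ⟨B, hB⟩ := h.remainder_isBigO.bound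
  have hsmall : Tendsto (fun z : Space d => B * ‖z‖ ^ a) (𝓝 0) (𝓝 0) := by
    have hcont : Continuous fun z : Space d => B * ‖z‖ ^ a :=
      continuous_const.mul (continuous_norm.rpow_const fun _ => Or.inr ha.le)
    simpa [Real.zero_rpow ha.ne'] using hcont.tendsto 0
  filter_upwards [nhdsWithin_le_nhds hB,
    nhdsWithin_le_nhds (hsmall.eventually (gt_mem_nhds (half_pos hν))), self_mem_nhdsWithin]
    with z hz hza hz0
  have hz' : 0 < ‖z‖ := norm_pos_iff.2 hz0
  have hre : (remainder μ α ν z).re ≤ B * ‖z‖ ^ a * ‖z‖ ^ α := by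
    refine (Complex.re_le_norm _).trans (hz.trans_eq ?_)
    rw [Real.norm_of_nonneg (by positivity), Real.rpow_add hz', mul_assoc]
  rw [re_remainder] at hre
  have hpow : 0 < ‖z‖ ^ α := by positivity
  nlinarith

lemma Assumption1.exists_le_one_sub_re_charFn [IsProbabilityMeasure μ] (h : Assumption1 μ α ν a)
    (hα : 0 < α) (ha : 0 < a) (hν : 0 < ν) :
    ∃ c : ℝ, 0 < c ∧ c ≤ ν ∧ ∀ z ∈ bigCube d, c * ‖z‖ ^ α ≤ 1 - (charFn μ z).re := by
  obtain ⟨c, hc0, hc⟩ := exists_pos_mul_norm_rpow_le isCompact_bigCube (half_pos hν)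
    (fun z _ _ => (continuous_const.sub
      (Complex.continuous_re.comp continuous_charFn)).continuousAt)
    (fun z hz hz0 => sub_pos.2 (h.re_charFn_lt_one hz hz0))
    (h.eventually_le_one_sub_re_charFn ha hν)
  refine ⟨min c ν, by positivity, min_le_right _ _, fun z hz => ?_⟩
  rcases eq_or_ne z 0 with rfl | hz0
  · simp [Real.zero_rpow hα.ne', charFn_zero]
  · refine le_trans ?_ (hc z hz hz0)
    gcongr
    exact min_le_left _ _

lemma Assumption2.contDiffAt_charFn (h : Assumption2 μ α ν a) {z : Space d} (hz : z ∈ bigCube d)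
    (hz0 : z ≠ 0) : ContDiffAt ℝ (d + 3 : ℕ) (charFn μ) z := by
  obtain ⟨w, hw, hw0, n, rfl⟩ := exists_mem_cube_eq_add hz hz0
  have hremainder : charFn μ = fun z => remainder μ α ν z + 1 - ν * normPow α z := by
    ext z
    simp only [remainder]
    ring
  have hcube : ContDiffAt ℝ (d + 3 : ℕ) (charFn μ) w := by
    rw [hremainder]
    exact ((h.contDiffAt w hw hw0).add contDiffAt_const).sub
      (contDiffAt_const.mul (contDiffAt_normPow α hw0 _))
  have hperiod : charFn μ = charFn μ ∘ fun z => z - (2 * Real.pi) • toSpace n := by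
    ext z
    rw [Function.comp_apply, ← charFn_add_two_pi_smul_toSpace (z - (2 * Real.pi) • toSpace n) n,
      sub_add_cancel]
  rw [hperiod]
  exact ContDiffAt.comp _ (by simpa using hcube) (by fun_prop)

lemma Assumption2.exists_norm_derivRemainder_le (h : Assumption2 μ α ν a) :
    ∃ C : ℝ, 0 < C ∧ ∀ k : ℕ, 1 ≤ k → k ≤ d + 3 → ∀ i : Fin d, ∀ z ∈ bigCube d, z ≠ 0 →
      ‖derivRemainder μ α ν k i z‖ ≤ C * ‖z‖ ^ (α + a - k) := by
  have hk : ∀ (k : Set.Icc 1 (d + 3)) (i : Fin d), ∃ C : ℝ, ∀ z ∈ bigCube d, z ≠ 0 →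
      ‖derivRemainder μ α ν k i z‖ ≤ C * ‖z‖ ^ (α + a - k) := fun k i =>
    (exists_norm_le_mul_norm_rpow isCompact_bigCube
      (fun z hz hz0 => (continuousAt_partialDeriv ((h.contDiffAt_charFn hz hz0).of_le
          (by exact_mod_cast k.2.2))).add
        (continuousAt_const.mul (continuousAt_partialDeriv (contDiffAt_normPow α hz0 k))))
      (h.derivRemainder_isBigO k k.2.1 k.2.2 i)).imp fun _ => And.right
  choose C hC using hk
  obtain ⟨M, hM⟩ := Finite.exists_le fun p : Set.Icc 1 (d + 3) × Fin d => C p.1 p.2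
  refine ⟨max M 1, by positivity, fun k hk1 hk i z hz hz0 => (hC ⟨k, hk1, hk⟩ i z hz hz0).trans ?_⟩
  gcongr
  exact (hM (⟨k, hk1, hk⟩, i)).trans (le_max_left _ _)

end CharFn

/-! ### The symbols `exp (s (μ̂ - 1))` and `exp (-s ν |z|^α)` -/

/-- The characteristic function of the walk at time `s`. -/
noncomputable def walkSymbol {d : ℕ} (μ : Measure (Fin d → ℤ)) (s : ℝ) (z : Space d) : ℂ :=
  Complex.exp (s * (charFn μ z - 1))

/-- The Fourier transform of the heat kernel at time `s`. -/
noncomputable def heatSymbol {d : ℕ} (α ν s : ℝ) (z : Space d) : ℂ :=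
  Complex.exp (s * -(ν * normPow α z))

lemma exists_rpow_mul_exp_neg_le {p c : ℝ} (hp : 0 ≤ p) (hc : 0 < c) :
    ∃ C : ℝ, 0 < C ∧ ∀ x : ℝ, 0 ≤ x → x ^ p * Real.exp (-(c * x)) ≤ C := by
  obtain ⟨n, hn⟩ := exists_nat_ge p
  refine ⟨1 + n.factorial / c ^ n, by positivity, fun x hx => ?_⟩
  have hpow : x ^ p ≤ 1 + x ^ n := by
    rcases le_total x 1 with h | h
    · exact (Real.rpow_le_one hx h hp).trans (le_add_of_nonneg_right (by positivity))
    · rw [← Real.rpow_natCast x n]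
      exact (Real.rpow_le_rpow_of_exponent_le h hn).trans (le_add_of_nonneg_left zero_le_one)
  have hexp : Real.exp (-(c * x)) ≤ 1 := Real.exp_le_one_iff.2 (by nlinarith)
  have hpowexp : x ^ n * Real.exp (-(c * x)) ≤ n.factorial / c ^ n := by
    have hseries := Real.pow_div_factorial_le_exp (c * x) (by positivity) n
    rw [div_le_iff₀ (by positivity), mul_pow] at hseries
    rw [Real.exp_neg, ← div_eq_mul_inv, div_le_div_iff₀ (Real.exp_pos _) (by positivity)]
    linarith
  calc x ^ p * Real.exp (-(c * x)) ≤ (1 + x ^ n) * Real.exp (-(c * x)) := by gcongr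
    _ = Real.exp (-(c * x)) + x ^ n * Real.exp (-(c * x)) := by ring
    _ ≤ 1 + n.factorial / c ^ n := add_le_add hexp hpowexp

lemma exists_one_add_mul_pow_mul_exp_neg_le (m : ℕ) {B c : ℝ} (hB : 0 ≤ B) (hc : 0 < c) :
    ∃ C : ℝ, 0 < C ∧ ∀ x : ℝ, 0 ≤ x → (1 + B * x) ^ m * Real.exp (-(c * x)) ≤ C := by
  obtain ⟨C, hC0, hC⟩ := exists_rpow_mul_exp_neg_le (Nat.cast_nonneg m) hc
  refine ⟨2 ^ (m - 1) * (1 + B ^ m * C), by positivity, fun x hx => ?_⟩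
  have hpow : (1 + B * x) ^ m ≤ 2 ^ (m - 1) * (1 + B ^ m * x ^ m) := by
    simpa [mul_pow] using add_pow_le zero_le_one (by positivity : 0 ≤ B * x) m
  have hexp : Real.exp (-(c * x)) ≤ 1 := Real.exp_le_one_iff.2 (by nlinarith)
  calc (1 + B * x) ^ m * Real.exp (-(c * x))
      ≤ 2 ^ (m - 1) * (1 + B ^ m * x ^ m) * Real.exp (-(c * x)) := by gcongr
    _ = 2 ^ (m - 1) * (Real.exp (-(c * x)) + B ^ m * (x ^ m * Real.exp (-(c * x)))) := by ring
    _ ≤ 2 ^ (m - 1) * (1 + B ^ m * C) := by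
      gcongr
      simpa using hC x hx

lemma norm_cexp_sub_cexp_le {x y : ℂ} {M : ℝ} (hx : x.re ≤ M) (hy : y.re ≤ M) :
    ‖Complex.exp x - Complex.exp y‖ ≤ Real.exp M * ‖x - y‖ := by
  refine (convex_halfSpace_re_le M).norm_image_sub_le_of_norm_deriv_le (f := Complex.exp)
    (fun z _ => Complex.differentiableAt_exp) (fun z hz => ?_) hy hx
  rw [Complex.deriv_exp, Complex.norm_exp]
  exact Real.exp_le_exp.2 hz

section Symbols

variable {d : ℕ} {μ : Measure (Fin d → ℤ)} {α ν a : ℝ}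

lemma heatSymbol_eq_ofReal (s : ℝ) (z : Space d) :
    heatSymbol α ν s z = (Real.exp (-s * ν * ‖z‖ ^ α) : ℂ) := by
  rw [heatSymbol, normPow, Complex.ofReal_exp]
  congr 1
  push_cast
  ring

lemma norm_heatSymbol (s : ℝ) (z : Space d) :
    ‖heatSymbol α ν s z‖ = Real.exp (-(s * ν * ‖z‖ ^ α)) := by
  rw [heatSymbol_eq_ofReal, Complex.norm_real, Real.norm_of_nonneg (Real.exp_pos _).le]
  ring_nf

lemma norm_heatSymbol_le {c s : ℝ} (hs : 0 ≤ s) (hcν : c ≤ ν) (z : Space d) :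
    ‖heatSymbol α ν s z‖ ≤ Real.exp (-(c * (s * ‖z‖ ^ α))) := by
  rw [norm_heatSymbol, mul_assoc, mul_left_comm]
  gcongr

lemma walkExponent_sub_heatExponent (s : ℝ) (z : Space d) :
    (s : ℂ) * (charFn μ z - 1) - s * -(ν * normPow α z) = s * remainder μ α ν z := by
  rw [remainder]
  ring

lemma norm_walkSymbol_sub_heatSymbol_le {c B s : ℝ} {z : Space d} (hs : 0 ≤ s) (hcν : c ≤ ν)
    (hc : c * ‖z‖ ^ α ≤ 1 - (charFn μ z).re)
    (hB : ‖remainder μ α ν z‖ ≤ B * ‖z‖ ^ (α + a)) :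
    ‖walkSymbol μ s z - heatSymbol α ν s z‖ ≤
      Real.exp (-(c * (s * ‖z‖ ^ α))) * (B * (s * ‖z‖ ^ (α + a))) := by
  have hwalk : ((s : ℂ) * (charFn μ z - 1)).re ≤ -(c * (s * ‖z‖ ^ α)) := by
    rw [Complex.re_ofReal_mul, Complex.sub_re, Complex.one_re]
    nlinarith
  have hheat : ((s : ℂ) * -(ν * normPow α z)).re ≤ -(c * (s * ‖z‖ ^ α)) := by
    rw [Complex.re_ofReal_mul, Complex.neg_re, Complex.re_ofReal_mul, normPow, Complex.ofReal_re]
    have : 0 ≤ s * ‖z‖ ^ α := by positivity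
    nlinarith
  refine (norm_cexp_sub_cexp_le hwalk hheat).trans ?_
  rw [walkExponent_sub_heatExponent, norm_mul, Complex.norm_real, Real.norm_of_nonneg hs,
    mul_left_comm B]
  gcongr

lemma continuous_heatSymbol (hα : 0 ≤ α) (s : ℝ) :
    Continuous (heatSymbol α ν s : Space d → ℂ) :=
  Complex.continuous_exp.comp
    (continuous_const.mul (continuous_const.mul (continuous_normPow hα)).neg)

lemma contDiffAt_heatSymbol (s : ℝ) {z : Space d} (hz : z ≠ 0) (n : WithTop ℕ∞) :
    ContDiffAt ℝ n (heatSymbol α ν s) z :=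
  (contDiffAt_const.mul (contDiffAt_const.mul (contDiffAt_normPow α hz n)).neg).cexp

lemma contDiffAt_walkSymbol {n : WithTop ℕ∞} (s : ℝ) {z : Space d}
    (hz : ContDiffAt ℝ n (charFn μ) z) : ContDiffAt ℝ n (walkSymbol μ s) z :=
  (contDiffAt_const.mul (hz.sub contDiffAt_const)).cexp

end Symbols

section SymbolDerivatives

variable {d : ℕ}

lemma partialDeriv_const_mul (k : ℕ) (i : Fin d) (c : ℂ) (f : Space d → ℂ) (z : Space d) :
    partialDeriv k i (fun w => c * f w) z = c * partialDeriv k i f z :=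
  iteratedDeriv_const_mul_field _ _

lemma partialDeriv_sub_const {k : ℕ} (hk : k ≠ 0) (i : Fin d) (f : Space d → ℂ) (c : ℂ)
    (z : Space d) : partialDeriv k i (fun w => f w - c) z = partialDeriv k i f z := by
  simp_rw [partialDeriv, sub_eq_neg_add]
  exact iteratedDeriv_const_add (Nat.pos_of_ne_zero hk) _

lemma exists_norm_partialDeriv_cexp_le (d m : ℕ) : ∃ C : ℝ, 0 ≤ C ∧
    ∀ (f : Space d → ℂ) (i : Fin d) (z : Space d) (ρ K M : ℝ), 0 < ρ → 0 ≤ K →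
      ContDiffAt ℝ m f z → (∀ j, 1 ≤ j → j ≤ m → ‖partialDeriv j i f z‖ ≤ K / ρ ^ j) →
      ‖Complex.exp (f z)‖ ≤ M →
      ‖partialDeriv m i (fun w => Complex.exp (f w)) z‖ ≤ C * M * (1 + K) ^ m / ρ ^ m := by
  obtain ⟨C, hC0, hC⟩ := exists_norm_iteratedDeriv_cexp_le m
  exact ⟨C, hC0, fun f i z ρ K M hρ hK hf hfK hM =>
    hC (fun u => f (z + u • EuclideanSpace.single i (1 : ℝ))) 0 ρ K M hρ hK
      (contDiffAt_comp_line (by simpa using hf)) hfK (by simpa using hM)⟩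

lemma exists_norm_partialDeriv_cexp_sub_cexp_le (d m : ℕ) : ∃ C : ℝ, 0 ≤ C ∧
    ∀ (f g : Space d → ℂ) (i : Fin d) (z : Space d) (ρ K δ M : ℝ), 0 < ρ → 0 ≤ K →
      ContDiffAt ℝ m f z → ContDiffAt ℝ m g z →
      (∀ j, 1 ≤ j → j ≤ m → ‖partialDeriv j i f z‖ ≤ K / ρ ^ j) →
      (∀ j, 1 ≤ j → j ≤ m → ‖partialDeriv j i g z‖ ≤ K / ρ ^ j) →
      (∀ j, 1 ≤ j → j ≤ m → ‖partialDeriv j i f z - partialDeriv j i g z‖ ≤ δ / ρ ^ j) →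
      ‖Complex.exp (g z)‖ ≤ M → ‖Complex.exp (f z) - Complex.exp (g z)‖ ≤ M * δ →
      ‖partialDeriv m i (fun w => Complex.exp (f w)) z -
        partialDeriv m i (fun w => Complex.exp (g w)) z‖ ≤
          C * (M * δ) * (1 + K) ^ m / ρ ^ m := by
  obtain ⟨C, hC0, hC⟩ := exists_norm_iteratedDeriv_cexp_sub_cexp_le m
  exact ⟨C, hC0, fun f g i z ρ K δ M hρ hK hf hg hfK hgK hfg hM hδ =>
    hC (fun u => f (z + u • EuclideanSpace.single i (1 : ℝ)))
      (fun u => g (z + u • EuclideanSpace.single i (1 : ℝ))) 0 ρ K δ M hρ hK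
      (contDiffAt_comp_line (by simpa using hf)) (contDiffAt_comp_line (by simpa using hg))
      hfK hgK hfg (by simpa using hM) (by simpa using hδ)⟩

variable {μ : Measure (Fin d → ℤ)} {α ν a : ℝ}

lemma partialDeriv_heatExponent (k : ℕ) (i : Fin d) (s : ℝ) (z : Space d) :
    partialDeriv k i (fun w => (s : ℂ) * -(ν * normPow α w)) z =
      -(s * ν) * partialDeriv k i (normPow α) z := by
  rw [← partialDeriv_const_mul]
  congr 1
  ext w
  ring

lemma norm_partialDeriv_heatExponent_le {C s : ℝ} (hs : 0 ≤ s) (hν : 0 ≤ ν) {k : ℕ} {i : Fin d}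
    {z : Space d} (hz : z ≠ 0) (hC : ‖partialDeriv k i (normPow α) z‖ ≤ C * ‖z‖ ^ (α - k)) :
    ‖partialDeriv k i (fun w => (s : ℂ) * -(ν * normPow α w)) z‖ ≤
      ν * C * (s * ‖z‖ ^ α) / ‖z‖ ^ k := by
  rw [partialDeriv_heatExponent, norm_mul, norm_neg, norm_mul, Complex.norm_real,
    Complex.norm_real, Real.norm_of_nonneg hs, Real.norm_of_nonneg hν]
  rw [Real.rpow_sub_natCast (norm_ne_zero_iff.2 hz)] at hC
  calc s * ν * ‖partialDeriv k i (normPow α) z‖ ≤ s * ν * (C * (‖z‖ ^ α / ‖z‖ ^ k)) := by gcongr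
    _ = ν * C * (s * ‖z‖ ^ α) / ‖z‖ ^ k := by ring

lemma partialDeriv_walkExponent_sub_heatExponent {k : ℕ} (hk : k ≠ 0) (i : Fin d) (s : ℝ)
    (z : Space d) :
    partialDeriv k i (fun w => (s : ℂ) * (charFn μ w - 1)) z -
      partialDeriv k i (fun w => (s : ℂ) * -(ν * normPow α w)) z =
        s * derivRemainder μ α ν k i z := by
  rw [partialDeriv_heatExponent, partialDeriv_const_mul, partialDeriv_sub_const hk,
    derivRemainder]
  ring

lemma norm_partialDeriv_walkExponent_sub_heatExponent_le {B s : ℝ} (hs : 0 ≤ s) {k : ℕ}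
    (hk : k ≠ 0) {i : Fin d} {z : Space d} (hz : z ≠ 0)
    (hB : ‖derivRemainder μ α ν k i z‖ ≤ B * ‖z‖ ^ (α + a - k)) :
    ‖partialDeriv k i (fun w => (s : ℂ) * (charFn μ w - 1)) z -
      partialDeriv k i (fun w => (s : ℂ) * -(ν * normPow α w)) z‖ ≤
        B * (s * ‖z‖ ^ (α + a)) / ‖z‖ ^ k := by
  rw [partialDeriv_walkExponent_sub_heatExponent hk, norm_mul, Complex.norm_real,
    Real.norm_of_nonneg hs]
  rw [Real.rpow_sub_natCast (norm_ne_zero_iff.2 hz)] at hB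
  calc s * ‖derivRemainder μ α ν k i z‖ ≤ s * (B * (‖z‖ ^ (α + a) / ‖z‖ ^ k)) := by gcongr
    _ = B * (s * ‖z‖ ^ (α + a)) / ‖z‖ ^ k := by ring

lemma exists_norm_partialDeriv_heatSymbol_le (d : ℕ) (α : ℝ) (hν : 0 < ν) (m : ℕ) :
    ∃ A : ℝ, 0 ≤ A ∧ ∀ s : ℝ, 0 ≤ s → ∀ (i : Fin d) (z : Space d), z ≠ 0 →
      ‖partialDeriv m i (heatSymbol α ν s) z‖ ≤ A / ‖z‖ ^ m := by
  obtain ⟨C, hC0, hC⟩ := exists_forall_norm_partialDeriv_normPow_le d α m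
  obtain ⟨D, hD0, hD⟩ := exists_norm_partialDeriv_cexp_le d m
  obtain ⟨M, hM0, hM⟩ := exists_one_add_mul_pow_mul_exp_neg_le m (mul_pos hν hC0).le hν
  refine ⟨D * M, by positivity, fun s hs i z hz => ?_⟩
  have hderiv := hD (fun w => (s : ℂ) * -(ν * normPow α w)) i z ‖z‖ (ν * C * (s * ‖z‖ ^ α))
    (Real.exp (-(ν * (s * ‖z‖ ^ α)))) (norm_pos_iff.2 hz) (by positivity)
    (contDiffAt_const.mul (contDiffAt_const.mul (contDiffAt_normPow α hz m)).neg)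
    (fun j _ hj => norm_partialDeriv_heatExponent_le hs hν.le hz (hC j hj i z hz))
    (norm_heatSymbol_le hs le_rfl z)
  refine hderiv.trans ?_
  rw [mul_assoc D, mul_comm (Real.exp _)]
  gcongr
  exact hM _ (by positivity)

lemma exists_norm_partialDeriv_symbol_sub_le_of_le (μ : Measure (Fin d → ℤ)) (α a : ℝ)
    (hν : 0 ≤ ν) (m : ℕ) :
    ∃ D : ℝ, 0 ≤ D ∧ ∀ (s c B C L : ℝ) (i : Fin d) (z : Space d), 0 ≤ s → 0 ≤ B → 0 ≤ C →
      z ≠ 0 → ContDiffAt ℝ m (charFn μ) z → c ≤ ν → c * ‖z‖ ^ α ≤ 1 - (charFn μ z).re →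
      ‖remainder μ α ν z‖ ≤ B * ‖z‖ ^ (α + a) →
      (∀ j, 1 ≤ j → j ≤ m → ‖derivRemainder μ α ν j i z‖ ≤ B * ‖z‖ ^ (α + a - j)) →
      (∀ j ≤ m, ‖partialDeriv j i (normPow α) z‖ ≤ C * ‖z‖ ^ (α - j)) →
      ν * C + B * ‖z‖ ^ a ≤ L →
      ‖partialDeriv m i (walkSymbol μ s) z - partialDeriv m i (heatSymbol α ν s) z‖ ≤
        D * (Real.exp (-(c * (s * ‖z‖ ^ α))) * (B * (s * ‖z‖ ^ (α + a)))) *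
          (1 + L * (s * ‖z‖ ^ α)) ^ m / ‖z‖ ^ m := by
  obtain ⟨D, hD0, hD⟩ := exists_norm_partialDeriv_cexp_sub_cexp_le d m
  refine ⟨D, hD0, fun s c B C L i z hs hB0 hC0 hz hsmooth hcν hc hB hBj hC hL => ?_⟩
  have hz' : 0 < ‖z‖ := norm_pos_iff.2 hz
  have hBa : 0 ≤ B * ‖z‖ ^ a := by positivity
  have hL0 : 0 ≤ L := le_trans (by positivity) hL
  have hsub : ∀ j, 1 ≤ j → j ≤ m →
      ‖partialDeriv j i (fun w => (s : ℂ) * (charFn μ w - 1)) z -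
        partialDeriv j i (fun w => (s : ℂ) * -(ν * normPow α w)) z‖ ≤
          B * (s * ‖z‖ ^ (α + a)) / ‖z‖ ^ j := fun j hj1 hj =>
    norm_partialDeriv_walkExponent_sub_heatExponent_le hs (Nat.one_le_iff_ne_zero.1 hj1) hz
      (hBj j hj1 hj)
  have hheat : ∀ j ≤ m, ‖partialDeriv j i (fun w => (s : ℂ) * -(ν * normPow α w)) z‖ ≤
      ν * C * (s * ‖z‖ ^ α) / ‖z‖ ^ j := fun j hj =>
    norm_partialDeriv_heatExponent_le hs hν hz (hC j hj)
  refine hD _ _ i z ‖z‖ (L * (s * ‖z‖ ^ α)) (B * (s * ‖z‖ ^ (α + a))) _ hz' (by positivity)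
    (contDiffAt_const.mul (hsmooth.sub contDiffAt_const))
    (contDiffAt_const.mul (contDiffAt_const.mul (contDiffAt_normPow α hz m)).neg)
    (fun j hj1 hj => ?_) (fun j _ hj => (hheat j hj).trans ?_) hsub (norm_heatSymbol_le hs hcν z)
    (norm_walkSymbol_sub_heatSymbol_le hs hcν hc hB)
  · refine (norm_le_norm_sub_add _ _).trans ((add_le_add (hsub j hj1 hj) (hheat j hj)).trans ?_)
    rw [← add_div, Real.rpow_add hz', show B * (s * (‖z‖ ^ α * ‖z‖ ^ a)) +
      ν * C * (s * ‖z‖ ^ α) = (ν * C + B * ‖z‖ ^ a) * (s * ‖z‖ ^ α) by ring]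
    gcongr
  · gcongr
    linarith

lemma exists_forall_mem_bigCube_norm_le (d : ℕ) : ∃ R : ℝ, 0 < R ∧ ∀ z ∈ bigCube d, ‖z‖ ≤ R :=
  isCompact_bigCube.isBounded.exists_pos_norm_le

lemma exists_norm_partialDeriv_symbol_sub_le [IsProbabilityMeasure μ] (h1 : Assumption1 μ α ν a)
    (h2 : Assumption2 μ α ν a) (hα : 0 < α) (hν : 0 < ν) (ha : 0 < a) :
    ∃ A : ℝ, 0 ≤ A ∧ ∀ s : ℝ, 0 ≤ s → ∀ (i : Fin d), ∀ z ∈ bigCube d, z ≠ 0 →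
      ‖partialDeriv (d + 3) i (walkSymbol μ s) z - partialDeriv (d + 3) i (heatSymbol α ν s) z‖ ≤
        A * s * ‖z‖ ^ (α + a - (d + 3 : ℕ)) := by
  obtain ⟨C, hC0, hC⟩ := exists_forall_norm_partialDeriv_normPow_le d α (d + 3)
  obtain ⟨D, hD0, hD⟩ := exists_norm_partialDeriv_symbol_sub_le_of_le μ α a hν.le (d + 3)
  obtain ⟨c, hc0, hcν, hc⟩ := h1.exists_le_one_sub_re_charFn hα ha hν
  obtain ⟨B₀, hB₀0, hB₀⟩ := h1.exists_norm_remainder_le hα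
  obtain ⟨B₁, -, hB₁⟩ := h2.exists_norm_derivRemainder_le
  obtain ⟨R, hR0, hR⟩ := exists_forall_mem_bigCube_norm_le d
  let B := max B₀ B₁
  have hB0 : 0 < B := lt_max_of_lt_left hB₀0
  obtain ⟨M, hM0, hM⟩ := exists_one_add_mul_pow_mul_exp_neg_le (d + 3)
    (B := ν * C + B * R ^ a) (by positivity) hc0
  refine ⟨D * B * M, by positivity, fun s hs i z hz hz0 => ?_⟩
  have hz' : 0 < ‖z‖ := norm_pos_iff.2 hz0
  refine (hD s c B C (ν * C + B * R ^ a) i z hs hB0.le hC0.le hz0 (h2.contDiffAt_charFn hz hz0)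
    hcν (hc z hz) ((hB₀ z hz).trans ?_) (fun j hj1 hj => (hB₁ j hj1 hj i z hz hz0).trans ?_)
    (fun j hj => hC j hj i z hz0) ?_).trans ?_
  · gcongr
    exact le_max_left _ _
  · gcongr
    exact le_max_right _ _
  · gcongr
    exact hR z hz
  · rw [Real.rpow_sub_natCast hz'.ne']
    calc _ = D * B * ((1 + (ν * C + B * R ^ a) * (s * ‖z‖ ^ α)) ^ (d + 3) *
          Real.exp (-(c * (s * ‖z‖ ^ α)))) * s * (‖z‖ ^ (α + a) / ‖z‖ ^ (d + 3)) := by ring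
      _ ≤ D * B * M * s * (‖z‖ ^ (α + a) / ‖z‖ ^ (d + 3)) := by
        gcongr
        exact hM _ (by positivity)

end SymbolDerivatives

/-! ### Transition probabilities and heat kernels as Fourier integrals -/

section Haar

variable {E : Type*} [NormedAddCommGroup E] [NormedSpace ℝ E] [FiniteDimensional ℝ E]
  [MeasurableSpace E] [BorelSpace E] (κ : Measure E) [κ.IsAddHaarMeasure]

open Module (finrank)

lemma integrable_norm_rpow_mul_exp_neg {α β c : ℝ} (hα : 0 < α) (hβ : 0 ≤ β) (hc : 0 < c) :
    Integrable (fun z : E => ‖z‖ ^ β * Real.exp (-(c * ‖z‖ ^ α))) κ := by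
  rcases subsingleton_or_nontrivial E with _ | _
  · exact .of_finite
  rw [integrable_fun_norm_addHaar κ (f := fun r => r ^ β * Real.exp (-(c * r ^ α)))]
  have hdim : -1 < ((finrank ℝ E - 1 : ℕ) : ℝ) + β :=
    neg_one_lt_zero.trans_le (by positivity)
  refine (integrableOn_rpow_mul_exp_neg_mul_rpow hdim hα hc).congr_fun (fun r hr => ?_)
    measurableSet_Ioi
  change r ^ (((finrank ℝ E - 1 : ℕ) : ℝ) + β) * _ = _
  rw [Real.rpow_add (Set.mem_Ioi.1 hr), Real.rpow_natCast, smul_eq_mul, mul_assoc, neg_mul]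

lemma integral_mul_norm_rpow_mul_exp_neg {α a c s : ℝ} (hα : 0 < α) (hs : 0 < s) :
    ∫ z, s * ‖z‖ ^ (α + a) * Real.exp (-(c * (s * ‖z‖ ^ α))) ∂κ =
      s ^ (-((finrank ℝ E + a) / α)) *
        ∫ z, ‖z‖ ^ (α + a) * Real.exp (-(c * ‖z‖ ^ α)) ∂κ := by
  have hR : 0 < s ^ (1 / α) := by positivity
  have hRα : (s ^ (1 / α)) ^ α = s := by
    rw [← Real.rpow_mul hs.le, one_div, inv_mul_cancel₀ hα.ne', Real.rpow_one]
  have hRz : ∀ z : E, ‖s ^ (1 / α) • z‖ = s ^ (1 / α) * ‖z‖ := fun z => by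
    rw [norm_smul, Real.norm_of_nonneg hR.le]
  have hscale : ∀ z : E, s * ‖z‖ ^ (α + a) * Real.exp (-(c * (s * ‖z‖ ^ α))) =
      s ^ (-(a / α)) * (‖s ^ (1 / α) • z‖ ^ (α + a) *
        Real.exp (-(c * ‖s ^ (1 / α) • z‖ ^ α))) := fun z => by
    rw [hRz, Real.mul_rpow hR.le (norm_nonneg _), Real.mul_rpow hR.le (norm_nonneg _), hRα,
      Real.rpow_add hR, hRα, ← Real.rpow_mul hs.le, one_div_mul_eq_div, Real.rpow_neg hs.le]
    field_simp
  simp_rw [hscale]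
  rw [integral_const_mul, Measure.integral_comp_smul_of_nonneg κ
    (fun z => ‖z‖ ^ (α + a) * Real.exp (-(c * ‖z‖ ^ α))) _ (hR := hR.le), smul_eq_mul, ← mul_assoc,
    ← Real.rpow_natCast, ← Real.rpow_mul hs.le, ← Real.rpow_neg hs.le, ← Real.rpow_add hs]
  ring_nf

lemma integrable_add_norm_rpow_neg {h r : ℝ} (hh : 0 < h) (hr : finrank ℝ E < r) :
    Integrable (fun z : E => (h + ‖z‖) ^ (-r)) κ := by
  have hone := (integrable_one_add_norm (μ := κ) hr).comp_smul (inv_ne_zero hh.ne')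
  refine (hone.const_mul (h ^ (-r))).congr (ae_of_all _ fun z => ?_)
  simp only [norm_smul, norm_inv, Real.norm_of_nonneg hh.le]
  rw [← Real.mul_rpow hh.le (by positivity), mul_add, mul_one, mul_inv_cancel_left₀ hh.ne']

lemma integral_add_norm_rpow_neg {h : ℝ} (hh : 0 < h) (r : ℝ) :
    ∫ z, (h + ‖z‖) ^ (-r) ∂κ = h ^ (finrank ℝ E - r) * ∫ z, (1 + ‖z‖) ^ (-r) ∂κ := by
  have hscale : ∀ z : E, (h + ‖z‖) ^ (-r) = h ^ (-r) * (1 + ‖h⁻¹ • z‖) ^ (-r) := fun z => by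
    rw [norm_smul, norm_inv, Real.norm_of_nonneg hh.le, ← Real.mul_rpow hh.le (by positivity),
      mul_add, mul_one, mul_inv_cancel_left₀ hh.ne']
  simp_rw [hscale]
  rw [integral_const_mul, Measure.integral_comp_inv_smul_of_nonneg κ
    (fun z => (1 + ‖z‖) ^ (-r)) hh.le, smul_eq_mul, ← mul_assoc, ← Real.rpow_natCast,
    ← Real.rpow_add hh, neg_add_eq_sub]

end Haar

lemma integrable_iterate_fwdDiff {M : Type*} [AddCommMonoid M] [MeasurableSpace M]
    {κ : Measure M} {f : M → ℂ} {v : M}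
    (hf : ∀ j : ℕ, Integrable (fun z => f (z + j • v)) κ) (m : ℕ) :
    Integrable ((fwdDiff v)^[m] f) κ := by
  rw [show (fwdDiff v)^[m] f = _ from funext (fwdDiff_iter_eq_sum_shift v f m)]
  exact integrable_finsetSum _ fun j _ => (hf j).smul _

section PlaneWaveIntegral

variable {E : Type*} [NormedAddCommGroup E] [InnerProductSpace ℝ E] [MeasurableSpace E]
  {κ : Measure E} {f : E → ℂ} {v x : E}

lemma integrable_planeWave_mul [OpensMeasurableSpace E] (hf : Integrable f κ) (x : E) :
    Integrable (fun z => planeWave z x * f z) κ :=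
  hf.bdd_mul (continuous_planeWave.comp (Continuous.prodMk_left x)).measurable.aestronglyMeasurable
    (ae_of_all _ fun z => (norm_planeWave z x).le)

lemma integral_planeWave_neg_mul_comp_add [MeasurableAdd E] [κ.IsAddRightInvariant] (f : E → ℂ)
    (x v : E) :
    ∫ z, planeWave z (-x) * f (z + v) ∂κ = planeWave v x * ∫ z, planeWave z (-x) * f z ∂κ := by
  rw [← integral_const_mul,
    ← integral_add_right_eq_self (fun z => planeWave v x * (planeWave z (-x) * f z)) v]
  have hcancel : planeWave v x * planeWave v (-x) = 1 := by
    rw [← planeWave_add_right, add_neg_cancel, planeWave_comm, planeWave_zero_left]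
  congr with z
  rw [planeWave_add_left]
  linear_combination (-(planeWave z (-x) * f (z + v))) * hcancel

lemma integral_planeWave_neg_mul_iterate_fwdDiff [OpensMeasurableSpace E] {w : ℂ}
    (hf : ∀ j : ℕ, Integrable (fun z => f (z + j • v)) κ)
    (hw : ∀ u, ∫ z, planeWave z (-x) * f (z + u) ∂κ = planeWave u x * w) (m : ℕ) :
    ∫ z, planeWave z (-x) * (fwdDiff v)^[m] f z ∂κ = (planeWave v x - 1) ^ m * w := by
  have hterm : ∀ (j : ℕ) (z : E), planeWave z (-x) *
      (((-1 : ℤ) ^ (m - j) * m.choose j) • f (z + j • v)) =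
      ((-1 : ℂ) ^ (m - j) * m.choose j) * (planeWave z (-x) * f (z + j • v)) := fun j z => by
    rw [zsmul_eq_mul]
    push_cast
    ring
  simp_rw [fwdDiff_iter_eq_sum_shift, Finset.mul_sum, hterm]
  rw [integral_finsetSum _ fun j _ => (integrable_planeWave_mul (hf j) _).const_mul _]
  simp_rw [integral_const_mul, hw, planeWave_nsmul_left]
  rw [sub_eq_add_neg, add_pow, Finset.sum_mul]
  exact Finset.sum_congr rfl fun j _ => by ring

end PlaneWaveIntegral

section Inversion

variable {d : ℕ} {ρ : Measure (Fin d → ℤ)} {α ν s : ℝ}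

lemma integrable_heatSymbol (hα : 0 < α) (hν : 0 < ν) (hs : 0 < s) :
    Integrable (heatSymbol α ν s : Space d → ℂ) := by
  refine (integrable_norm_rpow_mul_exp_neg volume hα le_rfl (mul_pos hs hν)).mono'
    (continuous_heatSymbol hα.le s).aestronglyMeasurable (ae_of_all _ fun z => ?_)
  rw [norm_heatSymbol, Real.rpow_zero, one_mul]

lemma heatKernel_eq_re_integral (α ν s : ℝ) (x : Space d) :
    heatKernel α ν s x =
      ((2 * Real.pi) ^ d)⁻¹ * (∫ z, planeWave z (-x) * heatSymbol α ν s z).re := by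
  simp_rw [heatKernel, planeWave, inner_neg_right, real_inner_comm x, heatSymbol_eq_ofReal,
    Complex.ofReal_neg, neg_mul, mul_neg]

lemma setIntegral_cube_planeWave_neg_mul_charFn_add [IsFiniteMeasure ρ] (k : Fin d → ℤ)
    (v : Space d) :
    ∫ z in cube d, planeWave z (-toSpace k) * charFn ρ (z + v) =
      planeWave v (toSpace k) * ((2 * (Real.pi : ℂ)) ^ d * ρ.real {k}) := by
  rw [mul_left_comm, ← setIntegral_cube_planeWave_mul_tsum
    (c := fun l => planeWave v (toSpace l) * (ρ.real {l} : ℂ))]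
  · congr! 4 with z
    refine tsum_congr fun l => ?_
    rw [← planeWave, planeWave_add_left, mul_assoc]
  · simpa only [norm_mul, norm_planeWave, one_mul, Complex.norm_real] using
      (summable_measureReal_singleton ρ).norm

lemma integral_planeWave_neg_mul_indicator_sub [IsProbabilityMeasure ρ] (hα : 0 < α) (hν : 0 < ν)
    (hs : 0 < s) (k : Fin d → ℤ) (v : Space d) (m : ℕ) :
    ∫ z, planeWave z (-toSpace k) * ((cube d).indicator ((fwdDiff v)^[m] (charFn ρ)) z -
      (fwdDiff v)^[m] (heatSymbol α ν s) z) =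
      (planeWave v (toSpace k) - 1) ^ m * ((2 * (Real.pi : ℂ)) ^ d * ρ.real {k} -
        ∫ z, planeWave z (-toSpace k) * heatSymbol α ν s z) := by
  have := isFiniteMeasure_restrict_cube (d := d)
  have hcharFn : ∀ j : ℕ, Integrable (fun z => charFn ρ (z + j • v)) (volume.restrict (cube d)) :=
    fun j => (integrable_const (1 : ℝ)).mono' (continuous_charFn.comp
      (continuous_id.add continuous_const)).aestronglyMeasurable
      (ae_of_all _ fun z => norm_charFn_le_one _)
  have hheat : ∀ j : ℕ, Integrable (fun z => heatSymbol α ν s (z + j • v)) volume := fun j =>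
    (integrable_heatSymbol hα hν hs).comp_add_right _
  have hcharFn_int := integrable_planeWave_mul (integrable_iterate_fwdDiff hcharFn m) (-toSpace k)
  rw [← IntegrableOn, ← integrable_indicator_iff measurableSet_cube] at hcharFn_int
  rw [mul_sub, ← integral_planeWave_neg_mul_iterate_fwdDiff hcharFn
      (setIntegral_cube_planeWave_neg_mul_charFn_add k) m,
    ← integral_planeWave_neg_mul_iterate_fwdDiff hheat
      (integral_planeWave_neg_mul_comp_add (heatSymbol α ν s) (toSpace k)) m,
    ← integral_indicator measurableSet_cube, ← integral_sub hcharFn_int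
      (integrable_planeWave_mul (integrable_iterate_fwdDiff hheat m) _)]
  congr with z
  by_cases hz : z ∈ cube d <;> simp [hz, mul_sub]

lemma two_pi_pow_mul_abs_sub_heatKernel_le (p : ℝ) (x : Space d) :
    (2 * Real.pi) ^ d * |p - heatKernel α ν s x| ≤
      ‖(2 * (Real.pi : ℂ)) ^ d * p - ∫ z, planeWave z (-x) * heatSymbol α ν s z‖ := by
  have hpi : 0 < (2 * Real.pi) ^ d := by positivity
  have hre : ((2 * (Real.pi : ℂ)) ^ d * p).re = (2 * Real.pi) ^ d * p := by
    exact_mod_cast Complex.ofReal_re ((2 * Real.pi) ^ d * p)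
  refine le_trans (le_of_eq ?_) (Complex.abs_re_le_norm _)
  rw [Complex.sub_re, hre, heatKernel_eq_re_integral, ← abs_of_pos hpi, ← abs_mul, abs_of_pos hpi,
    mul_sub, mul_inv_cancel_left₀ hpi.ne']

lemma norm_pow_mul_abs_measureReal_sub_heatKernel_le [IsProbabilityMeasure ρ] (hα : 0 < α)
    (hν : 0 < ν) (hs : 0 < s) (k : Fin d → ℤ) (v : Space d) (m : ℕ) {Φ : Space d → ℝ}
    (hΦ : Integrable Φ)
    (hb : ∀ z, ‖(cube d).indicator ((fwdDiff v)^[m] (charFn ρ)) z -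
      (fwdDiff v)^[m] (heatSymbol α ν s) z‖ ≤ Φ z) :
    ‖planeWave v (toSpace k) - 1‖ ^ m * |ρ.real {k} - heatKernel α ν s (toSpace k)| ≤
      ((2 * Real.pi) ^ d)⁻¹ * ∫ z, Φ z := by
  have hpi : 0 < (2 * Real.pi) ^ d := by positivity
  rw [inv_mul_eq_div, le_div_iff₀ hpi]
  calc ‖planeWave v (toSpace k) - 1‖ ^ m * |ρ.real {k} - heatKernel α ν s (toSpace k)| *
        (2 * Real.pi) ^ d
      = ‖planeWave v (toSpace k) - 1‖ ^ m *
          ((2 * Real.pi) ^ d * |ρ.real {k} - heatKernel α ν s (toSpace k)|) := by ring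
    _ ≤ ‖planeWave v (toSpace k) - 1‖ ^ m * ‖(2 * (Real.pi : ℂ)) ^ d * ρ.real {k} -
          ∫ z, planeWave z (-toSpace k) * heatSymbol α ν s z‖ := by
        gcongr
        exact two_pi_pow_mul_abs_sub_heatKernel_le _ _
    _ = ‖∫ z, planeWave z (-toSpace k) * ((cube d).indicator ((fwdDiff v)^[m] (charFn ρ)) z -
          (fwdDiff v)^[m] (heatSymbol α ν s) z)‖ := by
        rw [integral_planeWave_neg_mul_indicator_sub hα hν hs, norm_mul, norm_pow]
    _ ≤ ∫ z, Φ z := norm_integral_le_of_norm_le hΦ (ae_of_all _ fun z => by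
        rw [norm_mul, norm_planeWave, one_mul]
        exact hb z)

end Inversion

/-! ### Error bounds at lattice spacing one -/

section Geometry

variable {d : ℕ}

lemma mem_cube_of_norm_lt {z : Space d} (hz : ‖z‖ < Real.pi) : z ∈ cube d := fun i => by
  have hi := abs_lt.1 ((PiLp.norm_apply_le z i).trans_lt hz)
  exact ⟨hi.1, hi.2.le⟩

lemma norm_smul_single_one (i : Fin d) (u : ℝ) :
    ‖u • (EuclideanSpace.single i 1 : Space d)‖ = |u| := by
  rw [norm_smul, PiLp.norm_single, norm_one, mul_one, Real.norm_eq_abs]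

lemma nsmul_single (i : Fin d) (h : ℝ) (j : ℕ) :
    j • (EuclideanSpace.single i h : Space d) = (j * h) • EuclideanSpace.single i (1 : ℝ) := by
  ext l
  simp

lemma add_smul_single_mem_bigCube {z : Space d} (hz : z ∈ cube d) {i : Fin d} {u : ℝ}
    (hu : |u| ≤ 1 / 2) : z + u • EuclideanSpace.single i (1 : ℝ) ∈ bigCube d := fun j => by
  have hj := PiLp.norm_apply_le (u • (EuclideanSpace.single i 1 : Space d)) j
  rw [norm_smul_single_one] at hj
  exact (abs_add_le _ _).trans (add_le_add (abs_le.2 ⟨(hz j).1.le, (hz j).2⟩) (hj.trans hu))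

lemma half_norm_le_norm_add_smul_single {z : Space d} {i : Fin d} {u : ℝ} (hu : |u| ≤ ‖z‖ / 2) :
    ‖z‖ / 2 ≤ ‖z + u • EuclideanSpace.single i (1 : ℝ)‖ := by
  have htri := norm_le_add_norm_add z (u • EuclideanSpace.single i 1)
  rw [norm_smul_single_one] at htri
  linarith

lemma iterate_fwdDiff_single (f : Space d → ℂ) (i : Fin d) (h : ℝ) (m : ℕ) (z : Space d) :
    (fwdDiff (EuclideanSpace.single i h))^[m] f z =
      (fwdDiff h)^[m] (fun u : ℝ => f (z + u • EuclideanSpace.single i (1 : ℝ))) 0 := by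
  simp only [fwdDiff_iter_eq_sum_shift, zero_add, nsmul_single, nsmul_eq_mul]

lemma exists_norm_toSpace_le_mul_abs {k : Fin d → ℤ} (hk : k ≠ 0) :
    ∃ i, k i ≠ 0 ∧ ‖(toSpace k : Space d)‖ ≤ d * |(k i : ℝ)| := by
  obtain ⟨j, hj⟩ := Function.ne_iff.1 hk
  obtain ⟨i, -, hi⟩ := Finset.exists_max_image Finset.univ (fun i => |k i|) ⟨j, Finset.mem_univ j⟩
  refine ⟨i, abs_pos.1 ((abs_pos.2 hj).trans_le (hi j (Finset.mem_univ j))), ?_⟩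
  have hsum : (toSpace k : Space d) = ∑ l, (k l : ℝ) • EuclideanSpace.single l (1 : ℝ) := by
    ext l
    simp [toSpace, Pi.single_apply]
  rw [hsum]
  refine (norm_sum_le _ _).trans ?_
  simp_rw [norm_smul_single_one]
  refine (Finset.sum_le_card_nsmul _ _ |(k i : ℝ)| fun l hl => ?_).trans (by simp)
  exact_mod_cast hi l hl

lemma planeWave_single_pi_div_abs {k : Fin d → ℤ} {i : Fin d} (hi : k i ≠ 0) :
    planeWave (EuclideanSpace.single i (Real.pi / |(k i : ℝ)|)) (toSpace k) = -1 := by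
  have hki : (k i : ℝ) ≠ 0 := by exact_mod_cast hi
  rw [planeWave, EuclideanSpace.inner_single_left, mul_comm Complex.I]
  change Complex.exp (((Real.pi / |(k i : ℝ)| * k i : ℝ) : ℂ) * Complex.I) = -1
  rcases abs_choice (k i : ℝ) with h | h <;> rw [h]
  · rw [div_mul_cancel₀ _ hki, Complex.exp_pi_mul_I]
  · rw [div_neg, neg_mul, div_mul_cancel₀ _ hki, Complex.ofReal_neg, neg_mul, Complex.exp_neg,
      Complex.exp_pi_mul_I, inv_neg, inv_one]

end Geometry

lemma rpow_neg_le_mul_rpow_neg {x y c r : ℝ} (hx : 0 < x) (hy : 0 < y) (hyx : y ≤ c * x)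
    (hr : 0 ≤ r) : x ^ (-r) ≤ c ^ r * y ^ (-r) := by
  have hc : 0 < c := pos_of_mul_pos_left (hy.trans_le hyx) hx.le
  rw [Real.rpow_neg hx.le, Real.rpow_neg hy.le, ← div_eq_mul_inv, inv_eq_one_div,
    div_le_div_iff₀ (by positivity) (by positivity), one_mul, ← Real.mul_rpow hc.le hx.le]
  gcongr

lemma norm_iterate_fwdDiff_le_two_pow {M E : Type*} [AddCommMonoid M] [NormedAddCommGroup E]
    (f : M → E) (v : M) (m : ℕ) (z : M) {B : ℝ} (hB : ∀ j ≤ m, ‖f (z + j • v)‖ ≤ B) :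
    ‖(fwdDiff v)^[m] f z‖ ≤ 2 ^ m * B := by
  induction m generalizing z with
  | zero => simpa using hB 0 le_rfl
  | succ m ih =>
    rw [Function.iterate_succ_apply', fwdDiff, pow_succ, mul_two, add_mul]
    refine norm_sub_le_of_le (ih _ fun j hj => ?_) (ih _ fun j hj => hB j (hj.trans m.le_succ))
    simpa only [add_assoc, succ_nsmul'] using hB (j + 1) (Nat.succ_le_succ hj)

lemma iterate_fwdDiff_sub {M G : Type*} [AddCommMonoid M] [AddCommGroup G] (f g : M → G) (v : M)
    (m : ℕ) (z : M) :
    (fwdDiff v)^[m] f z - (fwdDiff v)^[m] g z = (fwdDiff v)^[m] (f - g) z := by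
  simp_rw [fwdDiff_iter_eq_sum_shift, ← Finset.sum_sub_distrib, ← smul_sub, Pi.sub_apply]

section Segment

variable {d m : ℕ} {h u : ℝ} {z : Space d}

lemma half_norm_le_norm_add_of_mem_Icc (hmh : 2 * (m * h) ≤ ‖z‖) (hu : u ∈ Set.Icc 0 (0 + m * h))
    (i : Fin d) : ‖z‖ / 2 ≤ ‖z + u • EuclideanSpace.single i (1 : ℝ)‖ :=
  half_norm_le_norm_add_smul_single (by rw [abs_of_nonneg hu.1]; linarith [hu.2])

lemma add_smul_single_ne_zero_of_mem_Icc (hz : z ≠ 0) (hmh : 2 * (m * h) ≤ ‖z‖)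
    (hu : u ∈ Set.Icc 0 (0 + m * h)) (i : Fin d) :
    z + u • EuclideanSpace.single i (1 : ℝ) ≠ 0 :=
  norm_pos_iff.1 ((half_pos (norm_pos_iff.2 hz)).trans_le
    (half_norm_le_norm_add_of_mem_Icc hmh hu i))

end Segment

lemma exists_norm_iterate_fwdDiff_heatSymbol_le (d : ℕ) (α : ℝ) {ν : ℝ} (hν : 0 < ν) (m : ℕ) :
    ∃ A : ℝ, 0 ≤ A ∧ ∀ s h : ℝ, 0 ≤ s → 0 ≤ h → ∀ (i : Fin d) (z : Space d), z ≠ 0 →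
      2 * (m * h) ≤ ‖z‖ →
      ‖(fwdDiff (EuclideanSpace.single i h))^[m] (heatSymbol α ν s) z‖ ≤ A * h ^ m / ‖z‖ ^ m := by
  obtain ⟨A, hA0, hA⟩ := exists_norm_partialDeriv_heatSymbol_le d α hν m
  refine ⟨A * 2 ^ m, by positivity, fun s h hs hh i z hz hzh => ?_⟩
  have hne := fun u hu => add_smul_single_ne_zero_of_mem_Icc (u := u) hz hzh hu i
  have : 0 < ‖z‖ := norm_pos_iff.2 hz
  rw [iterate_fwdDiff_single]
  refine (norm_iterate_fwdDiff_le m hh (M := A / (‖z‖ / 2) ^ m)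
    (fun u hu => contDiffAt_comp_line (contDiffAt_heatSymbol s (hne u hu) _)) fun u hu => ?_).trans
    (le_of_eq (by rw [div_pow]; field_simp))
  rw [iteratedDeriv_comp_line]
  refine (hA s hs i _ (hne u hu)).trans ?_
  gcongr
  exact half_norm_le_norm_add_of_mem_Icc hzh hu i

section Bounds

variable {d : ℕ} {μ : Measure (Fin d → ℤ)} {α ν a : ℝ} [IsProbabilityMeasure μ]

lemma Assumption1.exists_norm_indicator_symbol_sub_le (h1 : Assumption1 μ α ν a) (hα : 0 < α)
    (hν : 0 < ν) (ha : 0 < a) :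
    ∃ c B : ℝ, 0 < c ∧ 0 ≤ B ∧ ∀ s : ℝ, 1 ≤ s → ∀ z,
      ‖(cube d).indicator (walkSymbol μ s) z - heatSymbol α ν s z‖ ≤
        B * (s * ‖z‖ ^ (α + a) * Real.exp (-(c * (s * ‖z‖ ^ α)))) := by
  obtain ⟨c, hc0, hcν, hc⟩ := h1.exists_le_one_sub_re_charFn hα ha hν
  obtain ⟨B, hB0, hB⟩ := h1.exists_norm_remainder_le hα
  refine ⟨c, max B 1, hc0, by positivity, fun s hs z => ?_⟩
  have hs0 : 0 ≤ s := zero_le_one.trans hs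
  by_cases hz : z ∈ cube d
  · rw [Set.indicator_of_mem hz]
    have hz' := cube_subset_bigCube hz
    refine (norm_walkSymbol_sub_heatSymbol_le hs0 hcν (hc z hz') (hB z hz')).trans ?_
    rw [mul_comm, mul_assoc]
    gcongr
    exact le_max_left _ _
  · rw [Set.indicator_of_notMem hz, zero_sub, norm_neg]
    have hz1 : 1 ≤ ‖z‖ := by
      linarith [Real.pi_gt_three, not_lt.1 fun h => hz (mem_cube_of_norm_lt h)]
    calc ‖heatSymbol α ν s z‖ ≤ 1 * (1 * 1 * Real.exp (-(c * (s * ‖z‖ ^ α)))) := by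
          simpa only [one_mul] using norm_heatSymbol_le hs0 hcν z
      _ ≤ _ := by
          gcongr
          · exact le_max_right _ _
          · exact Real.one_le_rpow hz1 (by positivity)

lemma Assumption1.exists_abs_measureReal_sub_heatKernel_le (h1 : Assumption1 μ α ν a)
    (hα : 0 < α) (hν : 0 < ν) (ha : 0 < a) :
    ∃ C : ℝ, 0 ≤ C ∧ ∀ s : ℝ, 1 ≤ s → ∀ ρ : Measure (Fin d → ℤ), IsProbabilityMeasure ρ →
      charFn ρ = walkSymbol μ s → ∀ k : Fin d → ℤ,
        |ρ.real {k} - heatKernel α ν s (toSpace k)| ≤ C * s ^ (-((d + a) / α)) := by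
  obtain ⟨c, B, hc0, hB0, hB⟩ := h1.exists_norm_indicator_symbol_sub_le hα hν ha
  let J := ∫ z : Space d, ‖z‖ ^ (α + a) * Real.exp (-(c * ‖z‖ ^ α))
  refine ⟨((2 * Real.pi) ^ d)⁻¹ * (B * J), mul_nonneg (by positivity)
    (mul_nonneg hB0 (integral_nonneg fun z => by positivity)), fun s hs ρ _ hρ k => ?_⟩
  have hs0 : 0 < s := by linarith
  have h_int : Integrable fun z : Space d =>
      B * (s * ‖z‖ ^ (α + a) * Real.exp (-(c * (s * ‖z‖ ^ α)))) := by
    simpa only [mul_assoc] using ((integrable_norm_rpow_mul_exp_neg (E := Space d) volume hα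
      (add_pos hα ha).le (mul_pos hc0 hs0)).const_mul s).const_mul B
  have hbound := norm_pow_mul_abs_measureReal_sub_heatKernel_le hα hν hs0 k 0 0 h_int (ρ := ρ)
    (by simpa only [Function.iterate_zero, id_eq, hρ] using hB s hs)
  rw [pow_zero, one_mul, integral_const_mul, integral_mul_norm_rpow_mul_exp_neg _ hα hs0,
    finrank_euclideanSpace_fin] at hbound
  exact hbound.trans_eq (by ring)

lemma Assumption1.exists_norm_iterate_fwdDiff_symbol_sub_le_of_norm_le (h1 : Assumption1 μ α ν a)
    (hα : 0 < α) (hν : 0 < ν) (ha : 0 < a) (m : ℕ) :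
    ∃ A : ℝ, 0 ≤ A ∧ ∀ s h : ℝ, 0 ≤ s → 0 ≤ h → 2 * (m * h) ≤ 1 → ∀ (i : Fin d) (z : Space d),
      ‖z‖ ≤ 2 * (m * h) →
      ‖(fwdDiff (EuclideanSpace.single i h))^[m] (walkSymbol μ s) z -
        (fwdDiff (EuclideanSpace.single i h))^[m] (heatSymbol α ν s) z‖ ≤
          A * (s * h ^ (α + a)) := by
  obtain ⟨c, hc0, hcν, hc⟩ := h1.exists_le_one_sub_re_charFn hα ha hν
  obtain ⟨B, hB0, hB⟩ := h1.exists_norm_remainder_le hα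
  refine ⟨2 ^ m * (B * (3 * m) ^ (α + a)), by positivity, fun s h hs hh hmh i z hz => ?_⟩
  have hz_cube : z ∈ cube d := mem_cube_of_norm_lt (by linarith [Real.pi_gt_three])
  rw [iterate_fwdDiff_sub, mul_assoc]
  refine norm_iterate_fwdDiff_le_two_pow _ _ m z fun j hj => ?_
  have hjh : |j * h| ≤ m * h := by
    rw [abs_of_nonneg (by positivity)]
    gcongr
  rw [nsmul_single]
  have hw := add_smul_single_mem_bigCube hz_cube (i := i) (hjh.trans (by linarith))
  have hw_norm : ‖z + (j * h) • EuclideanSpace.single i (1 : ℝ)‖ ≤ 3 * m * h := by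
    refine (norm_add_le _ _).trans ?_
    rw [norm_smul_single_one]
    linarith
  calc _ ≤ _ := norm_walkSymbol_sub_heatSymbol_le hs hcν (hc _ hw) (hB _ hw)
    _ ≤ 1 * (B * (s * (3 * m * h) ^ (α + a))) := by
      gcongr
      exact Real.exp_le_one_iff.2 (neg_nonpos.2 (by positivity))
    _ = _ := by rw [Real.mul_rpow (by positivity) hh]; ring

lemma exists_norm_iterate_fwdDiff_symbol_sub_le_of_mem_cube (h1 : Assumption1 μ α ν a)
    (h2 : Assumption2 μ α ν a) (hα : 0 < α) (hν : 0 < ν) (ha : 0 < a)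
    (hαa : α + a ≤ (d + 3 : ℕ)) :
    ∃ A : ℝ, 0 ≤ A ∧ ∀ s h : ℝ, 0 ≤ s → 0 ≤ h → 2 * ((d + 3 : ℕ) * h) ≤ 1 → ∀ i : Fin d,
      ∀ z ∈ cube d, z ≠ 0 → 2 * ((d + 3 : ℕ) * h) ≤ ‖z‖ →
      ‖(fwdDiff (EuclideanSpace.single i h))^[d + 3] (walkSymbol μ s) z -
        (fwdDiff (EuclideanSpace.single i h))^[d + 3] (heatSymbol α ν s) z‖ ≤
          A * (s * h ^ (d + 3)) * ‖z‖ ^ (-((d + 3 : ℕ) - (α + a))) := by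
  obtain ⟨A, hA0, hA⟩ := exists_norm_partialDeriv_symbol_sub_le h1 h2 hα hν ha
  refine ⟨A * 2 ^ (((d + 3 : ℕ) : ℝ) - (α + a)), by positivity,
    fun s h hs hh hmh i z hz hz0 hzh => ?_⟩
  have hne := fun u hu => add_smul_single_ne_zero_of_mem_Icc (u := u) hz0 hzh hu i
  have hbig : ∀ u ∈ Set.Icc (0 : ℝ) (0 + (d + 3 : ℕ) * h),
      z + u • EuclideanSpace.single i (1 : ℝ) ∈ bigCube d := fun u hu =>
    add_smul_single_mem_bigCube hz (by rw [abs_of_nonneg hu.1]; linarith [hu.2])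
  have hwalk := fun u hu => contDiffAt_comp_line
    (contDiffAt_walkSymbol s (h2.contDiffAt_charFn (hbig u hu) (hne u hu)))
  have hheat := fun u hu => contDiffAt_comp_line
    (contDiffAt_heatSymbol (α := α) (ν := ν) s (hne u hu) (d + 3 : ℕ))
  rw [iterate_fwdDiff_sub, iterate_fwdDiff_single]
  refine (norm_iterate_fwdDiff_le (d + 3) hh (M := A * s *
    (2 ^ (((d + 3 : ℕ) : ℝ) - (α + a)) * ‖z‖ ^ (-(((d + 3 : ℕ) : ℝ) - (α + a)))))
    (fun u hu => (hwalk u hu).sub (hheat u hu)) fun u hu => ?_).trans_eq (by ring)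
  rw [iteratedDeriv_fun_sub (hwalk u hu) (hheat u hu), iteratedDeriv_comp_line,
    iteratedDeriv_comp_line]
  refine (hA s hs i _ (hbig u hu) (hne u hu)).trans ?_
  rw [← neg_sub]
  gcongr
  exact rpow_neg_le_mul_rpow_neg (norm_pos_iff.2 (hne u hu)) (norm_pos_iff.2 hz0)
    (by linarith [half_norm_le_norm_add_of_mem_Icc hzh hu i]) (sub_nonneg.2 hαa)

lemma exists_norm_indicator_iterate_fwdDiff_symbol_sub_le_of_le_norm (h1 : Assumption1 μ α ν a)
    (h2 : Assumption2 μ α ν a) (hα : 0 < α) (hν : 0 < ν) (ha : 0 < a)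
    (hαa : α + a ≤ (d + 3 : ℕ)) :
    ∃ A : ℝ, 0 ≤ A ∧ ∀ s h : ℝ, 1 ≤ s → 0 ≤ h → 2 * ((d + 3 : ℕ) * h) ≤ 1 →
      ∀ (i : Fin d) (z : Space d), z ≠ 0 → 2 * ((d + 3 : ℕ) * h) ≤ ‖z‖ →
      ‖(cube d).indicator ((fwdDiff (EuclideanSpace.single i h))^[d + 3] (walkSymbol μ s)) z -
        (fwdDiff (EuclideanSpace.single i h))^[d + 3] (heatSymbol α ν s) z‖ ≤
          A * (s * h ^ (d + 3)) * ‖z‖ ^ (-((d + 3 : ℕ) - (α + a))) := by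
  obtain ⟨A₁, hA₁0, hA₁⟩ :=
    exists_norm_iterate_fwdDiff_symbol_sub_le_of_mem_cube h1 h2 hα hν ha hαa
  obtain ⟨A₂, -, hA₂⟩ := exists_norm_iterate_fwdDiff_heatSymbol_le d α hν (d + 3)
  refine ⟨max A₁ A₂, by positivity, fun s h hs hh hmh i z hz0 hzh => ?_⟩
  have hs0 : 0 ≤ s := zero_le_one.trans hs
  by_cases hz : z ∈ cube d
  · rw [Set.indicator_of_mem hz]
    refine (hA₁ s h hs0 hh hmh i z hz hz0 hzh).trans ?_
    gcongr
    exact le_max_left _ _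
  · rw [Set.indicator_of_notMem hz, zero_sub, norm_neg]
    have hz1 : 1 ≤ ‖z‖ := by
      linarith [Real.pi_gt_three, not_lt.1 fun h => hz (mem_cube_of_norm_lt h)]
    calc _ ≤ A₂ * h ^ (d + 3) / ‖z‖ ^ (d + 3) := hA₂ s h hs0 hh i z hz0 hzh
      _ = A₂ * (1 * h ^ (d + 3)) * ‖z‖ ^ (-((d + 3 : ℕ) : ℝ)) := by
        rw [one_mul, Real.rpow_neg (norm_nonneg z), Real.rpow_natCast, div_eq_mul_inv]
      _ ≤ _ := by
        gcongr
        · exact le_max_right _ _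
        · linarith

lemma Assumption1.exists_norm_indicator_iterate_fwdDiff_symbol_sub_le_of_norm_le
    (h1 : Assumption1 μ α ν a) (hα : 0 < α) (hν : 0 < ν) (ha : 0 < a) {m : ℕ} (hαa : α + a ≤ m) :
    ∃ A : ℝ, 0 ≤ A ∧ ∀ s h : ℝ, 0 ≤ s → 0 < h → 2 * (m * h) ≤ 1 → ∀ (i : Fin d) (z : Space d),
      ‖z‖ ≤ 2 * (m * h) →
      ‖(cube d).indicator ((fwdDiff (EuclideanSpace.single i h))^[m] (walkSymbol μ s)) z -
        (fwdDiff (EuclideanSpace.single i h))^[m] (heatSymbol α ν s) z‖ ≤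
          A * (s * h ^ m) * (h + ‖z‖) ^ (-(m - (α + a))) := by
  obtain ⟨A, hA0, hA⟩ := h1.exists_norm_iterate_fwdDiff_symbol_sub_le_of_norm_le hα hν ha m
  set r : ℝ := m - (α + a) with hr
  refine ⟨A * (2 * m + 1) ^ r, by positivity, fun s h hs hh hmh i z hzh => ?_⟩
  rw [Set.indicator_of_mem (mem_cube_of_norm_lt (by linarith [Real.pi_gt_three]))]
  calc _ ≤ A * (s * h ^ (α + a)) := hA s h hs hh.le hmh i z hzh
    _ = A * (s * (h ^ m * h ^ (-r))) := by
      rw [← Real.rpow_natCast, ← Real.rpow_add hh, hr, neg_sub, add_sub_cancel]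
    _ ≤ A * (s * (h ^ m * ((2 * m + 1) ^ r * (h + ‖z‖) ^ (-r)))) := by
      gcongr
      exact rpow_neg_le_mul_rpow_neg hh (by positivity) (by linarith) (sub_nonneg.2 hαa)
    _ = A * (2 * m + 1) ^ r * (s * h ^ m) * (h + ‖z‖) ^ (-r) := by ring

lemma exists_norm_indicator_iterate_fwdDiff_symbol_sub_le (h1 : Assumption1 μ α ν a)
    (h2 : Assumption2 μ α ν a) (hα : 0 < α) (hν : 0 < ν) (ha : 0 < a)
    (hαa : α + a ≤ (d + 3 : ℕ)) :
    ∃ A : ℝ, 0 ≤ A ∧ ∀ s h : ℝ, 1 ≤ s → 0 < h → 2 * ((d + 3 : ℕ) * h) ≤ 1 →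
      ∀ (i : Fin d) (z : Space d),
      ‖(cube d).indicator ((fwdDiff (EuclideanSpace.single i h))^[d + 3] (walkSymbol μ s)) z -
        (fwdDiff (EuclideanSpace.single i h))^[d + 3] (heatSymbol α ν s) z‖ ≤
          A * (s * h ^ (d + 3)) * (h + ‖z‖) ^ (-((d + 3 : ℕ) - (α + a))) := by
  obtain ⟨A₁, -, hA₁⟩ :=
    h1.exists_norm_indicator_iterate_fwdDiff_symbol_sub_le_of_norm_le hα hν ha hαa
  obtain ⟨A₂, hA₂0, hA₂⟩ :=
    exists_norm_indicator_iterate_fwdDiff_symbol_sub_le_of_le_norm h1 h2 hα hν ha hαa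
  set m : ℕ := d + 3 with hm
  set r : ℝ := m - (α + a)
  refine ⟨max A₁ (A₂ * 2 ^ r), by positivity, fun s h hs hh hmh i z => ?_⟩
  have hs0 : 0 ≤ s := zero_le_one.trans hs
  rcases le_or_gt ‖z‖ (2 * (m * h)) with hzh | hzh
  · refine (hA₁ s h hs0 hh hmh i z hzh).trans ?_
    gcongr
    exact le_max_left _ _
  · have hz0 : 0 < ‖z‖ := (by positivity : (0 : ℝ) ≤ 2 * (m * h)).trans_lt hzh
    have hhz : h ≤ ‖z‖ := by
      refine le_trans ?_ hzh.le
      rw [hm]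
      push_cast
      linarith [mul_nonneg d.cast_nonneg hh.le]
    calc _ ≤ A₂ * (s * h ^ m) * ‖z‖ ^ (-r) :=
          hA₂ s h hs hh.le hmh i z (norm_pos_iff.1 hz0) hzh.le
      _ ≤ A₂ * (s * h ^ m) * (2 ^ r * (h + ‖z‖) ^ (-r)) := by
        gcongr
        exact rpow_neg_le_mul_rpow_neg hz0 (by positivity) (by linarith) (sub_nonneg.2 hαa)
      _ = A₂ * 2 ^ r * (s * h ^ m) * (h + ‖z‖) ^ (-r) := by ring
      _ ≤ _ := by
        gcongr
        exact le_max_right _ _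

lemma exists_norm_pow_mul_abs_measureReal_sub_heatKernel_le (h1 : Assumption1 μ α ν a)
    (h2 : Assumption2 μ α ν a) (hα : 0 < α) (hν : 0 < ν) (ha : 0 < a) (hαa : α + a < 3) :
    ∃ C : ℝ, 0 ≤ C ∧ ∀ s : ℝ, 1 ≤ s → ∀ ρ : Measure (Fin d → ℤ), IsProbabilityMeasure ρ →
      charFn ρ = walkSymbol μ s → ∀ (k : Fin d → ℤ) (i : Fin d) (h : ℝ), 0 < h →
        2 * ((d + 3 : ℕ) * h) ≤ 1 →
        ‖planeWave (EuclideanSpace.single i h) (toSpace k) - 1‖ ^ (d + 3) *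
          |ρ.real {k} - heatKernel α ν s (toSpace k)| ≤ C * (s * h ^ (d + α + a)) := by
  obtain ⟨A, hA0, hA⟩ := exists_norm_indicator_iterate_fwdDiff_symbol_sub_le h1 h2 hα hν ha
    (by push_cast; linarith [(Nat.cast_nonneg d : (0 : ℝ) ≤ d)])
  set m : ℕ := d + 3 with hm
  set r : ℝ := m - (α + a) with hr
  have hdr : d < r := by rw [hr, hm]; push_cast; linarith
  let J := ∫ z : Space d, (1 + ‖z‖) ^ (-r)
  refine ⟨((2 * Real.pi) ^ d)⁻¹ * (A * J), mul_nonneg (by positivity)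
    (mul_nonneg hA0 (integral_nonneg fun z => by positivity)),
    fun s hs ρ _ hρ k i h hh hmh => ?_⟩
  have hs0 : 0 < s := zero_lt_one.trans_le hs
  have h_int : Integrable fun z : Space d => A * (s * h ^ m) * (h + ‖z‖) ^ (-r) :=
    (integrable_add_norm_rpow_neg volume hh (by rwa [finrank_euclideanSpace_fin])).const_mul _
  have hbound := norm_pow_mul_abs_measureReal_sub_heatKernel_le hα hν hs0 k
    (EuclideanSpace.single i h) m h_int (ρ := ρ) (by simpa only [hρ] using hA s h hs hh hmh i)
  rw [integral_const_mul, integral_add_norm_rpow_neg _ hh, finrank_euclideanSpace_fin] at hbound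
  have hexp : h ^ m * h ^ (d - r) = h ^ (d + α + a) := by
    rw [← Real.rpow_natCast, ← Real.rpow_add hh]
    congr 1
    rw [hr]
    ring
  exact hbound.trans_eq (by rw [← hexp]; ring)

lemma exists_abs_measureReal_sub_heatKernel_le_of_le_abs (h1 : Assumption1 μ α ν a)
    (h2 : Assumption2 μ α ν a) (hα : 0 < α) (hν : 0 < ν) (ha : 0 < a) (hαa : α + a < 3) :
    ∃ C : ℝ, 0 ≤ C ∧ ∀ s : ℝ, 1 ≤ s → ∀ ρ : Measure (Fin d → ℤ), IsProbabilityMeasure ρ →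
      charFn ρ = walkSymbol μ s → ∀ (k : Fin d → ℤ) (i : Fin d),
        2 * ((d + 3 : ℕ) * Real.pi) ≤ |(k i : ℝ)| →
        |ρ.real {k} - heatKernel α ν s (toSpace k)| ≤ C * (s / |(k i : ℝ)| ^ (d + α + a)) := by
  obtain ⟨C, hC0, hC⟩ :=
    exists_norm_pow_mul_abs_measureReal_sub_heatKernel_le h1 h2 hα hν ha hαa
  refine ⟨C * Real.pi ^ (d + α + a), by positivity, fun s hs ρ hρ' hρ k i hki => ?_⟩
  have hki0 : 0 < |(k i : ℝ)| := lt_of_lt_of_le (by positivity) hki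
  have hbound := hC s hs ρ hρ' hρ k i (Real.pi / |(k i : ℝ)|) (by positivity)
    (by rwa [← mul_div_assoc, ← mul_div_assoc, div_le_one hki0])
  rw [planeWave_single_pi_div_abs (by exact_mod_cast abs_pos.1 hki0),
    show ‖(-1 : ℂ) - 1‖ = 2 by norm_num, Real.div_rpow Real.pi_pos.le hki0.le] at hbound
  calc _ ≤ 2 ^ (d + 3) * |ρ.real {k} - heatKernel α ν s (toSpace k)| :=
        le_mul_of_one_le_left (abs_nonneg _) (one_le_pow₀ one_le_two)
    _ ≤ _ := hbound
    _ = _ := by ring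

lemma exists_abs_measureReal_sub_heatKernel_le_div_abs (h1 : Assumption1 μ α ν a)
    (h2 : Assumption2 μ α ν a) (hα : 0 < α) (hν : 0 < ν) (ha : 0 < a) (hαa : α + a < 3) :
    ∃ C : ℝ, 0 ≤ C ∧ ∀ s : ℝ, 1 ≤ s → ∀ ρ : Measure (Fin d → ℤ), IsProbabilityMeasure ρ →
      charFn ρ = walkSymbol μ s → ∀ (k : Fin d → ℤ) (i : Fin d), k i ≠ 0 →
        |ρ.real {k} - heatKernel α ν s (toSpace k)| ≤ C * (s / |(k i : ℝ)| ^ (d + α + a)) := by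
  obtain ⟨C₁, hC₁0, hC₁⟩ := h1.exists_abs_measureReal_sub_heatKernel_le hα hν ha
  obtain ⟨C₂, -, hC₂⟩ := exists_abs_measureReal_sub_heatKernel_le_of_le_abs h1 h2 hα hν ha hαa
  set R := 2 * ((d + 3 : ℕ) * Real.pi)
  refine ⟨max (C₁ * R ^ (d + α + a)) C₂, by positivity, fun s hs ρ hρ' hρ k i hki => ?_⟩
  have hki0 : 0 < |(k i : ℝ)| := abs_pos.2 (by exact_mod_cast hki)
  have : 0 ≤ s := zero_le_one.trans hs
  rcases le_total R |(k i : ℝ)| with hR | hR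
  · refine (hC₂ s hs ρ hρ' hρ k i hR).trans ?_
    gcongr
    exact le_max_right _ _
  · have : 0 < R := hki0.trans_le hR
    calc _ ≤ C₁ * s ^ (-((d + a) / α)) := hC₁ s hs ρ hρ' hρ k
      _ ≤ C₁ * (s * (R ^ (d + α + a) / |(k i : ℝ)| ^ (d + α + a))) := by
        gcongr
        refine (Real.rpow_le_one_of_one_le_of_nonpos hs
          (neg_nonpos.2 (by positivity))).trans (one_le_mul_of_one_le_of_one_le hs ?_)
        rw [one_le_div (by positivity)]
        gcongr
      _ = C₁ * R ^ (d + α + a) * (s / |(k i : ℝ)| ^ (d + α + a)) := by ring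
      _ ≤ _ := by
        gcongr
        exact le_max_left _ _

lemma exists_abs_measureReal_sub_heatKernel_le_div_norm (h1 : Assumption1 μ α ν a)
    (h2 : Assumption2 μ α ν a) (hα : 0 < α) (hν : 0 < ν) (ha : 0 < a) (hαa : α + a < 3) :
    ∃ C : ℝ, 0 ≤ C ∧ ∀ s : ℝ, 1 ≤ s → ∀ ρ : Measure (Fin d → ℤ), IsProbabilityMeasure ρ →
      charFn ρ = walkSymbol μ s → ∀ k : Fin d → ℤ, k ≠ 0 →
        |ρ.real {k} - heatKernel α ν s (toSpace k)| ≤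
          C * (s / ‖(toSpace k : Space d)‖ ^ (d + α + a)) := by
  obtain ⟨C, hC0, hC⟩ := exists_abs_measureReal_sub_heatKernel_le_div_abs h1 h2 hα hν ha hαa
  refine ⟨C * d ^ (d + α + a), by positivity, fun s hs ρ hρ' hρ k hk => ?_⟩
  obtain ⟨i, hi0, hi⟩ := exists_norm_toSpace_le_mul_abs hk
  have hki : 0 < |(k i : ℝ)| := abs_pos.2 (by exact_mod_cast hi0)
  have hk_norm : 0 < ‖(toSpace k : Space d)‖ := hki.trans_le (PiLp.norm_apply_le (toSpace k) i)
  have hinv := rpow_neg_le_mul_rpow_neg hki hk_norm hi (r := d + α + a) (by positivity)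
  rw [Real.rpow_neg hki.le, Real.rpow_neg hk_norm.le] at hinv
  calc _ ≤ C * (s / |(k i : ℝ)| ^ (d + α + a)) := hC s hs ρ hρ' hρ k i hi0
    _ ≤ C * (s * (d ^ (d + α + a) * (‖(toSpace k : Space d)‖ ^ (d + α + a))⁻¹)) := by
      rw [div_eq_mul_inv]
      gcongr
    _ = _ := by ring

end Bounds

/-! ### Functions with nonnegative cosine transform -/

section CosTransform

variable {E : Type*} [NormedAddCommGroup E] [InnerProductSpace ℝ E] [FiniteDimensional ℝ E]
  [MeasurableSpace E] [BorelSpace E]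

/-- The cosine transform of `φ`, which is its Fourier transform when `φ` is even. -/
noncomputable def cosTransform (φ : E → ℝ) (x : E) : ℝ := ∫ z, Real.cos (inner ℝ x z) * φ z

/-- `φ` is integrable and has a nonnegative cosine transform. For even `φ` with `φ 0 = 1` this says
that `φ` is the characteristic function of a law with an integrable characteristic function. -/
structure IsCosPositive (φ : E → ℝ) : Prop where
  integrable : Integrable φ
  nonneg : ∀ x, 0 ≤ cosTransform φ x

variable {φ g J K : E → ℝ}

lemma norm_cos_mul_le (u t : ℝ) : ‖Real.cos u * t‖ ≤ ‖t‖ := by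
  rw [norm_mul]
  exact mul_le_of_le_one_left (norm_nonneg _) (Real.abs_cos_le_one u)

lemma integrable_cos_mul (hφ : Integrable φ) (x : E) :
    Integrable fun z => Real.cos (inner ℝ x z) * φ z :=
  hφ.bdd_mul (c := 1) (Continuous.aestronglyMeasurable (by fun_prop))
    (ae_of_all _ fun z => Real.abs_cos_le_one _)

lemma cosTransform_zero (φ : E → ℝ) : cosTransform φ 0 = ∫ z, φ z := by
  simp only [cosTransform, inner_zero_left, Real.cos_zero, one_mul]

lemma cosTransform_neg (φ : E → ℝ) (x : E) : cosTransform φ (-x) = cosTransform φ x := by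
  simp only [cosTransform, inner_neg_left, Real.cos_neg]

lemma cosTransform_const_mul (c : ℝ) (φ : E → ℝ) (x : E) :
    cosTransform (fun z => c * φ z) x = c * cosTransform φ x := by
  simp only [cosTransform, mul_left_comm _ c, integral_const_mul]

lemma cosTransform_sub (hJ : Integrable J) (hK : Integrable K) (x : E) :
    cosTransform (J - K) x = cosTransform J x - cosTransform K x := by
  simp only [cosTransform, Pi.sub_apply, mul_sub]
  exact integral_sub (integrable_cos_mul hJ x) (integrable_cos_mul hK x)

lemma abs_cosTransform_le (hφ : Integrable φ) (x : E) : |cosTransform φ x| ≤ ∫ z, ‖φ z‖ :=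
  norm_integral_le_of_norm_le hφ.norm (ae_of_all _ fun _ => norm_cos_mul_le _ _)

lemma continuous_cosTransform (hφ : Integrable φ) : Continuous (cosTransform φ) :=
  continuous_of_dominated (fun x => (integrable_cos_mul hφ x).aestronglyMeasurable)
    (fun _ => ae_of_all _ fun _ => norm_cos_mul_le _ _) hφ.norm (ae_of_all _ fun _ => by fun_prop)

lemma cosTransform_eq_re_integral (hφ : Integrable φ) (x : E) :
    cosTransform φ x = (∫ z, planeWave x z * φ z).re := by
  have h_int := integrable_planeWave_mul (f := fun z => (φ z : ℂ)) hφ.ofReal x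
  simp only [planeWave_comm _ x] at h_int
  have hre : ∀ z, Real.cos (inner ℝ x z) * φ z = RCLike.re (planeWave x z * φ z) := fun z => by
    rw [RCLike.re_eq_complex_re, Complex.re_mul_ofReal, planeWave, mul_comm Complex.I,
      Complex.exp_ofReal_mul_I_re]
  simp only [cosTransform, hre]
  exact integral_re h_int

lemma cosTransform_cosTransform_mul (hφ : Integrable φ) (hJ : Integrable J) (x : E) :
    cosTransform (fun z => cosTransform J z * φ z) x =
      ∫ y, 1 / 2 * (J y * (cosTransform φ (x + y) + cosTransform φ (x - y))) := by
  have h_int : Integrable (Function.uncurry fun z y : E =>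
      Real.cos (inner ℝ x z) * (Real.cos (inner ℝ z y) * (φ z * J y))) (volume.prod volume) := by
    have hcont : Continuous fun p : E × E => Real.cos (inner ℝ p.1 p.2) := by fun_prop
    refine (hφ.mul_prod hJ).mono (AEStronglyMeasurable.mul ?_ (AEStronglyMeasurable.mul
      hcont.aestronglyMeasurable (hφ.mul_prod hJ).aestronglyMeasurable))
      (ae_of_all _ fun p => (norm_cos_mul_le _ _).trans (norm_cos_mul_le _ _))
    exact Continuous.aestronglyMeasurable (by fun_prop)
  calc _ = ∫ z, ∫ y, Real.cos (inner ℝ x z) * (Real.cos (inner ℝ z y) * (φ z * J y)) := by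
        simp_rw [cosTransform, integral_const_mul, mul_left_comm _ (φ _), integral_const_mul,
          mul_comm (φ _)]
    _ = ∫ y, ∫ z, Real.cos (inner ℝ x z) * (Real.cos (inner ℝ z y) * (φ z * J y)) :=
        integral_integral_swap h_int
    _ = _ := by
      congr with y
      rw [cosTransform, cosTransform, ← integral_add (integrable_cos_mul hφ _)
        (integrable_cos_mul hφ _), ← integral_const_mul, ← integral_const_mul]
      congr with z
      rw [inner_add_left, inner_sub_left, Real.cos_add, Real.cos_sub, real_inner_comm y z]
      ring

lemma hasSum_cosTransform_exp_mul (hφ : Integrable φ) (hg : AEStronglyMeasurable g) {L : ℝ}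
    (hgL : ∀ z, |g z| ≤ L) (x : E) :
    HasSum (fun n : ℕ => (n.factorial : ℝ)⁻¹ * cosTransform (fun z => g z ^ n * φ z) x)
      (cosTransform (fun z => Real.exp (g z) * φ z) x) := by
  have h_int : ∀ n : ℕ, Integrable fun z => (n.factorial : ℝ)⁻¹ * (g z ^ n * φ z) := fun n =>
    (hφ.bdd_mul (hg.pow n) (c := L ^ n) (ae_of_all _ fun z => by
      rw [Pi.pow_apply, norm_pow]
      exact pow_le_pow_left₀ (norm_nonneg _) (hgL z) n)).const_mul _
  have hexp : ∀ u : ℝ, HasSum (fun n : ℕ => (n.factorial : ℝ)⁻¹ * u ^ n) (Real.exp u) := fun u => by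
    simpa only [Real.exp_eq_exp_ℝ, inv_mul_eq_div] using NormedSpace.expSeries_div_hasSum_exp u
  have hsummable : Summable fun n : ℕ =>
      ∫ z, ‖Real.cos (inner ℝ x z) * ((n.factorial : ℝ)⁻¹ * (g z ^ n * φ z))‖ := by
    refine .of_nonneg_of_le (fun n => integral_nonneg fun z => norm_nonneg _) (fun n => ?_)
      ((hexp L).summable.mul_right (∫ z, ‖φ z‖))
    rw [← integral_const_mul]
    refine integral_mono_of_nonneg (ae_of_all _ fun z => norm_nonneg _) (hφ.norm.const_mul _)
      (ae_of_all _ fun z => (norm_cos_mul_le _ _).trans ?_)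
    simp only [norm_mul, norm_pow, norm_inv, Real.norm_natCast, ← mul_assoc]
    gcongr
    exact hgL z
  have hsum := hasSum_integral_of_summable_integral_norm
    (fun n => integrable_cos_mul (h_int n) x) hsummable
  have htsum : ∀ z, ∑' n : ℕ, Real.cos (inner ℝ x z) * ((n.factorial : ℝ)⁻¹ * (g z ^ n * φ z)) =
      Real.cos (inner ℝ x z) * (Real.exp (g z) * φ z) := fun z => by
    simp only [tsum_mul_left, ← mul_assoc ((_ : ℝ)⁻¹), tsum_mul_right, (hexp _).tsum_eq]
  simp only [htsum] at hsum
  exact hsum.congr_fun fun n => (cosTransform_const_mul _ _ x).symm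

namespace IsCosPositive

lemma const_mul (hφ : IsCosPositive φ) {c : ℝ} (hc : 0 ≤ c) : IsCosPositive fun z => c * φ z where
  integrable := hφ.integrable.const_mul c
  nonneg x := (mul_nonneg hc (hφ.nonneg x)).trans_eq (cosTransform_const_mul c φ x).symm

lemma cosTransform_mul (hφ : IsCosPositive φ) (hJ : Integrable J) (hJ0 : ∀ y, 0 ≤ J y) :
    IsCosPositive fun z => cosTransform J z * φ z where
  integrable := hφ.integrable.bdd_mul (continuous_cosTransform hJ).aestronglyMeasurable
    (ae_of_all _ fun z => abs_cosTransform_le hJ z)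
  nonneg x := by
    rw [cosTransform_cosTransform_mul hφ.integrable hJ]
    exact integral_nonneg fun y =>
      mul_nonneg one_half_pos.le (mul_nonneg (hJ0 y) (add_nonneg (hφ.nonneg _) (hφ.nonneg _)))

lemma cosTransform_pow_mul (hφ : IsCosPositive φ) (hJ : Integrable J) (hJ0 : ∀ y, 0 ≤ J y)
    (n : ℕ) : IsCosPositive fun z => cosTransform J z ^ n * φ z := by
  induction n with
  | zero => simpa only [pow_zero, one_mul] using hφ
  | succ n ih => simpa only [pow_succ', mul_assoc] using ih.cosTransform_mul hJ hJ0

lemma exp_cosTransform_mul (hφ : IsCosPositive φ) (hJ : Integrable J) (hJ0 : ∀ y, 0 ≤ J y) :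
    IsCosPositive fun z => Real.exp (cosTransform J z) * φ z where
  integrable := hφ.integrable.bdd_mul (c := Real.exp (∫ z, ‖J z‖))
    (continuous_cosTransform hJ).rexp.aestronglyMeasurable (ae_of_all _ fun z => by
      rw [Real.norm_of_nonneg (Real.exp_pos _).le]
      exact Real.exp_le_exp.2 ((le_abs_self _).trans (abs_cosTransform_le hJ z)))
  nonneg x := (hasSum_cosTransform_exp_mul hφ.integrable
    (continuous_cosTransform hJ).aestronglyMeasurable (abs_cosTransform_le hJ) x).nonneg fun n =>
      mul_nonneg (by positivity) ((hφ.cosTransform_pow_mul hJ hJ0 n).nonneg x)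

lemma cosTransform_cosTransform_mul_le (hφ : IsCosPositive φ) (hJ : Integrable J)
    (hJ0 : ∀ y, 0 ≤ J y) (x : E) :
    cosTransform (fun z => cosTransform J z * φ z) x ≤
      cosTransform (fun z => Real.exp (cosTransform J z) * φ z) x := by
  simpa only [Nat.factorial_one, Nat.cast_one, inv_one, one_mul, pow_one] using
    le_hasSum (hasSum_cosTransform_exp_mul hφ.integrable
      (continuous_cosTransform hJ).aestronglyMeasurable (abs_cosTransform_le hJ) x) 1 fun n _ =>
        mul_nonneg (by positivity) ((hφ.cosTransform_pow_mul hJ hJ0 n).nonneg x)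

lemma of_tendsto {F : ℕ → E → ℝ} {bound : E → ℝ} (hF : ∀ n, IsCosPositive (F n))
    (hφ : Integrable φ) (hbound : Integrable bound) (hle : ∀ n z, ‖F n z‖ ≤ bound z)
    (hlim : ∀ z, Tendsto (fun n => F n z) atTop (𝓝 (φ z))) : IsCosPositive φ where
  integrable := hφ
  nonneg x := ge_of_tendsto' (f := fun n => cosTransform (F n) x)
    (tendsto_integral_of_dominated_convergence bound
      (fun n => (integrable_cos_mul (hF n).integrable x).aestronglyMeasurable) hbound
      (fun n => ae_of_all _ fun z => (norm_cos_mul_le _ _).trans (hle n z))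
      (ae_of_all _ fun z => (hlim z).const_mul _)) fun n => (hF n).nonneg x

end IsCosPositive

lemma isCosPositive_exp_neg_mul_sq_norm {b : ℝ} (hb : 0 < b) :
    IsCosPositive fun z : E => Real.exp (-(b * ‖z‖ ^ 2)) := by
  have h_int : Integrable fun z : E => Real.exp (-(b * ‖z‖ ^ 2)) := by
    simpa only [Real.rpow_two, Real.rpow_zero, one_mul] using
      integrable_norm_rpow_mul_exp_neg (E := E) volume two_pos le_rfl hb
  refine ⟨h_int, fun x => ?_⟩
  have hgauss := GaussianFourier.integral_cexp_neg_mul_sq_norm_add (V := E) (b := b)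
    (by simpa only [Complex.ofReal_re] using hb) Complex.I x
  have hintegrand : ∀ z : E, planeWave x z * (Real.exp (-(b * ‖z‖ ^ 2)) : ℝ) =
      Complex.exp (-b * ‖z‖ ^ 2 + Complex.I * (inner ℝ x z : ℝ)) := fun z => by
    rw [planeWave, Complex.ofReal_exp, ← Complex.exp_add, add_comm]
    push_cast
    ring_nf
  have hreal : ((Real.pi : ℂ) / b) ^ (Module.finrank ℝ E / 2 : ℂ) *
      Complex.exp (Complex.I ^ 2 * ‖x‖ ^ 2 / (4 * b)) =
      ((Real.pi / b) ^ (Module.finrank ℝ E / 2 : ℝ) * Real.exp (-‖x‖ ^ 2 / (4 * b)) : ℝ) := by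
    rw [Complex.ofReal_mul, Complex.ofReal_cpow (by positivity), Complex.ofReal_exp, Complex.I_sq]
    push_cast
    ring_nf
  rw [cosTransform_eq_re_integral h_int]
  simp_rw [hintegrand]
  rw [hgauss, hreal, Complex.ofReal_re]
  positivity

end CosTransform

/-! ### The Lévy–Khintchine representation of a power of the norm -/

section Levy

variable {E : Type*} [NormedAddCommGroup E] [InnerProductSpace ℝ E] {α : ℝ}

/-- The integrand of the Lévy–Khintchine representation of a multiple of `‖z‖ ^ α`, the Lévy measure
having a density proportional to `‖y‖ ^ (-(D + α))`, where `D` is the dimension of `E`. -/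
noncomputable def levyIntegrand (α : ℝ) (z y : E) : ℝ :=
  (1 - Real.cos (inner ℝ z y)) * ‖y‖ ^ (-(Module.finrank ℝ E + α))

lemma one_sub_cos_nonneg (u : ℝ) : 0 ≤ 1 - Real.cos u := sub_nonneg.2 (Real.cos_le_one u)

lemma one_sub_cos_inner_le (z y : E) :
    1 - Real.cos (inner ℝ z y) ≤ ‖z‖ ^ 2 / 2 * ‖y‖ ^ 2 := by
  have hinner : inner ℝ z y ^ 2 ≤ (‖z‖ * ‖y‖) ^ 2 :=
    sq_le_sq.2 ((abs_real_inner_le_norm z y).trans (le_abs_self _))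
  rw [mul_pow] at hinner
  linarith [Real.one_sub_sq_div_two_le_cos (x := inner ℝ z y)]

lemma levyIntegrand_nonneg (z y : E) : 0 ≤ levyIntegrand α z y :=
  mul_nonneg (one_sub_cos_nonneg _) (by positivity)

lemma levyIntegrand_zero_left (y : E) : levyIntegrand α 0 y = 0 := by
  simp only [levyIntegrand, inner_zero_left, Real.cos_zero, sub_self, zero_mul]

lemma levyIntegrand_le_rpow_norm (z y : E) :
    levyIntegrand α z y ≤ ‖z‖ ^ 2 / 2 * ‖y‖ ^ (-(Module.finrank ℝ E + α - 2)) := by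
  rcases eq_or_ne y 0 with rfl | hy
  · simp only [levyIntegrand, inner_zero_right, Real.cos_zero, sub_self, zero_mul]
    positivity
  have hsplit : ‖y‖ ^ (-(Module.finrank ℝ E + α - 2)) =
      ‖y‖ ^ 2 * ‖y‖ ^ (-(Module.finrank ℝ E + α)) := by
    rw [← Real.rpow_natCast, ← Real.rpow_add (norm_pos_iff.2 hy)]
    congr 1
    push_cast
    ring
  rw [levyIntegrand, hsplit, ← mul_assoc]
  gcongr
  exact one_sub_cos_inner_le z y

lemma levyIntegrand_le_of_one_le_norm (hα : 0 ≤ α) (z : E) {y : E} (hy : 1 ≤ ‖y‖) :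
    levyIntegrand α z y ≤ 2 * (2 ^ (Module.finrank ℝ E + α) *
      (1 + ‖y‖) ^ (-(Module.finrank ℝ E + α))) := by
  refine mul_le_mul (by linarith [Real.neg_one_le_cos (inner ℝ z y)]) ?_ (by positivity) two_pos.le
  exact rpow_neg_le_mul_rpow_neg (by positivity) (by positivity) (by linarith) (by positivity)

variable [FiniteDimensional ℝ E] [MeasurableSpace E] [BorelSpace E]

lemma measurable_levyIntegrand (z : E) : Measurable (levyIntegrand α z) := by
  unfold levyIntegrand
  fun_prop

lemma integral_levyIntegrand_smul {r : ℝ} (hr : 0 < r) (z : E) :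
    ∫ y, levyIntegrand α (r • z) y = r ^ α * ∫ y, levyIntegrand α z y := by
  set D := Module.finrank ℝ E
  have hscale : ∀ y, levyIntegrand α z (r • y) = r ^ (-(D + α)) * levyIntegrand α (r • z) y := by
    intro y
    rw [levyIntegrand, levyIntegrand, norm_smul, Real.norm_of_nonneg hr.le,
      Real.mul_rpow hr.le (norm_nonneg _), real_inner_smul_left, real_inner_smul_right]
    ring
  have hsubst : r ^ (-(D + α)) * ∫ y, levyIntegrand α (r • z) y =
      r ^ (-D : ℝ) * ∫ y, levyIntegrand α z y := by
    rw [← integral_const_mul]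
    simp_rw [← hscale]
    rw [Measure.integral_comp_smul, smul_eq_mul, abs_of_pos (by positivity), Real.rpow_neg hr.le,
      Real.rpow_natCast]
  refine mul_left_cancel₀ (Real.rpow_pos_of_pos hr (-(D + α))).ne' ?_
  rw [hsubst, ← mul_assoc, ← Real.rpow_add hr]
  ring_nf

lemma integral_levyIntegrand_of_norm_eq {z w : E} (h : ‖z‖ = ‖w‖) :
    ∫ y, levyIntegrand α z y = ∫ y, levyIntegrand α w y := by
  let R : E ≃ₗᵢ[ℝ] E := (ℝ ∙ (z - w))ᗮ.reflection
  have hR : R z = w := Submodule.reflection_sub h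
  rw [← R.measurePreserving.integral_comp R.toHomeomorph.measurableEmbedding (levyIntegrand α w)]
  simp only [levyIntegrand, ← hR, LinearIsometryEquiv.inner_map_map, LinearIsometryEquiv.norm_map]

variable [Nontrivial E]

lemma integrable_levyIntegrand (hα : 0 < α) (hα2 : α < 2) (z : E) :
    Integrable (levyIntegrand α z) := by
  have hmeas := (measurable_levyIntegrand (α := α) z).aestronglyMeasurable (μ := volume)
  rw [← integrableOn_univ, ← Set.union_compl_self (Metric.ball (0 : E) 1)]
  refine IntegrableOn.union ?_ ?_
  · refine integrableOn_ball_of_norm_le_rpow (Nat.succ_le_of_lt Module.finrank_pos)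
      (C := ‖z‖ ^ 2 / 2) (α := Module.finrank ℝ E + α - 2) (by linarith)
      (ae_of_all _ fun y => ?_) hmeas
    rw [Real.norm_of_nonneg (levyIntegrand_nonneg z y)]
    exact levyIntegrand_le_rpow_norm z y
  · have hfar : Integrable fun y : E => 2 * (2 ^ (Module.finrank ℝ E + α) *
        (1 + ‖y‖) ^ (-(Module.finrank ℝ E + α))) :=
      ((integrable_add_norm_rpow_neg volume one_pos (by linarith)).const_mul _).const_mul _
    refine hfar.integrableOn.mono' hmeas.restrict
      ((ae_restrict_iff' Metric.isOpen_ball.measurableSet.compl).2 (ae_of_all _ fun y hy => ?_))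
    rw [Real.norm_of_nonneg (levyIntegrand_nonneg z y)]
    exact levyIntegrand_le_of_one_le_norm hα.le z (by simpa using hy)

lemma integral_levyIntegrand_pos (hα : 0 < α) (hα2 : α < 2) {z : E} (hz : z ≠ 0) :
    0 < ∫ y, levyIntegrand α z y := by
  rw [integral_pos_iff_support_of_nonneg (levyIntegrand_nonneg _)
    (integrable_levyIntegrand hα hα2 _)]
  let U : Set E := {y | inner ℝ z y ∈ Set.Ioo 0 (2 * Real.pi)}
  have hU : IsOpen U := isOpen_Ioo.preimage (by fun_prop)
  have hU_nonempty : U.Nonempty := by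
    refine ⟨(‖z‖ ^ 2)⁻¹ • z, ?_⟩
    have hz' : ‖z‖ ≠ 0 := norm_ne_zero_iff.2 hz
    rw [Set.mem_ofPred_eq, real_inner_smul_right, real_inner_self_eq_norm_sq,
      inv_mul_cancel₀ (pow_ne_zero 2 hz')]
    exact ⟨one_pos, by linarith [Real.pi_gt_three]⟩
  refine (hU.measure_pos volume hU_nonempty).trans_le (measure_mono fun y hy => ?_)
  have hy0 : y ≠ 0 := by
    rintro rfl
    exact hy.1.ne' (inner_zero_right z)
  refine mul_ne_zero (sub_ne_zero.2 fun hcos => ?_)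
    (Real.rpow_pos_of_pos (norm_pos_iff.2 hy0) _).ne'
  exact hy.1.ne' ((Real.cos_eq_one_iff_of_lt_of_lt (by linarith [hy.1, Real.pi_pos]) hy.2).1
    hcos.symm)

lemma exists_levy_representation (hα : 0 < α) (hα2 : α < 2) {ν : ℝ} (hν : 0 < ν) :
    ∃ κ : ℝ, 0 < κ ∧ ∀ z : E, ∫ y, κ * levyIntegrand α z y = ν * ‖z‖ ^ α := by
  obtain ⟨e, he⟩ := exists_norm_eq E zero_le_one
  have hI : 0 < ∫ y, levyIntegrand α e y :=
    integral_levyIntegrand_pos hα hα2 (norm_ne_zero_iff.1 (he ▸ one_ne_zero))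
  refine ⟨ν / ∫ y, levyIntegrand α e y, by positivity, fun z => ?_⟩
  rw [integral_const_mul]
  rcases eq_or_ne z 0 with rfl | hz
  · simp only [levyIntegrand_zero_left, integral_zero, norm_zero, Real.zero_rpow hα.ne', mul_zero]
  have hz' : 0 < ‖z‖ := norm_pos_iff.2 hz
  have hnorm : ‖z‖ = ‖‖z‖ • e‖ := by rw [norm_smul, norm_norm, he, mul_one]
  rw [integral_levyIntegrand_of_norm_eq hnorm, integral_levyIntegrand_smul hz']
  field_simp

end Levy

/-! ### The lower bound of the stable heat kernel -/

section LowerBound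

variable {E : Type*} [NormedAddCommGroup E] [InnerProductSpace ℝ E] {α ν κ δ ε : ℝ}
  {φ J K : E → ℝ}

/-- The Lévy density of a stable process, made bounded by adding `δ > 0` to the norm. -/
noncomputable def jumpDensity (α κ δ : ℝ) (y : E) : ℝ :=
  κ * (δ + ‖y‖) ^ (-(Module.finrank ℝ E + α))

lemma jumpDensity_nonneg (hκ : 0 ≤ κ) (hδ : 0 ≤ δ) (y : E) : 0 ≤ jumpDensity α κ δ y := by
  unfold jumpDensity
  positivity

lemma jumpDensity_anti (hα : 0 ≤ α) (hκ : 0 ≤ κ) (hδ : 0 < δ) (h : δ ≤ ε) (y : E) :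
    jumpDensity α κ ε y ≤ jumpDensity α κ δ y := by
  unfold jumpDensity
  gcongr κ * ?_
  exact Real.rpow_le_rpow_of_nonpos (by positivity) (by linarith) (neg_nonpos.2 (by positivity))

lemma mul_one_add_norm_rpow_neg_le_jumpDensity (hα : 0 ≤ α) (hκ : 0 ≤ κ) {x y : E}
    (hy : y ∈ Metric.ball x 1) :
    κ * (2 ^ (Module.finrank ℝ E + α))⁻¹ * (1 + ‖x‖) ^ (-(Module.finrank ℝ E + α)) ≤
      jumpDensity α κ 1 y := by
  have hyx : ‖y‖ ≤ ‖y - x‖ + ‖x‖ := by simpa only [sub_add_cancel] using norm_add_le (y - x) x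
  rw [mem_ball_iff_norm] at hy
  rw [jumpDensity, mul_assoc]
  gcongr κ * ?_
  rw [inv_mul_le_iff₀ (by positivity)]
  exact rpow_neg_le_mul_rpow_neg (by positivity) (by positivity) (by linarith [norm_nonneg x])
    (by positivity)

variable [FiniteDimensional ℝ E] [MeasurableSpace E] [BorelSpace E]

/-- The exponent `∫ (1 - cos ⟪z, y⟫) J y dy` of the compound Poisson law with an even jump
density `J`. -/
noncomputable def jumpExponent (J : E → ℝ) (z : E) : ℝ := cosTransform J 0 - cosTransform J z

lemma jumpExponent_eq_integral (hJ : Integrable J) (z : E) :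
    jumpExponent J z = ∫ y, (1 - Real.cos (inner ℝ z y)) * J y := by
  rw [jumpExponent, cosTransform_zero, cosTransform, ← integral_sub hJ (integrable_cos_mul hJ z)]
  simp only [sub_mul, one_mul]

lemma jumpExponent_nonneg (hJ : Integrable J) (hJ0 : ∀ y, 0 ≤ J y) (z : E) :
    0 ≤ jumpExponent J z := by
  rw [jumpExponent_eq_integral hJ]
  exact integral_nonneg fun y => mul_nonneg (one_sub_cos_nonneg _) (hJ0 y)

lemma jumpExponent_sub (hJ : Integrable J) (hK : Integrable K) (z : E) :
    jumpExponent (J - K) z = jumpExponent J z - jumpExponent K z := by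
  simp only [jumpExponent, cosTransform_sub hJ hK]
  ring

lemma continuous_jumpExponent (hJ : Integrable J) : Continuous (jumpExponent J) :=
  continuous_const.sub (continuous_cosTransform hJ)

lemma jumpExponent_le (hJ : Integrable J) (z : E) : jumpExponent J z ≤ 2 * ∫ y, ‖J y‖ := by
  rw [jumpExponent, two_mul]
  exact (le_abs_self _).trans ((abs_sub _ _).trans
    (add_le_add (abs_cosTransform_le hJ 0) (abs_cosTransform_le hJ z)))

lemma IsCosPositive.exp_neg_jumpExponent_mul (hφ : IsCosPositive φ) (hJ : Integrable J)
    (hJ0 : ∀ y, 0 ≤ J y) : IsCosPositive fun z => Real.exp (-jumpExponent J z) * φ z := by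
  have hfactor : ∀ z, Real.exp (-jumpExponent J z) * φ z =
      Real.exp (-cosTransform J 0) * (Real.exp (cosTransform J z) * φ z) := fun z => by
    rw [jumpExponent, ← mul_assoc, ← Real.exp_add]
    ring_nf
  simpa only [hfactor] using (hφ.exp_cosTransform_mul hJ hJ0).const_mul (Real.exp_pos _).le

lemma norm_exp_neg_mul_le {u : ℝ} (hu : 0 ≤ u) (t : ℝ) : ‖Real.exp (-u) * t‖ ≤ ‖t‖ := by
  rw [norm_mul, Real.norm_of_nonneg (Real.exp_pos _).le]
  exact mul_le_of_le_one_left (norm_nonneg t) (Real.exp_le_one_iff.2 (neg_nonpos.2 hu))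

-- Without a Gaussian factor the approximations `exp (-jumpExponent (K n) z)` are not integrable.
lemma isCosPositive_exp_neg_of_tendsto_jumpExponent {K : ℕ → E → ℝ} {ψ : E → ℝ}
    (hK : ∀ n, Integrable (K n)) (hK0 : ∀ n y, 0 ≤ K n y)
    (hlim : ∀ z, Tendsto (fun n => jumpExponent (K n) z) atTop (𝓝 (ψ z)))
    (hψ : Integrable fun z => Real.exp (-ψ z)) : IsCosPositive fun z => Real.exp (-ψ z) := by
  have hψ0 : ∀ z, 0 ≤ ψ z := fun z =>
    ge_of_tendsto' (hlim z) fun n => jumpExponent_nonneg (hK n) (hK0 n) z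
  have hgauss : ∀ b : ℝ, 0 < b →
      IsCosPositive fun z => Real.exp (-ψ z) * Real.exp (-(b * ‖z‖ ^ 2)) := by
    intro b hb
    have hg := isCosPositive_exp_neg_mul_sq_norm (E := E) hb
    exact .of_tendsto (fun n => hg.exp_neg_jumpExponent_mul (hK n) (hK0 n))
      (hg.integrable.mono (hψ.1.mul hg.integrable.1)
        (ae_of_all _ fun z => norm_exp_neg_mul_le (hψ0 z) _))
      hg.integrable.norm (fun n z => norm_exp_neg_mul_le (jumpExponent_nonneg (hK n) (hK0 n) z) _)
      fun z => (hlim z).neg.rexp.mul_const _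
  refine .of_tendsto (fun n : ℕ => hgauss (1 / ((n : ℝ) + 1)) (by positivity)) hψ hψ.norm
    (fun n z => ?_) fun z => ?_
  · rw [mul_comm]
    exact norm_exp_neg_mul_le (by positivity) _
  · have hone : Tendsto (fun n : ℕ => Real.exp (-(1 / ((n : ℝ) + 1) * ‖z‖ ^ 2))) atTop (𝓝 1) := by
      simpa only [zero_mul, neg_zero, Real.exp_zero] using
        (tendsto_one_div_add_atTop_nhds_zero_nat.mul_const (‖z‖ ^ 2)).neg.rexp
    simpa only [mul_one] using hone.const_mul (Real.exp (-ψ z))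

lemma IsCosPositive.exists_le_cosTransform_cosTransform_mul (hφ : IsCosPositive φ)
    (hφ0 : 0 < cosTransform φ 0) :
    ∃ c : ℝ, 0 < c ∧ ∀ J : E → ℝ, Integrable J → (∀ y, 0 ≤ J y) → ∀ (x : E) (m : ℝ),
      (∀ y ∈ Metric.ball x 1, m ≤ J y) →
        m * c ≤ cosTransform (fun z => cosTransform J z * φ z) x := by
  set Q := cosTransform φ
  have hQ_cont : Continuous Q := continuous_cosTransform hφ.integrable
  obtain ⟨η, hη, hball⟩ := Metric.eventually_nhds_iff.1
    (hQ_cont.continuousAt.eventually (lt_mem_nhds (half_lt_self hφ0)))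
  set r := min η 1
  have hr : 0 < r := lt_min hη one_pos
  refine ⟨1 / 2 * (Q 0 / 2) * volume.real (Metric.ball (0 : E) r), mul_pos (by positivity)
    (ENNReal.toReal_pos (Metric.measure_ball_pos _ _ hr).ne' measure_ball_lt_top.ne),
    fun J hJ hJ0 x m hm => ?_⟩
  have h_int : Integrable fun y => 1 / 2 * (J y * (Q (x + y) + Q (x - y))) :=
    (hJ.mul_bdd (c := (∫ z, ‖φ z‖) + ∫ z, ‖φ z‖)
      (Continuous.aestronglyMeasurable (f := fun y => Q (x + y) + Q (x - y)) (by fun_prop))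
      (ae_of_all _ fun y => (norm_add_le _ _).trans (add_le_add
        (abs_cosTransform_le hφ.integrable _) (abs_cosTransform_le hφ.integrable _)))).const_mul _
  have hlower : ∀ y ∈ Metric.ball x r,
      1 / 2 * (m * (Q 0 / 2)) ≤ 1 / 2 * (J y * (Q (x + y) + Q (x - y))) := fun y hy => by
    rw [mem_ball_iff_norm] at hy
    have hQ : Q 0 / 2 < Q (x - y) :=
      hball (by simpa only [dist_zero_right, norm_sub_rev] using hy.trans_le (min_le_left _ _))
    have hmJ : m ≤ J y := hm y (mem_ball_iff_norm.2 (hy.trans_le (min_le_right _ _)))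
    have hJy := hJ0 y
    gcongr
    linarith [hφ.nonneg (x + y)]
  rw [cosTransform_cosTransform_mul hφ.integrable hJ]
  calc _ = 1 / 2 * (m * (Q 0 / 2)) * volume.real (Metric.ball x r) := by
        rw [Measure.real, Measure.real, Measure.addHaar_ball_center volume x]
        ring
    _ ≤ ∫ y in Metric.ball x r, 1 / 2 * (J y * (Q (x + y) + Q (x - y))) :=
        setIntegral_ge_of_const_le_real Metric.isOpen_ball.measurableSet measure_ball_lt_top.ne
          hlower h_int.integrableOn
    _ ≤ _ := setIntegral_le_integral h_int (ae_of_all _ fun y => mul_nonneg one_half_pos.le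
        (mul_nonneg (hJ0 y) (add_nonneg (hφ.nonneg _) (hφ.nonneg _))))

lemma integrable_jumpDensity (hα : 0 < α) (hδ : 0 < δ) :
    Integrable (jumpDensity α κ δ : E → ℝ) :=
  (integrable_add_norm_rpow_neg volume hδ (lt_add_of_pos_right _ hα)).const_mul κ

lemma integrable_exp_neg_sub_jumpExponent (hα : 0 < α) (hν : 0 < ν) (hJ : Integrable J) :
    Integrable fun z => Real.exp (-(ν * ‖z‖ ^ α - jumpExponent J z)) := by
  have hstable : Integrable fun z : E => Real.exp (-(ν * ‖z‖ ^ α)) := by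
    simpa only [Real.rpow_zero, one_mul] using
      integrable_norm_rpow_mul_exp_neg (E := E) volume hα le_rfl hν
  have hfactor : ∀ z, Real.exp (-(ν * ‖z‖ ^ α - jumpExponent J z)) =
      Real.exp (jumpExponent J z) * Real.exp (-(ν * ‖z‖ ^ α)) := fun z => by
    rw [← Real.exp_add]
    ring_nf
  simp only [hfactor]
  refine hstable.bdd_mul (c := Real.exp (2 * ∫ y, ‖J y‖))
    (continuous_jumpExponent hJ).rexp.aestronglyMeasurable (ae_of_all _ fun z => ?_)
  rw [Real.norm_of_nonneg (Real.exp_pos _).le]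
  exact Real.exp_le_exp.2 (jumpExponent_le hJ z)

variable [Nontrivial E]

lemma tendsto_jumpExponent_jumpDensity (hα : 0 < α) (hα2 : α < 2) (hκ : 0 ≤ κ) (z : E) :
    Tendsto (fun n : ℕ => jumpExponent (jumpDensity α κ (1 / ((n : ℝ) + 1))) z) atTop
      (𝓝 (∫ y, κ * levyIntegrand α z y)) := by
  have hδ : ∀ n : ℕ, 0 < 1 / ((n : ℝ) + 1) := fun n => by positivity
  have h_ae_pos : ∀ᵐ y : E, 0 < ‖y‖ := by
    filter_upwards [Measure.ae_ne volume (0 : E)] with y hy using norm_pos_iff.2 hy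
  have hJ : ∀ n : ℕ, Integrable (jumpDensity α κ (1 / ((n : ℝ) + 1)) : E → ℝ) := fun n =>
    integrable_jumpDensity hα (hδ n)
  simp only [fun n => jumpExponent_eq_integral (hJ n)]
  refine tendsto_integral_of_dominated_convergence (fun y => κ * levyIntegrand α z y)
    (fun n => ?_) ((integrable_levyIntegrand hα hα2 z).const_mul κ) (fun n => ?_) ?_
  · exact Continuous.aestronglyMeasurable (by fun_prop) |>.mul (hJ n).1
  · filter_upwards [h_ae_pos] with y hy
    rw [Real.norm_of_nonneg
      (mul_nonneg (one_sub_cos_nonneg _) (jumpDensity_nonneg hκ (hδ n).le y)),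
      levyIntegrand, jumpDensity, mul_left_comm]
    gcongr κ * (_ * ?_)
    · exact one_sub_cos_nonneg _
    · exact Real.rpow_le_rpow_of_nonpos hy (by linarith [hδ n]) (neg_nonpos.2 (by positivity))
  · filter_upwards [h_ae_pos] with y hy
    have hshift : Tendsto (fun n : ℕ => 1 / ((n : ℝ) + 1) + ‖y‖) atTop (𝓝 ‖y‖) := by
      simpa only [zero_add] using tendsto_one_div_add_atTop_nhds_zero_nat.add_const ‖y‖
    rw [levyIntegrand, mul_left_comm κ]
    exact ((hshift.rpow_const (Or.inl hy.ne')).const_mul κ).const_mul _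

lemma isCosPositive_exp_neg_sub_jumpExponent (hα : 0 < α) (hα2 : α < 2) (hν : 0 < ν) (hκ : 0 ≤ κ)
    (hrep : ∀ z : E, ∫ y, κ * levyIntegrand α z y = ν * ‖z‖ ^ α) :
    IsCosPositive fun z : E =>
      Real.exp (-(ν * ‖z‖ ^ α - jumpExponent (jumpDensity α κ 1) z)) := by
  have hδ : ∀ n : ℕ, 0 < 1 / ((n : ℝ) + 1) := fun n => by positivity
  have hδ1 : ∀ n : ℕ, 1 / ((n : ℝ) + 1) ≤ 1 := fun n =>
    div_le_one_of_le₀ (by linarith [(Nat.cast_nonneg n : (0 : ℝ) ≤ n)]) (by positivity)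
  have hJ₁ : Integrable (jumpDensity α κ 1 : E → ℝ) := integrable_jumpDensity hα one_pos
  have hJ : ∀ n : ℕ, Integrable (jumpDensity α κ (1 / ((n : ℝ) + 1)) : E → ℝ) := fun n =>
    integrable_jumpDensity hα (hδ n)
  refine isCosPositive_exp_neg_of_tendsto_jumpExponent (fun n => (hJ n).sub hJ₁)
    (fun n y => sub_nonneg.2 (jumpDensity_anti hα.le hκ (hδ n) (hδ1 n) y)) (fun z => ?_)
    (integrable_exp_neg_sub_jumpExponent hα hν hJ₁)
  simp only [jumpExponent_sub (hJ _) hJ₁, ← hrep]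
  exact (tendsto_jumpExponent_jumpDensity hα hα2 hκ z).sub_const _

/-- The jumps with density `jumpDensity α κ 1` form an independent compound Poisson part of the
stable law, and already a single such jump produces the tail. -/
lemma exists_le_cosTransform_exp_neg_rpow (E : Type*) [NormedAddCommGroup E]
    [InnerProductSpace ℝ E] [FiniteDimensional ℝ E] [MeasurableSpace E] [BorelSpace E]
    [Nontrivial E] (hα : 0 < α) (hα2 : α < 2) (hν : 0 < ν) :
    ∃ c : ℝ, 0 < c ∧ ∀ x : E, c * (1 + ‖x‖) ^ (-(Module.finrank ℝ E + α)) ≤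
      cosTransform (fun z => Real.exp (-(ν * ‖z‖ ^ α))) x := by
  obtain ⟨κ, hκ, hrep⟩ := exists_levy_representation (E := E) hα hα2 hν
  set J : E → ℝ := jumpDensity α κ 1
  have hJ : Integrable J := integrable_jumpDensity hα one_pos
  have hJ0 : ∀ y, 0 ≤ J y := jumpDensity_nonneg hκ.le zero_le_one
  set φ : E → ℝ := fun z => Real.exp (-(ν * ‖z‖ ^ α - jumpExponent J z))
  have hφ : IsCosPositive φ := isCosPositive_exp_neg_sub_jumpExponent hα hα2 hν hκ.le hrep
  have hφ0 : 0 < cosTransform φ 0 := (integral_exp_pos hφ.integrable).trans_eq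
    (cosTransform_zero φ).symm
  obtain ⟨c, hc, hle⟩ := hφ.exists_le_cosTransform_cosTransform_mul hφ0
  have hsplit : ∀ z, Real.exp (-(ν * ‖z‖ ^ α)) =
      Real.exp (-cosTransform J 0) * (Real.exp (cosTransform J z) * φ z) := fun z => by
    rw [← Real.exp_add, ← Real.exp_add, jumpExponent]
    ring_nf
  refine ⟨Real.exp (-cosTransform J 0) * (κ * (2 ^ (Module.finrank ℝ E + α))⁻¹ * c),
    by positivity, fun x => ?_⟩
  simp only [hsplit, cosTransform_const_mul, mul_assoc (Real.exp _)]
  gcongr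
  calc _ = κ * (2 ^ (Module.finrank ℝ E + α))⁻¹ * (1 + ‖x‖) ^ (-(Module.finrank ℝ E + α)) * c :=
        by ring
    _ ≤ cosTransform (fun z => cosTransform J z * φ z) x := hle J hJ hJ0 x _ fun y hy =>
        mul_one_add_norm_rpow_neg_le_jumpDensity hα.le hκ.le hy
    _ ≤ _ := hφ.cosTransform_cosTransform_mul_le hJ hJ0 x

end LowerBound

section HeatKernel

variable {d : ℕ} {α ν s : ℝ}

lemma heatKernel_eq_cosTransform (hα : 0 < α) (hν : 0 < ν) (hs : 0 < s) (x : Space d) :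
    heatKernel α ν s x =
      ((2 * Real.pi) ^ d)⁻¹ * cosTransform (fun z => Real.exp (-(s * ν * ‖z‖ ^ α))) x := by
  have h_int : Integrable fun z : Space d => Real.exp (-(s * ν * ‖z‖ ^ α)) := by
    simpa only [Real.rpow_zero, one_mul] using
      integrable_norm_rpow_mul_exp_neg (E := Space d) volume hα le_rfl (mul_pos hs hν)
  rw [heatKernel_eq_re_integral, ← cosTransform_neg, cosTransform_eq_re_integral h_int]
  simp only [planeWave_comm (-x), heatSymbol_eq_ofReal, neg_mul]

lemma exists_le_heatKernel_one [Nontrivial (Space d)] (hα : 0 < α) (hα2 : α < 2) (hν : 0 < ν) :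
    ∃ c : ℝ, 0 < c ∧ ∀ x : Space d, c * (1 + ‖x‖) ^ (-(d + α)) ≤ heatKernel α ν 1 x := by
  obtain ⟨c, hc, hle⟩ :=
    exists_le_cosTransform_exp_neg_rpow (Space d) hα hα2 (mul_pos one_pos hν)
  refine ⟨((2 * Real.pi) ^ d)⁻¹ * c, by positivity, fun x => ?_⟩
  rw [heatKernel_eq_cosTransform hα hν one_pos, mul_assoc]
  gcongr
  simpa only [finrank_euclideanSpace_fin] using hle x

lemma heatKernel_smul {r : ℝ} (hr : 0 < r) (s : ℝ) (x : Space d) :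
    heatKernel α ν (r ^ α * s) (r • x) = (r ^ d)⁻¹ * heatKernel α ν s x := by
  have hscale : ∀ z : Space d, planeWave z (-(r • x)) * heatSymbol α ν (r ^ α * s) z =
      planeWave (r • z) (-x) * heatSymbol α ν s (r • z) := fun z => by
    rw [planeWave, planeWave, inner_neg_right, inner_neg_right, real_inner_smul_left,
      real_inner_smul_right, heatSymbol_eq_ofReal, heatSymbol_eq_ofReal, norm_smul,
      Real.norm_of_nonneg hr.le, Real.mul_rpow hr.le (norm_nonneg _)]
    ring_nf
  simp only [heatKernel_eq_re_integral, hscale]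
  rw [Measure.integral_comp_smul volume fun z => planeWave z (-x) * heatSymbol α ν s z,
    finrank_euclideanSpace_fin, abs_of_pos (by positivity), Complex.smul_re, smul_eq_mul]
  ring

end HeatKernel

/-! ### Rescaling -/

section Rescaling

variable {d : ℕ} {Ω : Type*} [MeasurableSpace Ω] {P : Measure Ω}
  {X : ℝ≥0 → Ω → (Fin d → ℤ)} {α ν a ε t : ℝ}

lemma localError_smul_toSpace (hX : Measurable (X (t / ε ^ α).toNNReal)) (hε : 0 < ε)
    (k : Fin d → ℤ) :
    localError P X α ν ε t (ε • toSpace k) = (ε ^ d)⁻¹ *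
      |(P.map (X (t / ε ^ α).toNNReal)).real {k} - heatKernel α ν (t / ε ^ α) (toSpace k)| := by
  have hset : {ω | ε • toSpace (X (t / ε ^ α).toNNReal ω) = ε • toSpace k} =
      X (t / ε ^ α).toNNReal ⁻¹' {k} := by
    ext ω
    rw [Set.mem_ofPred_eq, smul_right_inj hε.ne', toSpace_injective.eq_iff, Set.mem_preimage,
      Set.mem_singleton_iff]
  have hkernel : heatKernel α ν t (ε • toSpace k) =
      (ε ^ d)⁻¹ * heatKernel α ν (t / ε ^ α) (toSpace k) := by
    rw [← heatKernel_smul hε, mul_div_cancel₀ _ (by positivity)]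
  rw [localError, hset, hkernel, map_measureReal_apply hX (measurableSet_singleton k), ← mul_sub,
    abs_mul, abs_of_pos (by positivity)]

variable [IsProbabilityMeasure P] {μ : Measure (Fin d → ℤ)} [IsProbabilityMeasure μ]

lemma IsRateOneWalk.charFn_map_eq_walkSymbol (hX : IsRateOneWalk P μ X) {s : ℝ} (hs : 0 ≤ s) :
    charFn (P.map (X s.toNNReal)) = walkSymbol μ s := by
  ext z
  rw [hX.charFn_map, Real.coe_toNNReal s hs, walkSymbol]

lemma IsRateOneWalk.localError_le {b : ℝ} (hX : IsRateOneWalk P μ X) (hε : 0 < ε) (ht : 0 ≤ t)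
    (k : Fin d → ℤ)
    (hb : ∀ ρ : Measure (Fin d → ℤ), IsProbabilityMeasure ρ →
      charFn ρ = walkSymbol μ (t / ε ^ α) →
        |ρ.real {k} - heatKernel α ν (t / ε ^ α) (toSpace k)| ≤ b) :
    localError P X α ν ε t (ε • toSpace k) ≤ (ε ^ d)⁻¹ * b := by
  rw [localError_smul_toSpace (hX.measurable _) hε]
  gcongr
  exact hb _ (Measure.isProbabilityMeasure_map (hX.measurable _).aemeasurable)
    (hX.charFn_map_eq_walkSymbol (by positivity))

lemma exists_localError_le (hX : IsRateOneWalk P μ X) (h1 : Assumption1 μ α ν a) (hα : 0 < α)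
    (hν : 0 < ν) (ha : 0 < a) :
    ∃ C : ℝ, 0 ≤ C ∧ ∀ ε t : ℝ, 0 < ε → ε ^ α ≤ t → ∀ x ∈ lattice d ε,
      localError P X α ν ε t x ≤ C * (ε ^ a / t ^ ((d + a) / α)) := by
  obtain ⟨C, hC0, hC⟩ := h1.exists_abs_measureReal_sub_heatKernel_le hα hν ha
  refine ⟨C, hC0, ?_⟩
  rintro ε t hε hεt _ ⟨k, rfl⟩
  have hεα : 0 < ε ^ α := by positivity
  have ht : 0 < t := hεα.trans_le hεt
  have hpow : (t / ε ^ α) ^ (-((d + a) / α)) = ε ^ d * (ε ^ a / t ^ ((d + a) / α)) := by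
    rw [Real.rpow_neg (by positivity), Real.div_rpow ht.le hεα.le, ← Real.rpow_mul hε.le,
      mul_div_cancel₀ _ hα.ne', Real.rpow_add hε, Real.rpow_natCast, inv_div, mul_div_assoc]
  calc _ ≤ (ε ^ d)⁻¹ * (C * (t / ε ^ α) ^ (-((d + a) / α))) := hX.localError_le hε ht.le k
        fun ρ hρ hρ_charFn => hC _ ((one_le_div hεα).2 hεt) ρ hρ hρ_charFn k
    _ = C * (ε ^ a / t ^ ((d + a) / α)) := by rw [hpow]; field_simp

lemma exists_localError_le_div_norm (hX : IsRateOneWalk P μ X) (h1 : Assumption1 μ α ν a)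
    (h2 : Assumption2 μ α ν a) (hα : 0 < α) (hν : 0 < ν) (ha : 0 < a) (hαa : α + a < 3) :
    ∃ C : ℝ, 0 ≤ C ∧ ∀ ε t : ℝ, 0 < ε → ε ^ α ≤ t → ∀ x ∈ lattice d ε, x ≠ 0 →
      localError P X α ν ε t x ≤ C * (t * ε ^ a / ‖x‖ ^ (d + α + a)) := by
  obtain ⟨C, hC0, hC⟩ := exists_abs_measureReal_sub_heatKernel_le_div_norm h1 h2 hα hν ha hαa
  refine ⟨C, hC0, ?_⟩
  rintro ε t hε hεt _ ⟨k, rfl⟩ hx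
  have hεα : 0 < ε ^ α := by positivity
  have hk : (toSpace k : Space d) ≠ 0 := right_ne_zero_of_smul hx
  have hk0 : k ≠ 0 := by
    rintro rfl
    exact hk (by ext; simp [toSpace])
  have hpow : ‖ε • (toSpace k : Space d)‖ ^ (d + α + a) =
      ε ^ d * ε ^ α * ε ^ a * ‖(toSpace k : Space d)‖ ^ (d + α + a) := by
    rw [norm_smul, Real.norm_of_nonneg hε.le, Real.mul_rpow hε.le (norm_nonneg _),
      Real.rpow_add hε, Real.rpow_add hε, Real.rpow_natCast]
  calc _ ≤ (ε ^ d)⁻¹ * (C * (t / ε ^ α / ‖(toSpace k : Space d)‖ ^ (d + α + a))) :=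
        hX.localError_le hε (hεα.le.trans hεt) k
          fun ρ hρ hρ_charFn => hC _ ((one_le_div hεα).2 hεt) ρ hρ hρ_charFn k hk0
    _ = C * (t * ε ^ a / ‖ε • (toSpace k : Space d)‖ ^ (d + α + a)) := by
        rw [hpow]
        field_simp

lemma exists_localError_le_div_max (hX : IsRateOneWalk P μ X) (h1 : Assumption1 μ α ν a)
    (h2 : Assumption2 μ α ν a) (hα : 0 < α) (hν : 0 < ν) (ha : 0 < a) (hαa : α + a < 3) :
    ∃ C : ℝ, 0 ≤ C ∧ ∀ ε t : ℝ, 0 < ε → ε ^ α ≤ t → ∀ x ∈ lattice d ε,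
      localError P X α ν ε t x ≤ C * (t * ε ^ a / max (t ^ (1 / α)) ‖x‖ ^ (d + α + a)) := by
  obtain ⟨C₁, hC₁0, hC₁⟩ := exists_localError_le hX h1 hα hν ha
  obtain ⟨C₂, -, hC₂⟩ := exists_localError_le_div_norm hX h1 h2 hα hν ha hαa
  refine ⟨max C₁ C₂, hC₁0.trans (le_max_left _ _), fun ε t hε hεt x hx => ?_⟩
  have ht : 0 < t := (Real.rpow_pos_of_pos hε α).trans_le hεt
  rcases le_or_gt ‖x‖ (t ^ (1 / α)) with hxt | hxt
  · have hpow : (t ^ (1 / α)) ^ (d + α + a) = t * t ^ ((d + a) / α) := by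
      rw [← Real.rpow_mul ht.le, ← Real.rpow_one_add' ht.le (by positivity)]
      congr 1
      field_simp
      ring
    rw [max_eq_left hxt, hpow, mul_div_mul_left _ _ ht.ne']
    exact (hC₁ ε t hε hεt x hx).trans (by gcongr; exact le_max_left _ _)
  · have hx0 : x ≠ 0 := norm_pos_iff.1 ((Real.rpow_pos_of_pos ht _).trans hxt)
    rw [max_eq_right hxt.le]
    exact (hC₂ ε t hε hεt x hx hx0).trans (by gcongr; exact le_max_right _ _)

lemma exists_le_heatKernel [Nontrivial (Space d)] (hα : 0 < α) (hα2 : α < 2) (hν : 0 < ν) :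
    ∃ c : ℝ, 0 < c ∧ ∀ t : ℝ, 0 < t → ∀ x : Space d,
      c * (t / (t ^ (1 / α) + ‖x‖) ^ (d + α)) ≤ heatKernel α ν t x := by
  obtain ⟨c, hc, hle⟩ := exists_le_heatKernel_one (d := d) hα hα2 hν
  refine ⟨c, hc, fun t ht x => ?_⟩
  have hr : 0 < t ^ (1 / α) := by positivity
  have hrα : (t ^ (1 / α)) ^ α = t := by
    rw [one_div, Real.rpow_inv_rpow ht.le hα.ne']
  set r := t ^ (1 / α)
  have hkernel : heatKernel α ν t x = (r ^ d)⁻¹ * heatKernel α ν 1 (r⁻¹ • x) := by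
    rw [← heatKernel_smul hr, smul_inv_smul₀ hr.ne', hrα, mul_one]
  have hpow : (1 + ‖r⁻¹ • x‖) ^ (-(d + α)) = r ^ d * (t / (r + ‖x‖) ^ (d + α)) := by
    have hsum : 1 + ‖r⁻¹ • x‖ = (r + ‖x‖) / r := by
      rw [norm_smul, Real.norm_of_nonneg (by positivity)]
      field_simp
    rw [hsum, Real.rpow_neg (by positivity), Real.div_rpow (by positivity) hr.le, inv_div,
      Real.rpow_add hr, Real.rpow_natCast, hrα, mul_div_assoc]
  calc c * (t / (r + ‖x‖) ^ (d + α))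
      = (r ^ d)⁻¹ * (c * (1 + ‖r⁻¹ • x‖) ^ (-(d + α))) := by rw [hpow]; field_simp
    _ ≤ heatKernel α ν t x := by rw [hkernel]; gcongr; exact hle _

lemma exists_localError_le_mul_heatKernel [Nontrivial (Space d)] (hX : IsRateOneWalk P μ X)
    (h1 : Assumption1 μ α ν a) (h2 : Assumption2 μ α ν a) (hα : 0 < α) (hα2 : α < 2) (hν : 0 < ν)
    (ha : 0 < a) (hαa : α + a < 3) :
    ∃ C : ℝ, ∀ ε t : ℝ, 0 < ε → ε ^ α ≤ t → ∀ x ∈ lattice d ε,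
      localError P X α ν ε t x ≤ C * (ε ^ a * heatKernel α ν t x / t ^ (a / α)) := by
  obtain ⟨C, hC0, hC⟩ := exists_localError_le_div_max hX h1 h2 hα hν ha hαa
  obtain ⟨c, hc, hle⟩ := exists_le_heatKernel (d := d) hα hα2 hν
  refine ⟨C * (2 ^ (d + α) / c), fun ε t hε hεt x hx => ?_⟩
  have ht : 0 < t := (Real.rpow_pos_of_pos hε α).trans_le hεt
  have hr : 0 < t ^ (1 / α) := by positivity
  have hra : (t ^ (1 / α)) ^ a = t ^ (a / α) := by
    rw [← Real.rpow_mul ht.le, one_div_mul_eq_div]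
  set r := t ^ (1 / α)
  have hpow : t ^ (a / α) * ((r + ‖x‖) ^ (d + α) / 2 ^ (d + α)) ≤ max r ‖x‖ ^ (d + α + a) := by
    rw [Real.rpow_add (lt_max_of_lt_left hr), mul_comm, ← hra,
      ← Real.div_rpow (by positivity) zero_le_two]
    gcongr
    · linarith [le_max_left r ‖x‖, le_max_right r ‖x‖]
    · exact le_max_left _ _
  calc _ ≤ C * (t * ε ^ a / max r ‖x‖ ^ (d + α + a)) := hC ε t hε hεt x hx
    _ ≤ C * (t * ε ^ a / (t ^ (a / α) * ((r + ‖x‖) ^ (d + α) / 2 ^ (d + α)))) := by gcongr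
    _ = C * (2 ^ (d + α) / c) *
        (ε ^ a * (c * (t / (r + ‖x‖) ^ (d + α))) / t ^ (a / α)) := by field_simp
    _ ≤ _ := by gcongr; exact hle t ht x

end Rescaling

end LocalLimit

theorem mainTheorem7_general {d : ℕ} (hd : 1 ≤ d) {α ν a : ℝ} (hα : 0 < α) (hν : 0 < ν)
    (ha : 0 < a)
    (μ : MeasureTheory.Measure (Fin d → ℤ)) [MeasureTheory.IsProbabilityMeasure μ]
    {Ω : Type*} [MeasurableSpace Ω] (P : MeasureTheory.Measure Ω)
    [MeasureTheory.IsProbabilityMeasure P]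
    (X : NNReal → Ω → (Fin d → ℤ)) (hX : LocalLimit.IsRateOneWalk P μ X)
    (h1 : LocalLimit.Assumption1 μ α ν a) :
    (∃ C : ℝ, ∀ ε t : ℝ, 0 < ε → ε ^ α ≤ t → ∀ x ∈ LocalLimit.lattice d ε,
      LocalLimit.localError P X α ν ε t x ≤ C * (ε ^ a / t ^ ((d + a) / α))) ∧
    (LocalLimit.Assumption2 μ α ν a → α + a < 3 →
      (∃ C : ℝ, ∀ ε t : ℝ, 0 < ε → ε ^ α ≤ t → ∀ x ∈ LocalLimit.lattice d ε, x ≠ 0 →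
        LocalLimit.localError P X α ν ε t x ≤ C * (t * ε ^ a / ‖x‖ ^ (d + α + a))) ∧
      (α < 2 →
        ∃ C : ℝ, ∀ ε t : ℝ, 0 < ε → ε ^ α ≤ t → ∀ x ∈ LocalLimit.lattice d ε,
          LocalLimit.localError P X α ν ε t x ≤
            C * (ε ^ a * LocalLimit.heatKernel α ν t x / t ^ (a / α)))) := by
  have : Nonempty (Fin d) := ⟨⟨0, hd⟩⟩
  refine ⟨?_, fun h2 hαa => ⟨?_, fun hα2 => ?_⟩⟩
  · obtain ⟨C, -, hC⟩ := LocalLimit.exists_localError_le (ν := ν) hX h1 hα hν ha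
    exact ⟨C, hC⟩
  · obtain ⟨C, -, hC⟩ := LocalLimit.exists_localError_le_div_norm hX h1 h2 hα hν ha hαa
    exact ⟨C, hC⟩
  · exact LocalLimit.exists_localError_le_mul_heatKernel hX h1 h2 hα hα2 hν ha hαa

theorem mainTheorem7 {d : ℕ} (hd : 1 ≤ d) {α ν a : ℝ} (hα : 0 < α) (hα2 : α ≤ 2) (hν : 0 < ν)
    (ha : 0 < a) (ha1 : a < 1)
    (μ : MeasureTheory.Measure (Fin d → ℤ)) [MeasureTheory.IsProbabilityMeasure μ]
    {Ω : Type*} [MeasurableSpace Ω] (P : MeasureTheory.Measure Ω)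
    [MeasureTheory.IsProbabilityMeasure P]
    (X : NNReal → Ω → (Fin d → ℤ)) (hX : LocalLimit.IsRateOneWalk P μ X)
    (h1 : LocalLimit.Assumption1 μ α ν a) (T : ℝ) (hT : 0 < T) :
    (∃ C : ℝ, ∀ ε t : ℝ, 0 < ε → ε ^ α ≤ t → t ≤ T → ∀ x ∈ LocalLimit.lattice d ε,
      LocalLimit.localError P X α ν ε t x ≤ C * (ε ^ a / t ^ ((d + a) / α))) ∧
    (LocalLimit.Assumption2 μ α ν a →
      (∃ C : ℝ, ∀ ε t : ℝ, 0 < ε → ε ^ α ≤ t → t ≤ T → ∀ x ∈ LocalLimit.lattice d ε,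
        t ^ (1 / α) ≤ ‖x‖ →
        LocalLimit.localError P X α ν ε t x ≤ C * (t * ε ^ a / ‖x‖ ^ (d + α + a))) ∧
      (α < 2 →
        ∃ C : ℝ, ∀ ε t : ℝ, 0 < ε → ε ^ α ≤ t → t ≤ T → ∀ x ∈ LocalLimit.lattice d ε,
          LocalLimit.localError P X α ν ε t x ≤
            C * (ε ^ a * LocalLimit.heatKernel α ν t x / t ^ (a / α)))) := by
  obtain ⟨⟨C, hC⟩, h⟩ := mainTheorem7_general hd hα hν ha μ P X hX h1
  refine ⟨⟨C, fun ε t hε hεt _ => hC ε t hε hεt⟩, fun h2 => ?_⟩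
  obtain ⟨⟨C, hC⟩, h⟩ := h h2 (by linarith)
  refine ⟨⟨C, fun ε t hε hεt _ x hx hxt => hC ε t hε hεt x hx ?_⟩, fun hα2 => ?_⟩
  · have ht : 0 < t := (Real.rpow_pos_of_pos hε α).trans_le hεt
    exact norm_pos_iff.1 ((Real.rpow_pos_of_pos ht _).trans_le hxt)
  · obtain ⟨C, hC⟩ := h hα2
    exact ⟨C, fun ε t hε hεt _ => hC ε t hε hεt⟩
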